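/- Let $(W,S)$ be a Coxeter group with $S$ finite and complete Coxeter graph, i.e. the order $m_{st}$ of $st$ satisfies $3\le m_{st}\le\infty$ for all $s\neq t$ in $S$. Let $l$ be the length function and $L:W\to\mathbb Z$ a positive weight function: $L(ww')=L(w)+L(w')$ whenever $l(ww')=l(w)+l(w')$, and $L(s)>0$ for $s\in S$. Let $\mathcal A=\mathbb Z[q,q^{-1}]$, with $\deg$ the highest exponent of $q$ that occurs and $\deg 0=-\infty$, and let $\mathcal H$ be the Hecke algebra over $\mathcal A$, with basis $T_w$ ($w\in W$) and relations $T_{ww'}=T_wT_{w'}$ if $l(ww')=l(w)+l(w')$, and $T_s^2=1+(q^{L(s)}-q^{-L(s)})T_s$ for $s\in S$. The bar involution is the ring endomorphism of $\mathcal H$ with $\bar q=q^{-1}$, $\overline{T_w}=T_{w^{-1}}^{-1}$. The Kazhdan–Lusztig basis element $C_w=\sum_y p_{y,w}T_y$ is the unique bar invariant element of $T_w+\bigoplus_y q^{-1}\mathbb Z[q^{-1}]T_y$. Write $C_xC_y=\sum_z h_{x,y,z}C_z$ and put: * $\mathbf a(w)=\max_{x,y}\deg h_{x,y,w}\in\mathbb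 N\cup\{\infty\}$, $W_{>N}=\{w:\mathbf a(w)>N\}$, $W_{\le N}=W\setminus W_{>N}$; * $\gamma_{x,y,z^{-1}}$ is the coefficient of $q^{\mathbf a(z)}$ in $h_{x,y,z}$, and $\Delta(w)=-\deg p_{e,w}$; * $\prec_L$ (resp. $\prec_{LR}$) is the preorder on $W$ generated by $w'\prec w$ whenever $C_{w'}$ occurs with non-zero coefficient in $C_sC_w$ (resp. in $C_sC_w$ or $C_wC_s$) for some $s\in S$; $\sim_L$ is the equivalence relation of $\prec_L$. Let $D\subset W$ consist of (i) the longest elements $w_J$ of the finite standard parabolic subgroups $W_J$, $J\subset S$, with $\mathbf a'(w_J)=L(w_J)$; and (ii) for $s,t\in S$ with $m_{st}<\infty$ and $L(s)<L(t)$, the alternating product $d=tst\cdots t$ with $m_{st}-1$ factors ($m_{st}$ is then even), with $\mathbf a'(d)=\frac{m_{st}}2L(t)-\bigl(\frac{m_{st}}2-1\bigr)L(s)$. Let $\Omega_{\ge N}$ be the set of all $xdy$ with $d\in D$, $\mathbf a'(d)\ge N$, $x,y\in W$ and $l(xdy)=l(x)+l(d)+l(y)$; put $\Omega_{>N}=\Omega_{\ge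 N+1}$ and $\Omega_N=\Omega_{\ge N}\setminus\Omega_{>N}$. Fix $N\in\mathbb N$ and assume $W_{>N}=\Omega_{>N}$ together with * $(\mathrm{P1})_{>N}$: $\mathbf a(w)\le\Delta(w)$ for all $w\in W_{>N}$; * $(\mathrm{P4})_{>N}$: if $w\in W_{>N}$ and $w'\prec_{LR}w$, then $\mathbf a(w')\ge\mathbf a(w)$; * $(\mathrm{P8})_{>N}$: if $x,y,z\in W$, at least one of them lies in $W_{>N}$, and $\gamma_{x,y,z}\ne0$, then $x\sim_Ly^{-1}$, $y\sim_Lz^{-1}$ and $z\sim_Lx^{-1}$. By $(\mathrm{P4})_{>N}$, the $\mathcal A$-span $\mathcal H_{>N}$ of the $C_w$, $w\in W_{>N}$, is a two-sided ideal of $\mathcal H$. Let $\mathcal H_{\le N}=\mathcal H/\mathcal H_{>N}$ and let ${}^N T_w$ be the image of $T_w$; the ${}^N T_w$ with $w\in W_{\le N}$ form an $\mathcal A$-basis of $\mathcal H_{\le N}$. The degree of an element of $\mathcal H_{\le N}$ is the maximal degree of its coefficients in this basis. Then for all $x,y\in W_{\le N}$, $$\deg\bigl({}^N T_x\,{}^N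 T_y\bigr)\le N,$$ and equality holds only if $x,y\in\Omega_N$. -/

import Mathlib

namespace CoxHecke

noncomputable section

section

/-! ### The exchange property for Coxeter groups -/

section Exchange

variable {B W : Type*} [Group W] {M : CoxeterMatrix B} (cs : CoxeterSystem M W)

open Classical in
/-- The generator `s` acts on `W × ZMod 2` by conjugation on the first factor, and flips the
sign of `(s, ε)`. -/
def signGen (s : B) : Function.End (W × ZMod 2) := fun p =>
  (cs.simple s * p.1 * cs.simple s, p.2 + if p.1 = cs.simple s then 1 else 0)

open Classical in
theorem signGen_prod (ω : List B) (p : W × ZMod 2) :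
    (ω.map (signGen cs)).prod p =
      (cs.wordProd ω * p.1 * (cs.wordProd ω)⁻¹,
        p.2 + ((cs.rightInvSeq ω).count p.1 : ZMod 2)) := by
  induction ω with
  | nil => simp; rfl
  | cons s ω ih =>
    have h1 : ((s :: ω).map (signGen cs)).prod p =
        signGen cs s ((ω.map (signGen cs)).prod p) := by
      simp [List.map_cons, List.prod_cons]; rfl
    rw [h1, ih, signGen]
    ext
    · simp [CoxeterSystem.wordProd_cons, mul_assoc]
    · have h2 : (cs.wordProd ω * p.1 * (cs.wordProd ω)⁻¹ = cs.simple s) ↔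
          ((cs.wordProd ω)⁻¹ * cs.simple s * cs.wordProd ω = p.1) := by
        constructor
        · intro h; rw [← h]; group
        · intro h; rw [← h]; group
      simp only [CoxeterSystem.rightInvSeq, List.count_cons, h2, beq_iff_eq]
      push_cast
      rw [add_assoc]

open Classical in
theorem signGen_pow (i j : B) (n : ℕ) (p : W × ZMod 2) :
    ((signGen cs i * signGen cs j) ^ n) p =
      ((cs.simple i * cs.simple j) ^ n * p.1 * ((cs.simple i * cs.simple j) ^ n)⁻¹,
        p.2 + ∑ r ∈ Finset.range (2 * n),
          if p.1 = cs.simple j * (cs.simple i * cs.simple j) ^ r then (1 : ZMod 2) else 0) := by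
  induction n with
  | zero => simp; rfl
  | succ n ih =>
    have h1 : ((signGen cs i * signGen cs j) ^ (n + 1)) p =
        signGen cs i (signGen cs j (((signGen cs i * signGen cs j) ^ n) p)) := by
      rw [pow_succ']; rfl
    rw [h1, ih]
    set u := cs.simple i * cs.simple j with hu
    have hinv : u⁻¹ = cs.simple j * cs.simple i := by simp [hu]
    have hc1 : u⁻¹ * cs.simple j = cs.simple j * u := by simp [hu, mul_assoc]
    have hc : ∀ k : ℕ, (u ^ k)⁻¹ * cs.simple j = cs.simple j * u ^ k := by
      intro k
      induction k with
      | zero => simp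
      | succ k ihk =>
        rw [pow_succ, mul_inv_rev, mul_assoc, ihk, ← mul_assoc, hc1, mul_assoc,
          (Commute.refl u).pow_right k]
    have conj_iff : ∀ x y z : W, x * y * x⁻¹ = z ↔ y = x⁻¹ * z * x := by
      intro x y z
      constructor
      · intro h; rw [← h]; group
      · intro h; rw [h]; group
    have e1 : (u ^ n * p.1 * (u ^ n)⁻¹ = cs.simple j) ↔ p.1 = cs.simple j * u ^ (2 * n) := by
      rw [conj_iff, hc, mul_assoc, ← pow_add, two_mul]
    have e2 : (cs.simple j * (u ^ n * p.1 * (u ^ n)⁻¹) * cs.simple j = cs.simple i) ↔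
        p.1 = cs.simple j * u ^ (2 * n + 1) := by
      have : cs.simple i = cs.simple j * (cs.simple j * u) * cs.simple j := by
        simp [hu]
      rw [this, mul_left_inj, mul_right_inj, conj_iff, ← mul_assoc, hc, mul_assoc, mul_assoc,
        ← pow_succ', ← pow_add]
      ring_nf
    rw [show 2 * (n + 1) = 2 * n + 1 + 1 by ring, Finset.sum_range_succ, Finset.sum_range_succ]
    simp only [signGen, e1, e2]
    ext
    · dsimp only
      rw [show u ^ (n + 1) = u * u ^ n from pow_succ' u n, mul_inv_rev, hinv]
      nth_rewrite 3 [hu]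
      simp only [mul_assoc]
    · simp [add_assoc]

theorem signGen_liftable : M.IsLiftable (signGen cs) := by
  classical
  intro i j
  funext p
  rw [signGen_pow, two_mul, Finset.sum_range_add, cs.simple_mul_simple_pow]
  have : ∀ x, (cs.simple i * cs.simple j) ^ (M i j + x) = (cs.simple i * cs.simple j) ^ x := by
    intro x; rw [pow_add, cs.simple_mul_simple_pow, one_mul]
  simp only [this, CharTwo.add_self_eq_zero]
  simp
  rfl

/-- The resulting action of `W` on `W × ZMod 2`. -/
def signHom : W →* Function.End (W × ZMod 2) := cs.lift ⟨signGen cs, signGen_liftable cs⟩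

open Classical in
theorem signHom_wordProd (ω : List B) (p : W × ZMod 2) :
    signHom cs (cs.wordProd ω) p =
      (cs.wordProd ω * p.1 * (cs.wordProd ω)⁻¹,
        p.2 + ((cs.rightInvSeq ω).count p.1 : ZMod 2)) := by
  rw [← signGen_prod, CoxeterSystem.wordProd, map_list_prod, List.map_map]
  have : (signHom cs : W → Function.End (W × ZMod 2)) ∘ cs.simple = signGen cs := by
    funext s; simp [signHom]
  rw [this]

/-- If `sw > w`, `wt > w` and `swt < sw`, then `sw = wt`. -/
theorem simple_mul_eq_mul_simple {w : W} {s t : B}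
    (h1 : cs.length w < cs.length (cs.simple s * w))
    (h2 : cs.length w < cs.length (w * cs.simple t))
    (h3 : cs.length (cs.simple s * w * cs.simple t) < cs.length (cs.simple s * w)) :
    cs.simple s * w = w * cs.simple t := by
  classical
  obtain ⟨ω, hω, rfl⟩ := cs.exists_isReduced w
  obtain ⟨ω', hω', e'⟩ := cs.exists_isReduced (cs.simple s * cs.wordProd ω * cs.simple t)
  have n1 : cs.simple t ∉ cs.rightInvSeq ω := fun hmem => by
    have := (cs.isRightInversion_of_mem_rightInvSeq hω hmem).2
    omega
  have n2 : cs.simple t ∉ cs.rightInvSeq ω' := fun hmem => by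
    have := (cs.isRightInversion_of_mem_rightInvSeq hω' hmem).2
    rw [← e', cs.simple_mul_simple_cancel_right] at this
    omega
  by_contra hne
  have n3 : cs.simple t ∉ cs.rightInvSeq (s :: ω) := by
    simp only [CoxeterSystem.rightInvSeq, List.mem_cons, not_or]
    refine ⟨fun h => hne ?_, n1⟩
    rw [h]; group
  have c1 := signHom_wordProd cs ω' (cs.simple t, 0)
  have c2 := signHom_wordProd cs (s :: ω) (cs.simple t, 1)
  have c3 : signHom cs (cs.simple t) (cs.simple t, 0) = (cs.simple t, 1) := by
    simp [signHom, signGen]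
  have c4 : signHom cs (cs.wordProd ω') (cs.simple t, 0) =
      signHom cs (cs.wordProd (s :: ω)) (cs.simple t, 1) := by
    rw [← e', ← cs.wordProd_cons, map_mul, ← c3]; rfl
  rw [c1, c2, List.count_eq_zero_of_not_mem n2, List.count_eq_zero_of_not_mem n3] at c4
  simpa using congrArg Prod.snd c4

end Exchange

end

section

/-! ### Weight functions and the Hecke algebra -/

variable {B W : Type*} [Group W] {M : CoxeterMatrix B}

/-- The ring `ℤ[q, q⁻¹]`; the power `q ^ n` is `LaurentPolynomial.T n`. -/
abbrev LZ : Type := LaurentPolynomial ℤ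

/-- A positive weight function on a Coxeter group. -/
structure WeightFunction (cs : CoxeterSystem M W) where
  /-- the underlying function -/
  toFun : W → ℤ
  map_mul_of_length_add : ∀ w w' : W,
    cs.length (w * w') = cs.length w + cs.length w' → toFun (w * w') = toFun w + toFun w'
  pos : ∀ s : B, 0 < toFun (cs.simple s)

instance (cs : CoxeterSystem M W) : CoeFun (WeightFunction cs) (fun _ => W → ℤ) :=
  ⟨WeightFunction.toFun⟩

variable {cs : CoxeterSystem M W}

/-- `ξ_s = q ^ L(s) - q ^ (-L(s))`. -/
def xi (L : WeightFunction cs) (s : B) : LZ :=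
  LaurentPolynomial.T (L (cs.simple s)) - LaurentPolynomial.T (-L (cs.simple s))

section Operators

variable (L : WeightFunction cs)

open Classical in
/-- Left multiplication by `T_s` on the free module with basis `W`. -/
def lop (s : B) : Module.End LZ (W →₀ LZ) :=
  Finsupp.linearCombination LZ fun w =>
    Finsupp.single (cs.simple s * w) 1 +
      if cs.IsLeftDescent w s then xi L s • Finsupp.single w (1 : LZ) else 0

open Classical in
/-- Right multiplication by `T_s` on the free module with basis `W`. -/
def rop (s : B) : Module.End LZ (W →₀ LZ) :=
  Finsupp.linearCombination LZ fun w =>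
    Finsupp.single (w * cs.simple s) 1 +
      if cs.IsRightDescent w s then xi L s • Finsupp.single w (1 : LZ) else 0

open Classical in
theorem lop_single (s : B) (w : W) : lop L s (Finsupp.single w 1) =
    Finsupp.single (cs.simple s * w) 1 +
      if cs.IsLeftDescent w s then xi L s • Finsupp.single w (1 : LZ) else 0 := by
  simp only [lop, Finsupp.linearCombination_single, one_smul]

open Classical in
theorem rop_single (s : B) (w : W) : rop L s (Finsupp.single w 1) =
    Finsupp.single (w * cs.simple s) 1 +
      if cs.IsRightDescent w s then xi L s • Finsupp.single w (1 : LZ) else 0 := by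
  simp only [rop, Finsupp.linearCombination_single, one_smul]

theorem xi_eq_of_mul_eq {w : W} {s t : B} (h : cs.simple s * w = w * cs.simple t) :
    xi L s = xi L t := by
  have hL : L (cs.simple s) = L (cs.simple t) := by
    rcases cs.length_simple_mul w s with h1 | h1
    · have a1 := L.map_mul_of_length_add (cs.simple s) w (by rw [h1, cs.length_simple]; ring)
      have a2 := L.map_mul_of_length_add w (cs.simple t)
        (by rw [← h, h1, cs.length_simple])
      rw [h] at a1
      linarith
    · have a1 := L.map_mul_of_length_add (cs.simple s) (cs.simple s * w)
        (by rw [cs.simple_mul_simple_cancel_left, cs.length_simple]; omega)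
      have a2 := L.map_mul_of_length_add (w * cs.simple t) (cs.simple t)
        (by rw [cs.simple_mul_simple_cancel_right, cs.length_simple, ← h]; omega)
      rw [cs.simple_mul_simple_cancel_left, h] at a1
      rw [cs.simple_mul_simple_cancel_right] at a2
      linarith
  simp only [xi, hL]

theorem descent_dichotomy (w : W) (s t : B) :
    cs.simple s * w = w * cs.simple t ∨
      ((cs.IsLeftDescent (w * cs.simple t) s ↔ cs.IsLeftDescent w s) ∧
        (cs.IsRightDescent (cs.simple s * w) t ↔ cs.IsRightDescent w t)) := by
  by_cases hne : cs.simple s * w = w * cs.simple t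
  · exact Or.inl hne
  right
  have k1 := cs.length_simple_mul w s
  have k2 := cs.length_mul_simple w t
  have k3 := cs.length_simple_mul (w * cs.simple t) s
  have k4 := cs.length_mul_simple (cs.simple s * w) t
  have x1 := simple_mul_eq_mul_simple cs (w := w) (s := s) (t := t)
  have x2 := simple_mul_eq_mul_simple cs (w := cs.simple s * w) (s := s) (t := t)
  have hne2 : cs.simple s * (cs.simple s * w) ≠ cs.simple s * w * cs.simple t := by
    intro h
    apply hne
    have := congrArg (cs.simple s * ·) h
    simpa [mul_assoc] using this
  simp only [CoxeterSystem.IsLeftDescent, CoxeterSystem.IsRightDescent]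
  simp only [cs.simple_mul_simple_cancel_left, ← mul_assoc] at *
  simp only [mul_assoc] at *
  simp only [hne, imp_false] at x1
  simp only [hne2, imp_false] at x2
  omega

theorem lop_rop_comm (s t : B) : Commute (lop L s) (rop L t) := by
  classical
  refine Finsupp.lhom_ext' fun w => LinearMap.ext_ring ?_
  change lop L s (rop L t (Finsupp.single w 1)) = rop L t (lop L s (Finsupp.single w 1))
  rw [lop_single, rop_single, map_add, map_add, lop_single, rop_single, ← mul_assoc]
  rcases descent_dichotomy (cs := cs) w s t with h | ⟨h1, h2⟩
  · have hx := xi_eq_of_mul_eq L h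
    have e1 : cs.IsLeftDescent (w * cs.simple t) s ↔ ¬ cs.IsRightDescent w t := by
      rw [CoxeterSystem.IsLeftDescent, ← h, cs.simple_mul_simple_cancel_left, h,
        CoxeterSystem.not_isRightDescent_iff]
      have := cs.length_mul_simple w t
      omega
    have e2 : cs.IsRightDescent (cs.simple s * w) t ↔ ¬ cs.IsRightDescent w t := by
      rw [CoxeterSystem.IsRightDescent, h, cs.simple_mul_simple_cancel_right,
        CoxeterSystem.not_isRightDescent_iff]
      have := cs.length_mul_simple w t
      omega
    have e3 : cs.IsLeftDescent w s ↔ cs.IsRightDescent w t := by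
      rw [CoxeterSystem.IsLeftDescent, h]; rfl
    simp only [e1, e2, e3]
    by_cases hd : cs.IsRightDescent w t <;>
      simp only [hd, not_true, not_false_iff, if_true, if_false, map_zero, add_zero, map_smul,
        lop_single, rop_single, e3, hx, h]
  · simp only [h1, h2]
    by_cases hd : cs.IsRightDescent w t <;> by_cases hd' : cs.IsLeftDescent w s <;>
      simp only [hd, hd', if_true, if_false, map_zero, add_zero, map_smul, lop_single, rop_single,
        smul_add, smul_smul, mul_comm (xi L s)] <;> abel

/-- The product of the operators `lop s` along a word. -/
def wordOp (ω : List B) : Module.End LZ (W →₀ LZ) := (ω.map (lop L)).prod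

theorem wordOp_rop_comm (ω : List B) (t : B) : Commute (wordOp L ω) (rop L t) := by
  unfold wordOp
  induction ω with
  | nil => simp
  | cons s ω ih =>
    rw [List.map_cons, List.prod_cons]
    exact (lop_rop_comm L s t).mul_left ih

theorem wordOp_one (ω : List B) (hω : cs.IsReduced ω) :
    wordOp L ω (Finsupp.single 1 1) = Finsupp.single (cs.wordProd ω) 1 := by
  unfold wordOp
  induction ω with
  | nil => simp
  | cons s ω ih =>
    have hr : cs.IsReduced ω := hω.drop 1
    have : ¬ cs.IsLeftDescent (cs.wordProd ω) s := by
      rw [CoxeterSystem.IsLeftDescent, ← cs.wordProd_cons, hω.eq, hr.eq]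
      simp
    rw [List.map_cons, List.prod_cons, Module.End.mul_apply, ih hr, lop_single, if_neg this,
      add_zero, cs.wordProd_cons]

/-- The bilinear product of the Hecke algebra: `T_x` acts as `T_{s_1} ⋯ T_{s_k}` for a reduced
expression `x = s_1 ⋯ s_k`. -/
def mulLeft : (W →₀ LZ) →ₗ[LZ] Module.End LZ (W →₀ LZ) :=
  Finsupp.linearCombination LZ fun w => wordOp L (cs.exists_isReduced w).choose

theorem mulLeft_one (x : W →₀ LZ) : mulLeft L x (Finsupp.single 1 1) = x := by
  induction x using Finsupp.induction_linear with
  | zero => simp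
  | add f g hf hg => rw [map_add, LinearMap.add_apply, hf, hg]
  | single w a =>
    rw [mulLeft, Finsupp.linearCombination_single, LinearMap.smul_apply, wordOp_one L _
      (cs.exists_isReduced w).choose_spec.1, ← (cs.exists_isReduced w).choose_spec.2]
    simp

theorem mulLeft_comm (x : W →₀ LZ) (t : B) : Commute (mulLeft L x) (rop L t) := by
  induction x using Finsupp.induction_linear with
  | zero => simp
  | add f g hf hg => rw [map_add]; exact hf.add_left hg
  | single w a =>
    rw [mulLeft, Finsupp.linearCombination_single]
    exact (wordOp_rop_comm L _ t).smul_left a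

theorem end_ext {f g : Module.End LZ (W →₀ LZ)} (hf : ∀ t, Commute f (rop L t))
    (hg : ∀ t, Commute g (rop L t)) (h : f (Finsupp.single 1 1) = g (Finsupp.single 1 1)) :
    f = g := by
  classical
  refine Finsupp.lhom_ext' fun w => LinearMap.ext_ring ?_
  change f (Finsupp.single w 1) = g (Finsupp.single w 1)
  induction hn : cs.length w generalizing w with
  | zero => rw [cs.length_eq_zero_iff] at hn; rw [hn, h]
  | succ n ih =>
    have hw : w ≠ 1 := by rintro rfl; simp at hn
    obtain ⟨t, ht⟩ := cs.exists_rightDescent_of_ne_one hw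
    have hl := (cs.isRightDescent_iff).1 ht
    have hnd : ¬ cs.IsRightDescent (w * cs.simple t) t := by
      rwa [← cs.isRightDescent_iff_not_isRightDescent_mul]
    have key : Finsupp.single w (1 : LZ) = rop L t (Finsupp.single (w * cs.simple t) 1) := by
      rw [rop_single, if_neg hnd, add_zero, cs.simple_mul_simple_cancel_right]
    have e1 := LinearMap.congr_fun (hf t).eq (Finsupp.single (w * cs.simple t) 1)
    have e2 := LinearMap.congr_fun (hg t).eq (Finsupp.single (w * cs.simple t) 1)
    simp only [Module.End.mul_apply] at e1 e2
    rw [key, e1, e2, ih _ (by omega)]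

theorem mulLeft_mulLeft (x y : W →₀ LZ) :
    mulLeft L (mulLeft L x y) = mulLeft L x * mulLeft L y := by
  refine end_ext L (mulLeft_comm L _)
    (fun t => (mulLeft_comm L x t).mul_left (mulLeft_comm L y t)) ?_
  rw [mulLeft_one, Module.End.mul_apply, mulLeft_one]

theorem mulLeft_single_one : mulLeft L (Finsupp.single 1 1) = 1 :=
  end_ext L (mulLeft_comm L _) (fun _ => Commute.one_left _) (by rw [mulLeft_one]; rfl)

theorem mulLeft_single_simple (s : B) : mulLeft L (Finsupp.single (cs.simple s) 1) = lop L s := by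
  classical
  refine end_ext L (mulLeft_comm L _) (lop_rop_comm L s) ?_
  rw [mulLeft_one, lop_single, if_neg (cs.not_isLeftDescent_one s)]
  simp

end Operators

/-- The Hecke algebra of a weighted Coxeter group: the free `ℤ[q, q⁻¹]`-module with basis
`T_w`, `w ∈ W`, with the product defined below. -/
def Hecke (_L : WeightFunction cs) : Type _ := W →₀ LZ

namespace Hecke

variable (L : WeightFunction cs)

instance : AddCommGroup (Hecke L) := inferInstanceAs (AddCommGroup (W →₀ LZ))

instance : Module LZ (Hecke L) := inferInstanceAs (Module LZ (W →₀ LZ))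

instance : Ring (Hecke L) :=
  { (inferInstance : AddCommGroup (Hecke L)) with
    mul := fun x y => mulLeft L x y
    one := (Finsupp.single 1 1 : W →₀ LZ)
    left_distrib := fun x y z => map_add (mulLeft L x) y z
    right_distrib := fun x y z =>
      LinearMap.congr_fun (map_add (mulLeft L) x y) z
    zero_mul := fun x => LinearMap.congr_fun (map_zero (mulLeft L)) x
    mul_zero := fun x => map_zero (mulLeft L x)
    mul_assoc := fun x y z => LinearMap.congr_fun (mulLeft_mulLeft L x y) z
    one_mul := fun x => LinearMap.congr_fun (mulLeft_single_one L) x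
    mul_one := fun x => mulLeft_one L x }

instance : Algebra LZ (Hecke L) :=
  Algebra.ofModule
    (fun r x y => LinearMap.congr_fun (map_smul (mulLeft L) r x) y)
    (fun r x y => map_smul (mulLeft L x) r y)

/-- The standard basis `T_w`, `w ∈ W`. -/
def stdBasis : Module.Basis W LZ (Hecke L) := ⟨LinearEquiv.refl LZ (W →₀ LZ)⟩

/-- The standard basis element `T_w`. -/
def T (w : W) : Hecke L := stdBasis L w

theorem T_eq (w : W) : T L w = (Finsupp.single w 1 : W →₀ LZ) := rfl

theorem T_one : T L (1 : W) = 1 := rfl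

theorem repr_T (w : W) : (stdBasis L).repr (T L w) = Finsupp.single w 1 := (stdBasis L).repr_self w

open Classical in
theorem T_simple_mul (s : B) (w : W) : T L (cs.simple s) * T L w =
    T L (cs.simple s * w) + if cs.IsLeftDescent w s then xi L s • T L w else 0 := by
  have h : T L (cs.simple s) * T L w = lop L s (Finsupp.single w 1) :=
    LinearMap.congr_fun (mulLeft_single_simple L s) (Finsupp.single w 1)
  rw [h, lop_single]; rfl

theorem T_simple_mul_of_lt {s : B} {w : W} (h : ¬ cs.IsLeftDescent w s) :
    T L (cs.simple s) * T L w = T L (cs.simple s * w) := by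
  classical
  rw [T_simple_mul, if_neg h, add_zero]

/-- The quadratic relation `T_s² = 1 + ξ_s T_s`. -/
theorem T_simple_mul_self (s : B) :
    T L (cs.simple s) * T L (cs.simple s) = 1 + xi L s • T L (cs.simple s) := by
  classical
  rw [T_simple_mul, cs.simple_mul_simple_self, T_one, if_pos]
  simp [CoxeterSystem.IsLeftDescent]

/-- An induction principle along left descents. -/
theorem left_induction {p : W → Prop} (one : p 1)
    (step : ∀ (s : B) (w : W), ¬ cs.IsLeftDescent w s → p w → p (cs.simple s * w)) (w : W) :
    p w := by
  induction hn : cs.length w generalizing w with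
  | zero => rw [cs.length_eq_zero_iff] at hn; rwa [hn]
  | succ n ih =>
    have hw : w ≠ 1 := by rintro rfl; simp at hn
    obtain ⟨s, hs⟩ := cs.exists_leftDescent_of_ne_one hw
    have h1 := step s (cs.simple s * w) (by rwa [← cs.isLeftDescent_iff_not_isLeftDescent_mul])
      (ih _ (by have := (cs.isLeftDescent_iff).1 hs; omega))
    rwa [cs.simple_mul_simple_cancel_left] at h1

/-- The relation `T_{ww'} = T_w T_{w'}` when lengths add up. -/
theorem T_mul_of_length_add (w w' : W) (h : cs.length (w * w') = cs.length w + cs.length w') :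
    T L w * T L w' = T L (w * w') := by
  induction w using left_induction (cs := cs) with
  | one => rw [T_one, one_mul, one_mul]
  | step s w hs ih =>
    have h1 := (cs.not_isLeftDescent_iff).1 hs
    rw [h1, mul_assoc] at h
    have h2 := cs.length_simple_mul (w * w') s
    have h3 := cs.length_mul_le w w'
    have h4 : cs.length (w * w') = cs.length w + cs.length w' := by omega
    rw [← T_simple_mul_of_lt L hs, mul_assoc, ih h4, T_simple_mul_of_lt, mul_assoc]
    rw [cs.not_isLeftDescent_iff]; omega

theorem hecke_induction {p : Hecke L → Prop} (add : ∀ x y, p x → p y → p (x + y))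
    (smul : ∀ (a : LZ) x, p x → p (a • x)) (one : p 1)
    (mul : ∀ (s : B) x, p x → p (T L (cs.simple s) * x)) (x : Hecke L) : p x := by
  have hT : ∀ w, p (T L w) := fun w => by
    induction w using left_induction (cs := cs) with
    | one => exact one
    | step s w hs ih => rw [← T_simple_mul_of_lt L hs]; exact mul s _ ih
  have h0 : p 0 := by simpa using smul 0 1 one
  rw [← (stdBasis L).linearCombination_repr x, Finsupp.linearCombination_apply, Finsupp.sum]
  exact Finset.sum_induction _ p add h0 fun w _ => smul _ _ (hT w)

end Hecke

end

section

variable {B W : Type*} [Group W] {M : CoxeterMatrix B} {cs : CoxeterSystem M W}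

/-! ### Laurent polynomials -/

theorem degree_neg_iff (a : LZ) : a.degree < 0 ↔ ∀ n : ℤ, 0 ≤ n → a.coeff n = 0 := by
  rw [LaurentPolynomial.degree, Finset.max_eq_sup_withBot,
    Finset.sup_lt_iff (WithBot.bot_lt_coe 0)]
  constructor
  · intro h n hn
    by_contra h0
    have := h n (by simpa using h0)
    exact absurd (WithBot.coe_lt_coe.1 this) (not_lt.2 hn)
  · intro h n hn
    refine WithBot.coe_lt_coe.2 ?_
    by_contra h0
    exact (Finsupp.mem_support_iff.1 hn) (h n (not_lt.1 h0))

theorem eq_zero_of_invert_eq {a : LZ} (h1 : a.degree < 0) (h2 : LaurentPolynomial.invert a = a) :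
    a = 0 := by
  rw [degree_neg_iff] at h1
  ext n
  rcases le_total 0 n with hn | hn
  · rw [h1 n hn]; rfl
  · have := congrArg (fun b : LZ => b.coeff n) h2
    simp only [LaurentPolynomial.invert_apply] at this
    rw [← this, h1 (-n) (by omega)]; rfl

theorem exists_symm (a : LZ) :
    ∃ b : LZ, LaurentPolynomial.invert b = b ∧ (a - b).degree < 0 := by
  induction a using LaurentPolynomial.induction_on' with
  | add p q hp hq =>
    obtain ⟨b, hb, hb'⟩ := hp
    obtain ⟨c, hc, hc'⟩ := hq
    refine ⟨b + c, by rw [map_add, hb, hc], ?_⟩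
    rw [degree_neg_iff] at *
    intro n hn
    have e1 := hb' n hn
    have e2 := hc' n hn
    rw [add_sub_add_comm]
    simp only [AddMonoidAlgebra.coeff_add, Finsupp.add_apply, e1, e2, add_zero]
  | C_mul_T n c =>
    rcases lt_trichotomy n 0 with hn | rfl | hn
    · refine ⟨0, map_zero _, ?_⟩
      rw [sub_zero]
      exact lt_of_le_of_lt (LaurentPolynomial.degree_C_mul_T_le n c) (by exact_mod_cast hn)
    · refine ⟨LaurentPolynomial.C c, by simp, ?_⟩
      simp
    · refine ⟨LaurentPolynomial.C c * LaurentPolynomial.T n +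
        LaurentPolynomial.C c * LaurentPolynomial.T (-n), ?_, ?_⟩
      · simp [add_comm]
      · rw [sub_add_cancel_left, ← neg_mul, ← map_neg]
        exact lt_of_le_of_lt (LaurentPolynomial.degree_C_mul_T_le (-n) _)
          (by exact_mod_cast (by omega : -n < 0))

namespace Hecke

variable (L : WeightFunction cs)

/-! ### The bar involution -/

theorem T_simple_mul_inv (s : B) :
    T L (cs.simple s) * (T L (cs.simple s) - algebraMap LZ _ (xi L s)) = 1 := by
  rw [mul_sub, T_simple_mul_self, Algebra.smul_def, Algebra.commutes]; abel

theorem T_inv_mul_simple (s : B) :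
    (T L (cs.simple s) - algebraMap LZ _ (xi L s)) * T L (cs.simple s) = 1 := by
  rw [sub_mul, T_simple_mul_self, Algebra.smul_def]; abel

/-- `T_s` as a unit; its inverse is `T_s - ξ_s`. -/
def unitS (s : B) : (Hecke L)ˣ :=
  ⟨T L (cs.simple s), T L (cs.simple s) - algebraMap LZ _ (xi L s), T_simple_mul_inv L s,
    T_inv_mul_simple L s⟩

theorem isUnit_T (w : W) : IsUnit (T L w) := by
  induction w using left_induction (cs := cs) with
  | one => exact isUnit_one
  | step s w hs ih => rw [← T_simple_mul_of_lt L hs]; exact (unitS L s).isUnit.mul ih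

/-- The bar involution as an additive map: `q ↦ q⁻¹` and `T_w ↦ (T_{w⁻¹})⁻¹`. -/
def barAdd : Hecke L →+ Hecke L :=
  Finsupp.liftAddHom fun w : W =>
    ((AddMonoidHom.mulRight (Ring.inverse (T L w⁻¹))).comp
      (algebraMap LZ (Hecke L)).toAddMonoidHom).comp
      (LaurentPolynomial.invert (R := ℤ)).toAddEquiv.toAddMonoidHom

theorem barAdd_smul_T (a : LZ) (w : W) : barAdd L (a • T L w) =
    LaurentPolynomial.invert a • Ring.inverse (T L w⁻¹) := by
  have h : (a • T L w : Hecke L) = (Finsupp.single w a : W →₀ LZ) := by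
    rw [T_eq]
    exact (Finsupp.smul_single a w 1).trans (by rw [smul_eq_mul, mul_one])
  rw [h, Algebra.smul_def]
  exact Finsupp.liftAddHom_apply_single _ _ _

theorem barAdd_T (w : W) : barAdd L (T L w) = Ring.inverse (T L w⁻¹) := by
  have := barAdd_smul_T L 1 w
  rwa [one_smul, map_one, one_smul] at this

theorem add_induction {p : Hecke L → Prop} (add : ∀ x y, p x → p y → p (x + y))
    (smul : ∀ (a : LZ) w, p (a • T L w)) (x : Hecke L) : p x := by
  have h0 : p 0 := by simpa using smul 0 1
  rw [← (stdBasis L).linearCombination_repr x, Finsupp.linearCombination_apply, Finsupp.sum]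
  exact Finset.sum_induction _ p add h0 fun w _ => smul _ _

theorem barAdd_smul (a : LZ) (x : Hecke L) :
    barAdd L (a • x) = LaurentPolynomial.invert a • barAdd L x := by
  induction x using add_induction with
  | add x y hx hy => rw [smul_add, map_add, map_add, hx, hy, smul_add]
  | smul b w => rw [smul_smul, barAdd_smul_T, barAdd_smul_T, map_mul, smul_smul]

theorem barAdd_T_simple (s : B) : barAdd L (T L (cs.simple s)) =
    T L (cs.simple s) - algebraMap LZ _ (xi L s) := by
  rw [barAdd_T, cs.inv_simple]
  exact Ring.inverse_unit (unitS L s)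

theorem invert_xi (s : B) : LaurentPolynomial.invert (xi L s) = - xi L s := by
  simp [xi]

theorem barAdd_T_simple_mul_of_lt {s : B} {w : W} (h : ¬ cs.IsLeftDescent w s) :
    barAdd L (T L (cs.simple s * w)) =
      (T L (cs.simple s) - algebraMap LZ _ (xi L s)) * barAdd L (T L w) := by
  have h1 := (cs.not_isLeftDescent_iff).1 h
  rw [barAdd_T, barAdd_T, mul_inv_rev, cs.inv_simple, ← T_mul_of_length_add]
  · obtain ⟨u, hu⟩ := isUnit_T L w⁻¹
    have e : T L w⁻¹ * T L (cs.simple s) = ((u * unitS L s : (Hecke L)ˣ) : Hecke L) := by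
      rw [Units.val_mul, hu]; rfl
    rw [e, ← hu, Ring.inverse_unit, Ring.inverse_unit, mul_inv_rev, Units.val_mul]
    rfl
  · rw [← cs.length_inv, mul_inv_rev, inv_inv, cs.inv_simple, h1, cs.length_inv, cs.length_simple]

theorem barAdd_T_simple_mul (s : B) (x : Hecke L) :
    barAdd L (T L (cs.simple s) * x) =
      (T L (cs.simple s) - algebraMap LZ _ (xi L s)) * barAdd L x := by
  classical
  induction x using add_induction with
  | add x y hx hy => rw [mul_add, map_add, map_add, hx, hy, mul_add]
  | smul a w =>
    rw [mul_smul_comm, barAdd_smul, barAdd_smul, mul_smul_comm]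
    congr 1
    by_cases h : cs.IsLeftDescent w s
    · have h' : ¬ cs.IsLeftDescent (cs.simple s * w) s := by
        rwa [← cs.isLeftDescent_iff_not_isLeftDescent_mul]
      have e := barAdd_T_simple_mul_of_lt L h'
      rw [cs.simple_mul_simple_cancel_left] at e
      have e2 : T L (cs.simple s) * barAdd L (T L w) = barAdd L (T L (cs.simple s * w)) := by
        rw [e, ← mul_assoc, T_simple_mul_inv, one_mul]
      rw [T_simple_mul, if_pos h, map_add, barAdd_smul, invert_xi, ← e2, sub_mul, neg_smul,
        Algebra.smul_def, sub_eq_add_neg]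
    · rw [T_simple_mul_of_lt L h, barAdd_T_simple_mul_of_lt L h]

theorem barAdd_one : barAdd L 1 = 1 := by
  rw [← T_one, barAdd_T, inv_one, T_one, Ring.inverse_one]

theorem barAdd_mul (x y : Hecke L) : barAdd L (x * y) = barAdd L x * barAdd L y := by
  induction x using hecke_induction with
  | add x x' hx hx' => rw [add_mul, map_add, map_add, hx, hx', add_mul]
  | smul a x hx => rw [smul_mul_assoc, barAdd_smul, barAdd_smul, hx, smul_mul_assoc]
  | one => rw [one_mul, barAdd_one, one_mul]
  | mul s x hx => rw [mul_assoc, barAdd_T_simple_mul, barAdd_T_simple_mul, hx, mul_assoc]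

/-- The bar involution: the ring endomorphism with `q ↦ q⁻¹` and `T_w ↦ (T_{w⁻¹})⁻¹`. -/
def bar : Hecke L →+* Hecke L :=
  { barAdd L with
    map_one' := barAdd_one L
    map_mul' := barAdd_mul L }

theorem bar_smul (a : LZ) (x : Hecke L) :
    bar L (a • x) = LaurentPolynomial.invert a • bar L x := barAdd_smul L a x

theorem bar_T (w : W) : bar L (T L w) = Ring.inverse (T L w⁻¹) := barAdd_T L w

theorem bar_T_simple (s : B) : bar L (T L (cs.simple s)) =
    T L (cs.simple s) - algebraMap LZ _ (xi L s) := barAdd_T_simple L s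

/-! ### Triangularity with respect to the length -/

/-- The span of the `T_w` with `ℓ(w) < n`. -/
def low (n : ℕ) : Submodule LZ (Hecke L) where
  carrier := {h | ∀ w, n ≤ cs.length w → (stdBasis L).repr h w = 0}
  add_mem' := fun {x y} hx hy w hw => by
    rw [map_add, Finsupp.add_apply, hx w hw, hy w hw, add_zero]
  zero_mem' := fun w _ => by rw [map_zero]; rfl
  smul_mem' := fun a x hx w hw => by
    rw [map_smul, Finsupp.smul_apply, hx w hw, smul_zero]

theorem low_mono {m n : ℕ} (h : m ≤ n) : low L m ≤ low L n :=
  fun _ hx w hw => hx w (h.trans hw)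

theorem T_mem_low {w : W} {n : ℕ} (h : cs.length w < n) : T L w ∈ low L n := by
  classical
  intro y hy
  rw [repr_T, Finsupp.single_apply, if_neg]
  rintro rfl; omega

theorem exists_mem_low (x : Hecke L) : ∃ n, x ∈ low L n := by
  induction x using add_induction with
  | add x y hx hy =>
    obtain ⟨m, hm⟩ := hx
    obtain ⟨n, hn⟩ := hy
    exact ⟨max m n, (low L _).add_mem (low_mono L (le_max_left m n) hm)
      (low_mono L (le_max_right m n) hn)⟩
  | smul a w => exact ⟨_, (low L _).smul_mem a (T_mem_low L (Nat.lt_succ_self (cs.length w)))⟩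

theorem low_zero {x : Hecke L} (h : x ∈ low L 0) : x = 0 := by
  apply (stdBasis L).repr.injective
  ext1 w
  rw [h w (Nat.zero_le _), map_zero]; rfl

/-- Induction over the elements of `low n`. -/
theorem low_induction {n : ℕ} {p : ∀ x : Hecke L, x ∈ low L n → Prop}
    (zero : p 0 (low L n).zero_mem)
    (add : ∀ x y hx hy, p x hx → p y hy → p (x + y) ((low L n).add_mem hx hy))
    (smul : ∀ (a : LZ) w (hw : cs.length w < n),
      p (a • T L w) ((low L n).smul_mem a (T_mem_low L hw)))
    {x : Hecke L} (hx : x ∈ low L n) : p x hx := by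
  have key : ∃ h : x ∈ low L n, p x h := by
    rw [← (stdBasis L).linearCombination_repr x, Finsupp.linearCombination_apply, Finsupp.sum]
    refine Finset.sum_induction _ (fun y => ∃ h : y ∈ low L n, p y h)
      (fun y z hy hz => ⟨_, add y z hy.1 hz.1 hy.2 hz.2⟩) ⟨_, zero⟩
      fun w hw => ⟨_, smul _ _ ?_⟩
    by_contra h
    exact (Finsupp.mem_support_iff.1 hw) (hx w (not_lt.1 h))
  exact key.2

theorem T_simple_mul_low {n : ℕ} (s : B) {x : Hecke L} (hx : x ∈ low L n) :
    T L (cs.simple s) * x ∈ low L (n + 1) := by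
  classical
  induction hx using low_induction with
  | zero => rw [mul_zero]; exact (low L _).zero_mem
  | add x y _ _ hx hy => rw [mul_add]; exact (low L _).add_mem hx hy
  | smul a w hw =>
    rw [mul_smul_comm, T_simple_mul]
    refine (low L _).smul_mem a ((low L _).add_mem (T_mem_low L ?_) ?_)
    · rcases cs.length_simple_mul w s with h | h <;> omega
    · split_ifs
      · exact (low L _).smul_mem _ (T_mem_low L (by omega))
      · exact (low L _).zero_mem

theorem bar_T_sub_mem (w : W) : bar L (T L w) - T L w ∈ low L (cs.length w) := by
  induction w using left_induction (cs := cs) with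
  | one => rw [T_one, map_one, sub_self]; exact (low L _).zero_mem
  | step s w hs ih =>
    have hl := (cs.not_isLeftDescent_iff).1 hs
    rw [← T_simple_mul_of_lt L hs, map_mul, bar_T_simple, hl]
    have e : (T L (cs.simple s) - algebraMap LZ _ (xi L s)) * bar L (T L w) -
        T L (cs.simple s) * T L w = T L (cs.simple s) * (bar L (T L w) - T L w) -
          (xi L s • (bar L (T L w) - T L w) + xi L s • T L w) := by
      rw [Algebra.smul_def, Algebra.smul_def]; noncomm_ring
    rw [e]
    exact (low L _).sub_mem (T_simple_mul_low L s ih) ((low L _).add_mem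
      ((low L _).smul_mem _ (low_mono L (Nat.le_succ _) ih))
      ((low L _).smul_mem _ (T_mem_low L (Nat.lt_succ_self _))))

theorem bar_mem_low {n : ℕ} {x : Hecke L} (hx : x ∈ low L n) : bar L x ∈ low L n := by
  induction hx using low_induction with
  | zero => rw [map_zero]; exact (low L _).zero_mem
  | add x y _ _ hx hy => rw [map_add]; exact (low L _).add_mem hx hy
  | smul a w hw =>
    rw [bar_smul]
    refine (low L _).smul_mem _ ?_
    have := (low L n).add_mem (low_mono L hw.le (bar_T_sub_mem L w)) (T_mem_low L hw)
    rwa [sub_add_cancel] at this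

theorem repr_bar_of_mem_low {n : ℕ} {x : Hecke L} (hx : x ∈ low L (n + 1)) (y : W)
    (hy : n ≤ cs.length y) :
    (stdBasis L).repr (bar L x) y = LaurentPolynomial.invert ((stdBasis L).repr x y) := by
  classical
  induction hx using low_induction with
  | zero => rw [map_zero, map_zero]; exact (map_zero LaurentPolynomial.invert).symm
  | add x y _ _ hx hy => rw [map_add, map_add, map_add, Finsupp.add_apply, Finsupp.add_apply, hx, hy,
      map_add]
  | smul a w hw =>
    have h := bar_T_sub_mem L w y (by omega)
    rw [map_sub, Finsupp.sub_apply, sub_eq_zero] at h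
    rw [bar_smul, map_smul, map_smul, Finsupp.smul_apply, Finsupp.smul_apply, h, repr_T,
      Finsupp.single_apply]
    split_ifs <;> simp

/-! ### The Kazhdan–Lusztig basis -/

/-- The submodule `H_{<0} = ⨁ A_{<0} T_w`, as a set. -/
def negPart : Set (Hecke L) := {h | ∀ w, ((stdBasis L).repr h w).degree < 0}

theorem negPart_add {x y : Hecke L} (hx : x ∈ negPart L) (hy : y ∈ negPart L) :
    x + y ∈ negPart L := by
  intro w
  have h1 := hx w
  have h2 := hy w
  rw [degree_neg_iff] at *
  intro n hn
  rw [map_add, Finsupp.add_apply, AddMonoidAlgebra.coeff_add, Finsupp.add_apply, h1 n hn, h2 n hn,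
    add_zero]

theorem negPart_neg {x : Hecke L} (hx : x ∈ negPart L) : -x ∈ negPart L := by
  intro w
  have h1 := hx w
  rw [degree_neg_iff] at *
  intro n hn
  rw [map_neg, Finsupp.neg_apply, AddMonoidAlgebra.coeff_neg, Finsupp.neg_apply, h1 n hn, neg_zero]

theorem negPart_zero : (0 : Hecke L) ∈ negPart L := fun w => by
  rw [map_zero]; simp

theorem negPart_smul_T {a : LZ} (ha : a.degree < 0) (w : W) : a • T L w ∈ negPart L := by
  classical
  intro y
  rw [map_smul, repr_T, Finsupp.smul_apply, Finsupp.single_apply]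
  split_ifs
  · rwa [smul_eq_mul, mul_one]
  · simp

/-- The two conditions characterising `C_w`: it is bar invariant and congruent to `T_w` modulo
`H_{<0}`. -/
def IsKL (w : W) (c : Hecke L) : Prop := bar L c = c ∧ c - T L w ∈ negPart L

theorem eq_zero_of_bar_eq {x : Hecke L} (h1 : bar L x = x) (h2 : x ∈ negPart L) : x = 0 := by
  obtain ⟨n, hn⟩ := exists_mem_low L x
  induction n with
  | zero => exact low_zero L hn
  | succ n ih =>
    refine ih fun y hy => ?_
    have := repr_bar_of_mem_low L hn y hy
    rw [h1] at this
    exact eq_zero_of_invert_eq (h2 y) this.symm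

theorem IsKL.unique {w : W} {c c' : Hecke L} (h : IsKL L w c) (h' : IsKL L w c') : c = c' := by
  rw [← sub_eq_zero]
  refine eq_zero_of_bar_eq L (by rw [map_sub, h.1, h'.1]) ?_
  have := negPart_add L h.2 (negPart_neg L h'.2)
  rwa [neg_sub, sub_add_sub_cancel] at this

theorem exists_approx (n : ℕ)
    (hC : ∀ w, cs.length w < n → ∃ c, IsKL L w c ∧ c - T L w ∈ low L (cs.length w)) :
    ∀ g ∈ low L n, ∃ b, bar L b = b ∧ b ∈ low L n ∧ g - b ∈ negPart L := by
  induction n with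
  | zero =>
    intro g hg
    exact ⟨0, map_zero _, (low L _).zero_mem, by
      rw [low_zero L hg, sub_zero]; exact negPart_zero L⟩
  | succ n ih =>
    intro g hg
    have ih' := ih fun w hw => hC w (by omega)
    induction hg using low_induction with
    | zero => exact ⟨0, map_zero _, (low L _).zero_mem, by rw [sub_zero]; exact negPart_zero L⟩
    | add x y _ _ hx hy =>
      obtain ⟨b, hb1, hb2, hb3⟩ := hx
      obtain ⟨c, hc1, hc2, hc3⟩ := hy
      refine ⟨b + c, by rw [map_add, hb1, hc1], (low L _).add_mem hb2 hc2, ?_⟩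
      rw [add_sub_add_comm]; exact negPart_add L hb3 hc3
    | smul a w hw =>
      obtain ⟨c, ⟨hc1, -⟩, hc3⟩ := hC w hw
      obtain ⟨b, hb1, hb2⟩ := exists_symm a
      obtain ⟨d, hd1, hd2, hd3⟩ := ih' (-(b • (c - T L w)))
        ((low L _).neg_mem ((low L _).smul_mem _ (low_mono L (by omega) hc3)))
      refine ⟨b • c + d, by rw [map_add, bar_smul, hb1, hc1, hd1], ?_, ?_⟩
      · refine (low L _).add_mem ((low L _).smul_mem _ ?_) (low_mono L (by omega) hd2)
        have := (low L (n + 1)).add_mem (low_mono L (by omega) hc3) (T_mem_low L hw)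
        rwa [sub_add_cancel] at this
      · have := negPart_add L (negPart_smul_T L hb2 w) hd3
        have e : a • T L w - (b • c + d) =
            (a - b) • T L w + (-(b • (c - T L w)) - d) := by
          rw [sub_smul, smul_sub]; abel
        rwa [e]

theorem exists_isKL (w : W) : ∃ c, IsKL L w c ∧ c - T L w ∈ low L (cs.length w) := by
  induction hn : cs.length w using Nat.strong_induction_on generalizing w with
  | _ n ih =>
    subst hn
    by_cases hw : w = 1
    · refine ⟨1, ⟨map_one _, ?_⟩, ?_⟩ <;> rw [hw, T_one, sub_self]
      · exact negPart_zero L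
      · exact (low L _).zero_mem
    obtain ⟨s, hs⟩ := cs.exists_leftDescent_of_ne_one hw
    have hl := (cs.isLeftDescent_iff).1 hs
    have hnd : ¬ cs.IsLeftDescent (cs.simple s * w) s := by
      rwa [← cs.isLeftDescent_iff_not_isLeftDescent_mul]
    obtain ⟨c, ⟨hc1, -⟩, hc3⟩ := ih _ (by omega) (cs.simple s * w) rfl
    set a : LZ := LaurentPolynomial.T (-L (cs.simple s)) with ha
    set u : Hecke L := T L (cs.simple s) + algebraMap LZ _ a with hu
    have hbu : bar L u = u := by
      have h1 : bar L (algebraMap LZ _ a) = algebraMap LZ _ (LaurentPolynomial.invert a) := by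
        rw [Algebra.algebraMap_eq_smul_one, Algebra.algebraMap_eq_smul_one, bar_smul, map_one]
      rw [hu, map_add, bar_T_simple, h1, ha, xi, LaurentPolynomial.invert_T, neg_neg, map_sub]
      abel
    have hX : u * c - T L w ∈ low L (cs.length w) := by
      have e1 : T L w = T L (cs.simple s) * T L (cs.simple s * w) := by
        rw [T_simple_mul_of_lt L hnd, cs.simple_mul_simple_cancel_left]
      have e : u * c - T L w = T L (cs.simple s) * (c - T L (cs.simple s * w)) +
          a • ((c - T L (cs.simple s * w)) + T L (cs.simple s * w)) := by
        rw [e1, hu, Algebra.smul_def]; noncomm_ring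
      rw [e]
      refine (low L _).add_mem (low_mono L (by omega) (T_simple_mul_low L s hc3))
        ((low L _).smul_mem _ ((low L _).add_mem (low_mono L (by omega) hc3)
          (T_mem_low L (by omega))))
    obtain ⟨b, hb1, hb2, hb3⟩ := exists_approx L (cs.length w)
      (fun y hy => ih _ hy y rfl) (-(u * c - T L w)) ((low L _).neg_mem hX)
    have e : u * c + b - T L w = -(-(u * c - T L w) - b) := by abel
    refine ⟨u * c + b, ⟨by rw [map_add, map_mul, hbu, hc1, hb1], ?_⟩, ?_⟩
    · rw [e]; exact negPart_neg L hb3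
    · have := (low L _).add_mem hX hb2
      rwa [sub_add_eq_add_sub] at this

/-- The Kazhdan–Lusztig element `C_w`. -/
def C (w : W) : Hecke L := (exists_isKL L w).choose

theorem C_isKL (w : W) : IsKL L w (C L w) := (exists_isKL L w).choose_spec.1

theorem C_sub_T_mem (w : W) : C L w - T L w ∈ low L (cs.length w) :=
  (exists_isKL L w).choose_spec.2

theorem existsUnique_isKL (w : W) : ∃! c, IsKL L w c :=
  ⟨C L w, C_isKL L w, fun _ h => h.unique L (C_isKL L w)⟩

/-- A family that is unitriangular with respect to the length is a basis. -/
theorem tri_bijective (v : W → Hecke L) (hv : ∀ w, v w - T L w ∈ low L (cs.length w)) :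
    Function.Bijective ((stdBasis L).constr LZ v) := by
  set φ := (stdBasis L).constr LZ v with hφ
  have hT : ∀ w, φ (T L w) = v w := fun w => (stdBasis L).constr_basis LZ v w
  have key : ∀ n x, x ∈ low L (n + 1) → φ x - x ∈ low L n := by
    intro n x hx
    induction hx using low_induction with
    | zero => rw [map_zero, sub_self]; exact (low L _).zero_mem
    | add x y _ _ hx hy => rw [map_add, add_sub_add_comm]; exact (low L _).add_mem hx hy
    | smul a w hw =>
      rw [map_smul, hT, ← smul_sub]
      exact (low L _).smul_mem _ (low_mono L (by omega) (hv w))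
  constructor
  · rw [injective_iff_map_eq_zero]
    intro x hx
    obtain ⟨n, hn⟩ := exists_mem_low L x
    induction n with
    | zero => exact low_zero L hn
    | succ n ih =>
      have := key n x hn
      rw [hx, zero_sub, Submodule.neg_mem_iff] at this
      exact ih this
  · intro x
    obtain ⟨n, hn⟩ := exists_mem_low L x
    induction n generalizing x with
    | zero => exact ⟨0, by rw [map_zero, low_zero L hn]⟩
    | succ n ih =>
      obtain ⟨y, hy⟩ := ih _ (key n x hn)
      exact ⟨x - y, by rw [map_sub, hy, sub_sub_cancel]⟩

/-- The basis given by a family that is unitriangular with respect to the length. -/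
def triBasis (v : W → Hecke L) (hv : ∀ w, v w - T L w ∈ low L (cs.length w)) :
    Module.Basis W LZ (Hecke L) :=
  (stdBasis L).map (LinearEquiv.ofBijective _ (tri_bijective L v hv))

theorem triBasis_apply (v : W → Hecke L) (hv : ∀ w, v w - T L w ∈ low L (cs.length w)) (w : W) :
    triBasis L v hv w = v w := by
  rw [triBasis, Module.Basis.map_apply]
  exact (stdBasis L).constr_basis LZ v w

/-- The Kazhdan–Lusztig basis `C_w`, `w ∈ W`. -/
def klBasis : Module.Basis W LZ (Hecke L) := triBasis L (C L) (C_sub_T_mem L)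

theorem klBasis_apply (w : W) : klBasis L w = C L w := triBasis_apply L _ _ w

theorem C_simple (s : B) : C L (cs.simple s) =
    T L (cs.simple s) + algebraMap LZ _ (LaurentPolynomial.T (-L (cs.simple s))) := by
  refine (C_isKL L _).unique L ⟨?_, ?_⟩
  · rw [map_add, bar_T_simple, Algebra.algebraMap_eq_smul_one, Algebra.algebraMap_eq_smul_one,
      bar_smul, map_one, xi, LaurentPolynomial.invert_T, neg_neg, sub_smul]
    abel
  · rw [add_sub_cancel_left, Algebra.algebraMap_eq_smul_one, ← T_one]
    refine negPart_smul_T L ?_ 1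
    rw [LaurentPolynomial.degree_T]
    have := L.pos s
    exact_mod_cast (by omega : -L (cs.simple s) < 0)

end Hecke

end

section

variable {B W : Type*} [Group W] {M : CoxeterMatrix B} {cs : CoxeterSystem M W}

namespace Hecke

variable (L : WeightFunction cs)

/-! ### Structure constants, cells and the `a`-function -/

/-- The coefficient `p_{y,w}` of `T_y` in `C_w`. -/
def p (y w : W) : LZ := (stdBasis L).repr (C L w) y

/-- The coefficient `h_{x,y,z}` of `C_z` in `C_x C_y`. -/
def h (x y z : W) : LZ := (klBasis L).repr (C L x * C L y) z

/-- The preorder `w' ≺_L w`, generated by the pairs such that `C_{w'}` occurs in `C_s C_w` for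
some simple reflection `s`. -/
def LeL (w' w : W) : Prop :=
  Relation.ReflTransGen (fun x y => ∃ s : B, h L (cs.simple s) y x ≠ 0) w' w

/-- The preorder `w' ≺_LR w`, generated by the pairs such that `C_{w'}` occurs in `C_s C_w` or in
`C_w C_s` for some simple reflection `s`. -/
def LeLR (w' w : W) : Prop :=
  Relation.ReflTransGen
    (fun x y => ∃ s : B, h L (cs.simple s) y x ≠ 0 ∨ h L y (cs.simple s) x ≠ 0) w' w

/-- The equivalence relation whose classes are the left cells. -/
def SimL (w w' : W) : Prop := LeL L w w' ∧ LeL L w' w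

/-- Lusztig's function `a(w) = max {deg h_{x,y,w}}`, with values in `ℕ ∪ {∞}`.
Since `h_{1,w,w} = 1`, the maximum is at least `0`, so that replacing negative degrees
(and `deg 0 = -∞`) by `0` does not change it. -/
def aFun (w : W) : ℕ∞ := ⨆ (x : W) (y : W), (((h L x y w).degree.unbotD 0).toNat : ℕ∞)

/-- `W_{>N}`. -/
def Wgt (N : ℕ) : Set W := {w | (N : ℕ∞) < aFun L w}

/-- `W_{≤N}`. -/
def Wle (N : ℕ) : Set W := {w | aFun L w ≤ (N : ℕ∞)}

/-- `γ_{x,y,z}`, the coefficient of `q ^ a(z⁻¹)` in `h_{x,y,z⁻¹}`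
(zero if `a(z⁻¹) = ∞`). -/
def gam (x y z : W) : ℤ :=
  if aFun L z⁻¹ = ⊤ then 0 else (h L x y z⁻¹).coeff ((aFun L z⁻¹).toNat : ℤ)

/-- The integer `Δ(w) = - deg p_{1,w}`; it is nonnegative since `deg p_{1,w} ≤ 0`. -/
def Delta (w : W) : ℕ := (-((p L 1 w).degree.unbotD 0)).toNat

/-- Property P1 on `W_{>N}`. -/
def P1gt (N : ℕ) : Prop := ∀ w ∈ Wgt L N, aFun L w ≤ (Delta L w : ℕ∞)

/-- Property P4 on `W_{>N}`. -/
def P4gt (N : ℕ) : Prop := ∀ w ∈ Wgt L N, ∀ w' : W, LeLR L w' w → aFun L w ≤ aFun L w'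

/-- Property P8 on `W_{>N}`. -/
def P8gt (N : ℕ) : Prop := ∀ x y z : W, (x ∈ Wgt L N ∨ y ∈ Wgt L N ∨ z ∈ Wgt L N) →
  gam L x y z ≠ 0 → SimL L x y⁻¹ ∧ SimL L y z⁻¹ ∧ SimL L z x⁻¹

/-- A set of elements of `W` closed under the preorder `≺_LR`. -/
def LRClosed (U : Set W) : Prop := ∀ w ∈ U, ∀ w' : W, LeLR L w' w → w' ∈ U

theorem P4gt.lrClosed {L : WeightFunction cs} {N : ℕ} (h4 : P4gt L N) : LRClosed L (Wgt L N) :=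
  fun w hw w' hle => lt_of_lt_of_le hw (h4 w hw w' hle)

/-! ### The quotient algebra `H_{≤N}` -/

theorem span_C_of_repr {U : Set W} {x : Hecke L}
    (hx : ∀ z, (klBasis L).repr x z ≠ 0 → z ∈ U) : x ∈ Submodule.span LZ (C L '' U) := by
  rw [← (klBasis L).linearCombination_repr x, Finsupp.linearCombination_apply, Finsupp.sum]
  refine Submodule.sum_mem _ fun z hz => Submodule.smul_mem _ _ (Submodule.subset_span ?_)
  exact ⟨z, hx z (Finsupp.mem_support_iff.1 hz), (klBasis_apply L z).symm⟩

theorem T_simple_eq (s : B) : T L (cs.simple s) = C L (cs.simple s) -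
    algebraMap LZ _ (LaurentPolynomial.T (-L (cs.simple s))) := by
  rw [C_simple, add_sub_cancel_right]

theorem T_simple_mul_mem {U : Set W} (hU : LRClosed L U) (s : B) {y : Hecke L}
    (hy : y ∈ Submodule.span LZ (C L '' U)) :
    T L (cs.simple s) * y ∈ Submodule.span LZ (C L '' U) := by
  induction hy using Submodule.span_induction with
  | mem y hy =>
    obtain ⟨w, hw, rfl⟩ := hy
    rw [T_simple_eq, sub_mul, ← Algebra.smul_def]
    refine Submodule.sub_mem _ (span_C_of_repr L fun z hz => hU w hw z ?_)
      (Submodule.smul_mem _ _ (Submodule.subset_span ⟨w, hw, rfl⟩))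
    exact Relation.ReflTransGen.single ⟨s, Or.inl hz⟩
  | zero => rw [mul_zero]; exact Submodule.zero_mem _
  | add x y _ _ hx hy => rw [mul_add]; exact Submodule.add_mem _ hx hy
  | smul a x _ hx => rw [mul_smul_comm]; exact Submodule.smul_mem _ _ hx

theorem mul_T_simple_mem {U : Set W} (hU : LRClosed L U) (s : B) {y : Hecke L}
    (hy : y ∈ Submodule.span LZ (C L '' U)) :
    y * T L (cs.simple s) ∈ Submodule.span LZ (C L '' U) := by
  induction hy using Submodule.span_induction with
  | mem y hy =>
    obtain ⟨w, hw, rfl⟩ := hy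
    rw [T_simple_eq, mul_sub, ← Algebra.commutes, ← Algebra.smul_def]
    refine Submodule.sub_mem _ (span_C_of_repr L fun z hz => hU w hw z ?_)
      (Submodule.smul_mem _ _ (Submodule.subset_span ⟨w, hw, rfl⟩))
    exact Relation.ReflTransGen.single ⟨s, Or.inr hz⟩
  | zero => rw [zero_mul]; exact Submodule.zero_mem _
  | add x y _ _ hx hy => rw [add_mul]; exact Submodule.add_mem _ hx hy
  | smul a x _ hx => rw [smul_mul_assoc]; exact Submodule.smul_mem _ _ hx

theorem mul_mem_span {U : Set W} (hU : LRClosed L U) (x : Hecke L) :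
    ∀ y ∈ Submodule.span LZ (C L '' U), x * y ∈ Submodule.span LZ (C L '' U) := by
  induction x using hecke_induction with
  | add x x' hx hx' =>
    intro y hy
    rw [add_mul]; exact Submodule.add_mem _ (hx y hy) (hx' y hy)
  | smul a x hx => intro y hy; rw [smul_mul_assoc]; exact Submodule.smul_mem _ _ (hx y hy)
  | one => intro y hy; rwa [one_mul]
  | mul s x hx => intro y hy; rw [mul_assoc]; exact T_simple_mul_mem L hU s (hx y hy)

theorem span_mul_mem {U : Set W} (hU : LRClosed L U) (x : Hecke L) :
    ∀ y ∈ Submodule.span LZ (C L '' U), y * x ∈ Submodule.span LZ (C L '' U) := by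
  induction x using hecke_induction with
  | add x x' hx hx' =>
    intro y hy
    rw [mul_add]; exact Submodule.add_mem _ (hx y hy) (hx' y hy)
  | smul a x hx => intro y hy; rw [mul_smul_comm]; exact Submodule.smul_mem _ _ (hx y hy)
  | one => intro y hy; rwa [mul_one]
  | mul s x hx => intro y hy; rw [← mul_assoc]; exact hx _ (mul_T_simple_mem L hU s hy)

/-- The two-sided ideal `H_{>N}`, which is the `ℤ[q, q⁻¹]`-span of the `C_w` with `w ∈ W_{>N}`,
when `W_{>N}` is closed under `≺_LR`. -/
def gtIdeal (N : ℕ) (hN : LRClosed L (Wgt L N)) : Ideal (Hecke L) where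
  carrier := Submodule.span LZ (C L '' Wgt L N)
  add_mem' := fun hx hy => Submodule.add_mem _ hx hy
  zero_mem' := Submodule.zero_mem _
  smul_mem' := fun x y hy => mul_mem_span L hN x y hy

instance (N : ℕ) (hN : LRClosed L (Wgt L N)) : (gtIdeal L N hN).IsTwoSided :=
  ⟨fun x hy => span_mul_mem L hN x _ hy⟩

/-- The quotient algebra `H_{≤N} = H / H_{>N}`. -/
abbrev Hle (N : ℕ) (hN : LRClosed L (Wgt L N)) : Type _ := Hecke L ⧸ gtIdeal L N hN

/-- The quotient map `H → H_{≤N}`. -/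
def toHle (N : ℕ) (hN : LRClosed L (Wgt L N)) : Hecke L →ₐ[LZ] Hle L N hN :=
  Ideal.Quotient.mkₐ LZ (gtIdeal L N hN)

/-- The image of `T_w` in `H_{≤N}`. -/
def TN (N : ℕ) (hN : LRClosed L (Wgt L N)) (w : W) : Hle L N hN := toHle L N hN (T L w)

theorem toHle_eq_zero (N : ℕ) (hN : LRClosed L (Wgt L N)) (x : Hecke L) :
    toHle L N hN x = 0 ↔ x ∈ Submodule.span LZ (C L '' Wgt L N) :=
  Ideal.Quotient.eq_zero_iff_mem

open Classical in
/-- The basis of `H` formed by the `C_w` with `w ∈ W_{>N}` and the `T_w` with `w ∈ W_{≤N}`. -/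
def mixBasis (N : ℕ) : Module.Basis W LZ (Hecke L) :=
  triBasis L (fun w => if w ∈ Wgt L N then C L w else T L w) fun w => by
    split_ifs
    · exact C_sub_T_mem L w
    · rw [sub_self]; exact (low L _).zero_mem

theorem mixBasis_gt {N : ℕ} {w : W} (hw : w ∈ Wgt L N) : mixBasis L N w = C L w :=
  (triBasis_apply L _ _ w).trans (if_pos hw)

theorem mixBasis_le {N : ℕ} {w : W} (hw : w ∉ Wgt L N) : mixBasis L N w = T L w :=
  (triBasis_apply L _ _ w).trans (if_neg hw)

theorem notMem_Wgt {N : ℕ} {w : W} : w ∉ Wgt L N ↔ w ∈ Wle L N :=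
  not_lt (a := (N : ℕ∞)) (b := aFun L w)

theorem TN_linearIndependent (N : ℕ) (hN : LRClosed L (Wgt L N)) :
    LinearIndependent LZ fun w : Wle L N => TN L N hN w := by
  have h1 : LinearIndependent LZ fun w : Wle L N => T L (w : W) :=
    (stdBasis L).linearIndependent.comp _ Subtype.val_injective
  refine h1.map (f := (toHle L N hN).toLinearMap) ?_
  have e1 : Set.range (fun w : Wle L N => T L (w : W)) = mixBasis L N '' Wle L N := by
    ext x
    constructor
    · rintro ⟨w, rfl⟩
      exact ⟨w, w.2, mixBasis_le L ((notMem_Wgt L).2 w.2)⟩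
    · rintro ⟨w, hw, rfl⟩
      exact ⟨⟨w, hw⟩, (mixBasis_le L ((notMem_Wgt L).2 hw)).symm⟩
  have e2 : LinearMap.ker (toHle L N hN).toLinearMap =
      Submodule.span LZ (mixBasis L N '' Wgt L N) := by
    rw [Set.image_congr fun w hw => mixBasis_gt L hw]
    ext x
    exact toHle_eq_zero L N hN x
  rw [e1, e2]
  refine (mixBasis L N).linearIndependent.disjoint_span_image ?_
  rw [Set.disjoint_left]
  exact fun w hw hw' => (notMem_Wgt L).2 hw hw'

theorem TN_span (N : ℕ) (hN : LRClosed L (Wgt L N)) :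
    ⊤ ≤ Submodule.span LZ (Set.range fun w : Wle L N => TN L N hN w) := by
  rintro x -
  obtain ⟨y, rfl⟩ := Ideal.Quotient.mk_surjective x
  change toHle L N hN y ∈ _
  induction (mixBasis L N).mem_span y using Submodule.span_induction with
  | mem y hy =>
    obtain ⟨w, rfl⟩ := hy
    by_cases hw : w ∈ Wgt L N
    · rw [mixBasis_gt L hw, (toHle_eq_zero L N hN _).2 (Submodule.subset_span ⟨w, hw, rfl⟩)]
      exact Submodule.zero_mem _
    · rw [mixBasis_le L hw]
      exact Submodule.subset_span ⟨⟨w, (notMem_Wgt L).1 hw⟩, rfl⟩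
  | zero => rw [map_zero]; exact Submodule.zero_mem _
  | add x y _ _ hx hy => rw [map_add]; exact Submodule.add_mem _ hx hy
  | smul a x _ hx => rw [map_smul]; exact Submodule.smul_mem _ _ hx

/-- The basis of `H_{≤N}` formed by the images of the `T_w` with `w ∈ W_{≤N}`. -/
def leBasis (N : ℕ) (hN : LRClosed L (Wgt L N)) : Module.Basis (Wle L N) LZ (Hle L N hN) :=
  Module.Basis.mk (TN_linearIndependent L N hN) (TN_span L N hN)

/-- The degree of an element of `H_{≤N}`: the maximal degree of its coefficients in the basis of
the `T_w`, `w ∈ W_{≤N}`. -/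
def degLe (N : ℕ) (hN : LRClosed L (Wgt L N)) (x : Hle L N hN) : WithBot ℤ :=
  ((leBasis L N hN).repr x).support.sup fun w => ((leBasis L N hN).repr x w).degree

/-! ### The sets `Ω` -/

/-- `d` is the longest element of the parabolic subgroup `W_J`, which is finite. -/
def IsLongest (cs : CoxeterSystem M W) (J : Set B) (d : W) : Prop :=
  (Subgroup.closure (cs.simple '' J) : Set W).Finite ∧ d ∈ Subgroup.closure (cs.simple '' J) ∧
    ∀ w ∈ Subgroup.closure (cs.simple '' J), cs.length w ≤ cs.length d

/-- `D_{≥N}`: the elements `d` with `a'(d) ≥ N`, where `d` and `a'(d)` are either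
* `d = w_J` for some `J` with `W_J` finite, and `a'(d) = L(w_J)`, or
* `d = tst⋯t` (an alternating product with `m_{st} - 1` factors) for some `s`, `t` with
  `m_{st} < ∞` and `L(s) < L(t)`, and `a'(d) = (m_{st}/2) L(t) - (m_{st}/2 - 1) L(s)`.

In the second case `m_{st}` is even. Recall that `M s t = 0` encodes `m_{st} = ∞`. -/
def Dge (N : ℕ) : Set W :=
  {d | (∃ J : Set B, IsLongest cs J d ∧ (N : ℤ) ≤ L d) ∨
    ∃ s t : B, M s t ≠ 0 ∧ L (cs.simple s) < L (cs.simple t) ∧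
      d = cs.wordProd (CoxeterSystem.alternatingWord s t (M s t - 1)) ∧
      (N : ℤ) ≤ ((M s t / 2 : ℕ) : ℤ) * L (cs.simple t) -
        (((M s t / 2 : ℕ) : ℤ) - 1) * L (cs.simple s)}

/-- `Ω_{≥N}`: the elements `xdy` with `d ∈ D_{≥N}` and `ℓ(xdy) = ℓ(x) + ℓ(d) + ℓ(y)`. -/
def OmegaGe (N : ℕ) : Set W :=
  {w | ∃ d ∈ Dge L N, ∃ x y : W, w = x * d * y ∧
    cs.length (x * d * y) = cs.length x + cs.length d + cs.length y}

/-- `Ω_{>N}`. -/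
def OmegaGt (N : ℕ) : Set W := OmegaGe L (N + 1)

/-- `Ω_N`. -/
def Omega (N : ℕ) : Set W := OmegaGe L N \ OmegaGt L N

end Hecke

end

end

end CoxHecke

/-! The bound $N$ is formal. The matrix between the bases $T$ and $C$ is unitriangular with entries
of negative degree off the diagonal, and so is its inverse. In $\mathcal H_{\le N}$ only the
$h_{x,y,z}$ with $z\in W_{\le N}$ survive, and they have degree at most $N$. Hence all products
${}^NT_x\,{}^NT_y$ have degree at most $N$, for arbitrary $x,y\in W$. If $y\in W_{>N}$, then
$T_y\equiv -(C_y-T_y)$ has coefficients of negative degree with respect to the $C_w$, and the degree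
is at most $N-1$. `BoundedHecke` records what is needed of this.

The rest shows by induction on $l(x)$ that the degree is less than $N$ for every $y$ once
$x\notin\Omega_{\ge N}$ (`mul_mem_of_notMem_omegaGe`). The opposite algebra gives the same for $y$.
Two devices turn the uniform bound into better ones.

Gain: if $xs>x$ and $sy>y$, then $T_{xs}T_{sy}=T_xT_y+\xi_sT_xT_{sy}$. A bound on the two outer
products therefore bounds $T_xT_{sy}$, with a gain of $L(s)$ (`mul_mem_of_step`).

Characters: let $c$ be a one-dimensional character of the Hecke algebra of a finite dihedral $W_J$,
whose values are powers of $q$ up to sign and whose degree has a strict maximum at $z$. The sum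
$X=\sum c(w)T_w$ satisfies $T_uX=c(u)X$. Comparing $T_{au}XT_b$ with its expansion in the
$T_{au}T_{wb}$ isolates $T_{au}T_{zb}$ (`mul_mem_of_charSum`). The index character has $z=w_J$. The
character $T_s\mapsto -q^{-L(s)}$, $T_t\mapsto q^{L(t)}$ with $L(s)<L(t)$ has $z=d=t\cdots t$. These
are the elements of $D$ of rank two, and $\mathbf a'(z)$ is the degree of $c(z)$. If $u=z$, then
$\mathbf a'(z)<N$ because $az\notin\Omega_{\ge N}$, and $T_aXT_b$ is estimated term by term.

This estimate needs the combinatorics of a complete Coxeter graph. After one of two descents is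
removed, the other is the only descent (`eq_of_descents`). A non-reduced product without common
descent meets along a dihedral subgroup (`descents_of_not_reduced`). A dihedral factor of length at
least $3$ between minimal $a$ and $b$ makes $awb$ reduced (`length_mul_mul_of_par`). The factors of
length $2$ need `mul_mem_of_minimal`. -/

namespace CoxHecke

/-! ### The geometric representation and the order of a product of two generators. -/

section GeometricRepresentation

open Polynomial.Chebyshev

variable {B W : Type*} [Group W] {M : CoxeterMatrix B}

/-- The linear form `v ↦ 2 ⟨e_i, v⟩` of the geometric representation of a Coxeter group. -/
noncomputable def geomForm (M : CoxeterMatrix B) (i : B) : Module.Dual ℝ (B →₀ ℝ) :=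
  Finsupp.linearCombination ℝ fun j => -2 * Real.cos (Real.pi / M i j)

theorem geomForm_single (i j : B) :
    geomForm M i (Finsupp.single j 1) = -2 * Real.cos (Real.pi / M i j) := by
  simp [geomForm]

theorem geomForm_self (i : B) : geomForm M i (Finsupp.single i 1) = 2 := by
  simp [geomForm_single]

/-- The reflections of the geometric representation. -/
noncomputable def geomRefl (M : CoxeterMatrix B) (i : B) : (B →₀ ℝ) ≃ₗ[ℝ] (B →₀ ℝ) :=
  Module.reflection (geomForm_self (M := M) i)

theorem geom_trace (i j : B) : 2 * Real.cos (2 * Real.pi / M i j) =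
    geomForm M i (Finsupp.single j 1) * geomForm M j (Finsupp.single i 1) - 2 := by
  rw [geomForm_single, geomForm_single, M.symmetric j i,
    show 2 * Real.pi / M i j = 2 * (Real.pi / M i j) by ring, Real.cos_two_mul]
  ring

theorem sin_two_pi_div_pos {m : ℕ} (hm : 3 ≤ m) : 0 < Real.sin (2 * Real.pi / m) := by
  have h3 : (3 : ℝ) ≤ m := by exact_mod_cast hm
  refine Real.sin_pos_of_pos_of_lt_pi (by positivity) ?_
  rw [div_lt_iff₀ (by linarith)]
  nlinarith [Real.pi_pos]

theorem geomRefl_liftable (hM : ∀ s t : B, s ≠ t → M s t ≠ 2) : M.IsLiftable (geomRefl M) := by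
  intro i j
  rcases eq_or_ne i j with rfl | hij
  · rw [M.diagonal, pow_one]
    refine LinearEquiv.ext fun v => ?_
    rw [LinearEquiv.mul_apply, geomRefl, Module.involutive_reflection (geomForm_self i) v]
    rfl
  rcases Nat.eq_zero_or_pos (M i j) with h0 | hpos
  · rw [h0, pow_zero]
  have h1 := M.off_diagonal i j hij
  have h2 := hM i j hij
  have h3 : 3 ≤ M i j := by omega
  -- The values of $S_n$ are read off from $S_n(2\cos\theta)\sin\theta=\sin((n+1)\theta)$ with
  -- $\theta=2\pi/m$. The factor $\sin\theta$ can be cancelled because $m\ge 3$.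
  have hsin := (sin_two_pi_div_pos h3).ne'
  have hm0 : (M i j : ℝ) ≠ 0 := by positivity
  rw [← LinearEquiv.toLinearMap_inj]
  change (((Module.reflection (geomForm_self i)) * (Module.reflection (geomForm_self j))) ^ _ :
    (B →₀ ℝ) ≃ₗ[ℝ] (B →₀ ℝ)).toLinearMap = LinearMap.id
  rw [Module.reflection_mul_reflection_pow _ _ _ _ (geom_trace i j)]
  have hS := S_two_mul_real_cos (2 * Real.pi / M i j)
  set S' : ℤ → ℝ := fun n => (S ℝ n).eval (2 * Real.cos (2 * Real.pi / M i j)) with hS'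
  -- Each product has a vanishing factor: $S_{k-1}$ if $m=2k$, because $k\theta=\pi$, and
  -- $S_k+S_{k-1}$ if $m=2k+1$, because $(k+1)\theta=2\pi-k\theta$.
  have key : (S' (((M i j : ℤ) - 2) / 2) *
      (S' (((M i j : ℤ) - 1) / 2) + S' (((M i j : ℤ) - 3) / 2)) = 0) ∧
      S' (((M i j : ℤ) - 1) / 2) * (S' ((M i j : ℤ) / 2) + S' (((M i j : ℤ) - 2) / 2)) = 0 := by
    obtain ⟨k, hk⟩ := Nat.even_or_odd' (M i j)
    have hθ : (M i j : ℝ) * (2 * Real.pi / M i j) = 2 * Real.pi := by field_simp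
    rcases hk with hk | hk
    · have e : S' (k - 1) = 0 := by
        refine (mul_eq_zero.1 ((hS (k - 1)).trans ?_)).resolve_right hsin
        rw [show (((k - 1 : ℤ) : ℝ) + 1) * (2 * Real.pi / M i j) = Real.pi by
          rw [hk] at hθ ⊢; push_cast at hθ ⊢; linarith, Real.sin_pi]
      constructor
      · rw [show ((M i j : ℤ) - 2) / 2 = k - 1 by omega, e, zero_mul]
      · rw [show ((M i j : ℤ) - 1) / 2 = k - 1 by omega, e, zero_mul]
    · have e : S' k + S' (k - 1) = 0 := by
        refine (mul_eq_zero.1 (?_ : (S' k + S' (k - 1)) * _ = 0)).resolve_right hsin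
        rw [add_mul, hS, hS, show ((k : ℤ) + 1 : ℝ) * (2 * Real.pi / M i j) =
          2 * Real.pi - (((k - 1 : ℤ) : ℝ) + 1) * (2 * Real.pi / M i j) by
          rw [hk] at hθ ⊢; push_cast at hθ ⊢; linarith, Real.sin_two_pi_sub, neg_add_cancel]
      constructor
      · rw [show ((M i j : ℤ) - 1) / 2 = k by omega,
          show ((M i j : ℤ) - 3) / 2 = k - 1 by omega, e, mul_zero]
      · rw [show (M i j : ℤ) / 2 = k by omega, show ((M i j : ℤ) - 2) / 2 = k - 1 by omega, e,
          mul_zero]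
  simp only [hS'] at key
  rw [key.1, key.2, zero_smul, zero_smul, add_zero, add_zero]

/-- In the absence of commuting generators, the order of `st` is `m_{st}`. -/
theorem simple_mul_simple_pow_ne_one (cs : CoxeterSystem M W) (hM : ∀ s t : B, s ≠ t → M s t ≠ 2)
    {i j : B} (hij : i ≠ j) {n : ℕ} (hn : 0 < n) (hn' : M i j = 0 ∨ n < M i j) :
    (cs.simple i * cs.simple j) ^ n ≠ 1 := by
  intro h
  have hs : M j i = M i j := M.symmetric j i
  have h1 := M.off_diagonal i j hij
  have h2 := hM i j hij
  have e1 := congrArg (cs.lift ⟨geomRefl M, geomRefl_liftable hM⟩) h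
  rw [map_pow, map_mul, cs.lift_apply_simple, cs.lift_apply_simple, map_one] at e1
  have e2 := LinearEquiv.congr_fun e1 (Finsupp.single i 1)
  change ((Module.reflection (geomForm_self i) * Module.reflection (geomForm_self j)) ^ n)
    (Finsupp.single i 1) = Finsupp.single i 1 at e2
  rw [Module.reflection_mul_reflection_pow_apply_self _ _ _ _ (geom_trace i j)] at e2
  have ei := DFunLike.congr_fun e2 i
  have ej := DFunLike.congr_fun e2 j
  simp only [Finsupp.add_apply, Finsupp.smul_apply, Finsupp.single_eq_same,
    Finsupp.single_eq_of_ne hij, Finsupp.single_eq_of_ne hij.symm, smul_eq_mul, mul_zero, mul_one,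
    add_zero, zero_add] at ei ej
  rcases hn' with h0 | hlt
  -- For $m=\infty$, encoded as $0$, division by zero gives the angle $\pi/0=0$ and hence the
  -- pairing $-2$. The coefficient of $e_j$ then involves $S_{n-1}(2)=n\ne 0$.
  · rw [h0, Nat.cast_zero, div_zero, Real.cos_zero, mul_one, S_eval_two] at ej
    have hf : geomForm M j (Finsupp.single i 1) = -2 := by
      rw [geomForm_single, hs, h0, Nat.cast_zero, div_zero, Real.cos_zero, mul_one]
    have ej' := (mul_eq_zero.1 ej).resolve_right fun h => by
      have := neg_eq_zero.1 h
      linarith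
    push_cast at ej'
    have : (0 : ℝ) < n := by exact_mod_cast hn
    linarith
  · have h3 : 3 ≤ M i j := by omega
    have hsin := (sin_two_pi_div_pos h3)
    have hm : (3 : ℝ) ≤ M i j := by exact_mod_cast h3
    have hc : geomForm M j (Finsupp.single i 1) ≠ 0 := by
      rw [geomForm_single, hs]
      have : 0 < Real.cos (Real.pi / M i j) := by
        refine Real.cos_pos_of_mem_Ioo ⟨?_, ?_⟩
        · have : 0 < Real.pi / M i j := by positivity
          linarith [Real.pi_pos]
        · rw [div_lt_div_iff₀ (by linarith) (by norm_num)]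
          nlinarith [Real.pi_pos]
      nlinarith
    -- The coefficients of $e_j$ and $e_i$ give $\sin n\theta=0$ and $\cos n\theta=1$, which is
    -- impossible for $0<n\theta<2\pi$.
    have ej' : (S ℝ ((n : ℤ) - 1)).eval (2 * Real.cos (2 * Real.pi / M i j)) = 0 := by
      rcases mul_eq_zero.1 ej with h | h
      · exact h
      · exact absurd (neg_eq_zero.1 h) hc
    rw [ej', add_zero] at ei
    have s1 := S_two_mul_real_cos (2 * Real.pi / M i j) ((n : ℤ) - 1)
    have s2 := S_two_mul_real_cos (2 * Real.pi / M i j) n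
    rw [ej', zero_mul] at s1
    rw [ei, one_mul] at s2
    push_cast at s1 s2
    rw [sub_add_cancel] at s1
    rw [add_mul, one_mul, Real.sin_add, ← s1, zero_mul, zero_add] at s2
    have hcos : Real.cos (n * (2 * Real.pi / M i j)) = 1 :=
      mul_right_cancel₀ hsin.ne' (by rw [one_mul]; exact s2.symm)
    have hnm : (n : ℝ) < M i j := by exact_mod_cast hlt
    have hn0 : (0 : ℝ) < n := by exact_mod_cast hn
    have hθ : n * (2 * Real.pi / M i j) = 2 * Real.pi * (n / M i j) := by ring
    have hr : (n : ℝ) / M i j < 1 := by rw [div_lt_one (by linarith)]; exact hnm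
    have hr0 : 0 < (n : ℝ) / M i j := by positivity
    rw [hθ, Real.cos_eq_one_iff_of_lt_of_lt (by nlinarith [Real.pi_pos])
      (by nlinarith [Real.pi_pos])] at hcos
    have := Real.pi_pos
    have : 0 < 2 * Real.pi * (n / M i j) := by positivity
    linarith

end GeometricRepresentation

end CoxHecke

namespace CoxHecke

open CoxeterSystem

/-! ### Dihedral parabolic subgroups, coset decompositions and descents. -/

section Dihedral

variable {B W : Type*} [Group W] {M : CoxeterMatrix B} (cs : CoxeterSystem M W)

/-- The alternating product of `n` factors `s`, `t` that ends with `t`. -/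
def alt (s t : B) (n : ℕ) : W := cs.wordProd (alternatingWord s t n)

@[simp] theorem alt_zero (s t : B) : alt cs s t 0 = 1 := by simp [alt, alternatingWord]

theorem alt_succ (s t : B) (n : ℕ) : alt cs s t (n + 1) = alt cs t s n * cs.simple t := by
  rw [alt, alternatingWord_succ, cs.wordProd_concat, alt]

theorem alt_succ_left (s t : B) (n : ℕ) :
    alt cs s t (n + 1) = cs.simple (if Even n then t else s) * alt cs s t n := by
  rw [alt, alternatingWord_succ', cs.wordProd_cons, alt]

@[simp] theorem alt_one (s t : B) : alt cs s t 1 = cs.simple t := by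
  rw [alt_succ, alt_zero, one_mul]

theorem alt_comm (s t : B) : alt cs s t (M s t) = alt cs t s (M s t) := by
  have := cs.wordProd_braidWord_eq s t
  rwa [braidWord, braidWord, M.symmetric t s] at this

theorem pow_eq_one_of_alt_eq {s t : B} {n : ℕ} (h : alt cs s t n = alt cs t s n) :
    (cs.simple s * cs.simple t) ^ n = 1 := by
  have hi : cs.simple t * cs.simple s = (cs.simple s * cs.simple t)⁻¹ := by simp
  rw [alt, alt, prod_alternatingWord_eq_mul_pow, prod_alternatingWord_eq_mul_pow, hi] at h
  obtain ⟨k, rfl | rfl⟩ := Nat.even_or_odd' n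
  · rw [if_pos (by simp), if_pos (by simp), one_mul, one_mul,
      Nat.mul_div_cancel_left _ two_pos] at h
    rw [two_mul, pow_add]
    nth_rw 1 [h]
    rw [inv_pow, inv_mul_cancel]
  · have hk : ¬ Even (2 * k + 1) := by simp
    have e : (2 * k + 1) / 2 = k := by omega
    rw [if_neg hk, if_neg hk, e] at h
    have h' := congrArg (cs.simple s * ·) h
    simp only [← mul_assoc, cs.simple_mul_simple_self, one_mul, ← pow_succ'] at h'
    rw [show 2 * k + 1 = (k + 1) + k by ring, pow_add, h', inv_pow, inv_mul_cancel]


/-- If the length dropped on appending a letter, the exchange property would identify the two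
alternating products with $n+1$ factors. Then $(st)^{n+1}=1$ with $n+1<m_{st}$, against
`simple_mul_simple_pow_ne_one`. -/
theorem length_alt (hM : ∀ s t : B, s ≠ t → M s t ≠ 2) (n : ℕ) :
    ∀ {s t : B}, s ≠ t → (M s t = 0 ∨ n ≤ M s t) → cs.length (alt cs s t n) = n := by
  induction n using Nat.strong_induction_on with
  | _ n ih =>
    intro s t hst hn
    match n with
    | 0 => simp
    | 1 => simp
    | n + 2 =>
      have e1 : alt cs t s (n + 1) = cs.simple (if Even n then s else t) * alt cs t s n :=
        alt_succ_left cs t s n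
      have l0 := ih n (by omega) hst.symm (by rw [M.symmetric]; omega)
      have l1 := ih (n + 1) (by omega) hst.symm (by rw [M.symmetric]; omega)
      have l2 := ih (n + 1) (by omega) hst (by omega)
      rw [alt_succ cs s t (n + 1)]
      rcases cs.length_mul_simple (alt cs t s (n + 1)) t with h | h
      · rw [h, l1]
      · exfalso
        rw [e1] at l1 h
        rw [alt_succ] at l2
        have key := simple_mul_eq_mul_simple cs (w := alt cs t s n)
          (s := if Even n then s else t) (t := t) (by omega) (by omega) (by omega)
        rw [← e1, ← alt_succ] at key
        exact simple_mul_simple_pow_ne_one cs hM hst (n := n + 1) (by omega) (by omega)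
          (pow_eq_one_of_alt_eq cs key.symm)

/-- The standard parabolic subgroup generated by `s` and `t`. -/
def par (s t : B) : Subgroup W := Subgroup.closure (cs.simple '' {s, t})

theorem par_comm (s t : B) : par cs s t = par cs t s := by
  rw [par, par, Set.pair_comm]

theorem left_mem_par (s t : B) : cs.simple s ∈ par cs s t :=
  Subgroup.subset_closure ⟨s, by simp, rfl⟩

theorem right_mem_par (s t : B) : cs.simple t ∈ par cs s t :=
  Subgroup.subset_closure ⟨t, by simp, rfl⟩

theorem simple_mem_par {s t p : B} (h : p = s ∨ p = t) : cs.simple p ∈ par cs s t := by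
  rcases h with rfl | rfl
  · exact left_mem_par cs _ _
  · exact right_mem_par cs _ _

theorem alt_mem_par (n : ℕ) : ∀ s t : B, alt cs s t n ∈ par cs s t := by
  induction n with
  | zero => intro s t; rw [alt_zero]; exact one_mem _
  | succ n ih =>
    intro s t
    rw [alt_succ]
    refine mul_mem ?_ (right_mem_par cs s t)
    rw [par_comm]; exact ih t s

/-- An element of a dihedral parabolic subgroup is an alternating product. -/
theorem mem_par {s t : B} {u : W} (hu : u ∈ par cs s t) :
    ∃ n, (M s t = 0 ∨ n ≤ M s t) ∧ (u = alt cs s t n ∨ u = alt cs t s n) := by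
  have key : ∀ s t : B, ∀ n, (M s t = 0 ∨ n ≤ M s t) →
      ∃ m, (M s t = 0 ∨ m ≤ M s t) ∧
        (alt cs t s n * cs.simple t = alt cs s t m ∨ alt cs t s n * cs.simple t = alt cs t s m) := by
    intro s t n hn
    by_cases hn' : M s t = 0 ∨ n + 1 ≤ M s t
    · exact ⟨n + 1, hn', Or.inl (alt_succ cs s t n).symm⟩
    -- At the maximal length both alternating products coincide, so the element can be rewritten to
    -- end with $t$, which cancels.
    · have e : n = M s t := by omega
      obtain ⟨k, hk⟩ : ∃ k, n = k + 1 := ⟨n - 1, by omega⟩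
      refine ⟨k, by omega, Or.inr ?_⟩
      have e2 : alt cs t s n = alt cs s t n := by rw [e]; exact (alt_comm cs s t).symm
      rw [e2, hk, alt_succ, cs.simple_mul_simple_cancel_right]
  have key2 : ∀ s t : B, ∀ n, (M s t = 0 ∨ n ≤ M s t) →
      ∃ m, (M s t = 0 ∨ m ≤ M s t) ∧
        (alt cs s t n * cs.simple t = alt cs s t m ∨ alt cs s t n * cs.simple t = alt cs t s m) := by
    intro s t n hn
    cases n with
    | zero =>
      by_cases h : M s t = 0 ∨ 1 ≤ M s t
      · exact ⟨1, h, Or.inl (by simp)⟩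
      · omega
    | succ n => exact ⟨n, by omega, Or.inr (by
        rw [alt_succ, cs.simple_mul_simple_cancel_right])⟩
  have step : ∀ x, (∃ n, (M s t = 0 ∨ n ≤ M s t) ∧ (x = alt cs s t n ∨ x = alt cs t s n)) →
      ∀ p, p = s ∨ p = t →
      (∃ n, (M s t = 0 ∨ n ≤ M s t) ∧
        (x * cs.simple p = alt cs s t n ∨ x * cs.simple p = alt cs t s n)) := by
    rintro x ⟨n, hn, rfl | rfl⟩ p (rfl | rfl)
    · rw [M.symmetric] at hn ⊢
      obtain ⟨m, hm, h⟩ := key _ _ n hn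
      exact ⟨m, hm, h.symm⟩
    · exact key2 _ _ n hn
    · rw [M.symmetric] at hn ⊢
      obtain ⟨m, hm, h⟩ := key2 _ _ n hn
      exact ⟨m, hm, h.symm⟩
    · exact key _ _ n hn
  induction hu using Subgroup.closure_induction_right with
  | one => exact ⟨0, by omega, Or.inl (by simp)⟩
  | mul_right x _ y hy ih =>
    obtain ⟨p, hp, rfl⟩ := hy
    exact step x ih p hp
  | mul_inv_cancel x _ y hy ih =>
    obtain ⟨p, hp, rfl⟩ := hy
    rw [cs.inv_simple]
    exact step x ih p hp

theorem not_descent_of_simple_mul {g : W} {i s : B} (h : cs.length (cs.simple i * g) = cs.length g + 1)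
    (hs : ¬ cs.IsRightDescent (cs.simple i * g) s) : ¬ cs.IsRightDescent g s := by
  rw [cs.not_isRightDescent_iff] at hs ⊢
  have h1 := cs.length_mul_simple g s
  have h2 := cs.length_simple_mul (g * cs.simple s) i
  rw [mul_assoc] at hs
  omega

/-- Induction on $g=ig'$. If a letter $q$ appended to $ig'v$ lowers the length, exchange gives
$ig'=g'\cdot vqv^{-1}$. By the induction hypothesis for $g'$, the element $vqv^{-1}$ of the
parabolic subgroup has length $1$, so it is $s$ or $t$ and $ig'$ has it as a right descent. -/
theorem length_mul_par (hM : ∀ s t : B, s ≠ t → M s t ≠ 2) {s t : B} (hst : s ≠ t) {g : W}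
    (hs : ¬ cs.IsRightDescent g s) (ht : ¬ cs.IsRightDescent g t) :
    ∀ u ∈ par cs s t, cs.length (g * u) = cs.length g + cs.length u := by
  induction g using Hecke.left_induction (cs := cs) with
  | one => intro u _; simp
  | step i g' hi ih =>
    have hl := cs.not_isLeftDescent_iff.1 hi
    have ih' := ih (not_descent_of_simple_mul cs hl hs) (not_descent_of_simple_mul cs hl ht)
    have key : ∀ n, ∀ p q : B, (p = s ∧ q = t ∨ p = t ∧ q = s) → (M s t = 0 ∨ n ≤ M s t) →
        cs.length (cs.simple i * g' * alt cs p q n) = cs.length (cs.simple i * g') + n := by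
      intro n
      induction n with
      | zero => intro p q _ _; simp
      | succ n ihn =>
        intro p q hpq hn
        have hqp : q = s ∧ p = t ∨ q = t ∧ p = s := by tauto
        have i1 := ihn q p hqp (by omega)
        have hMpq : M p q = M s t := by
          rcases hpq with ⟨rfl, rfl⟩ | ⟨rfl, rfl⟩
          · rfl
          · exact M.symmetric _ _
        have hne : p ≠ q := by rcases hpq with ⟨rfl, rfl⟩ | ⟨rfl, rfl⟩ <;> tauto
        have hpar : par cs p q = par cs s t := by
          rcases hpq with ⟨rfl, rfl⟩ | ⟨rfl, rfl⟩
          · rfl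
          · exact par_comm cs _ _
        have m1 : alt cs q p n ∈ par cs s t := by rw [← hpar, par_comm]; exact alt_mem_par cs n q p
        have m2 : alt cs p q (n + 1) ∈ par cs s t := by rw [← hpar]; exact alt_mem_par cs _ p q
        have l1 := length_alt cs hM n hne.symm (by rw [M.symmetric]; omega)
        have l2 := length_alt cs hM (n + 1) hne (by omega)
        have i2 := ih' _ m1
        have i3 := ih' _ m2
        rw [alt_succ, ← mul_assoc] at i3
        rw [alt_succ, ← mul_assoc]
        rw [alt_succ] at l2
        rcases cs.length_mul_simple (cs.simple i * g' * alt cs q p n) q with h | h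
        · omega
        · exfalso
          rw [mul_assoc (cs.simple i)] at h i1
          have e := simple_mul_eq_mul_simple cs (w := g' * alt cs q p n) (s := i) (t := q)
            (by omega) (by omega) (by omega)
          have e2 : cs.simple i * g' =
              g' * (alt cs q p n * cs.simple q * (alt cs q p n)⁻¹) := by
            rw [← mul_assoc, eq_mul_inv_iff_mul_eq, mul_assoc, e, mul_assoc]
          have m3 : alt cs q p n * cs.simple q * (alt cs q p n)⁻¹ ∈ par cs s t := by
            rw [← alt_succ]; exact mul_mem m2 (inv_mem m1)
          have i4 := ih' _ m3
          rw [← e2, hl] at i4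
          obtain ⟨m, hm, h'⟩ := mem_par cs m3
          have hm1 : m = 1 := by
            rcases h' with h' | h' <;> rw [h', length_alt cs hM m] at i4
            · omega
            · exact hst
            · exact hm
            · omega
            · exact hst.symm
            · rwa [M.symmetric]
          subst hm1
          rw [alt_one, alt_one] at h'
          rcases h' with h' | h' <;> rw [e2, h'] at hs ht
          · exact ht (by rw [IsRightDescent, cs.simple_mul_simple_cancel_right, ← h', ← e2]; omega)
          · exact hs (by rw [IsRightDescent, cs.simple_mul_simple_cancel_right, ← h', ← e2]; omega)
    intro u hu
    obtain ⟨n, hn, rfl | rfl⟩ := mem_par cs hu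
    · rw [key n s t (by tauto) hn, length_alt cs hM n hst hn]
    · rw [key n t s (by tauto) hn, length_alt cs hM n hst.symm (by rwa [M.symmetric])]

theorem exists_par_decomp (s t : B) (w : W) :
    ∃ g, ∃ u ∈ par cs s t, w = g * u ∧ ¬ cs.IsRightDescent g s ∧ ¬ cs.IsRightDescent g t := by
  induction hn : cs.length w using Nat.strong_induction_on generalizing w with
  | _ n ih =>
    subst hn
    by_cases h : cs.IsRightDescent w s ∨ cs.IsRightDescent w t
    · obtain ⟨p, hp, hd⟩ : ∃ p, (p = s ∨ p = t) ∧ cs.IsRightDescent w p := by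
        rcases h with h | h
        · exact ⟨s, Or.inl rfl, h⟩
        · exact ⟨t, Or.inr rfl, h⟩
      obtain ⟨g, u, hu, e, h1, h2⟩ := ih _ hd _ rfl
      refine ⟨g, u * cs.simple p, mul_mem hu (simple_mem_par cs hp), ?_, h1, h2⟩
      rw [← mul_assoc, ← e, cs.simple_mul_simple_cancel_right]
    · rw [not_or] at h
      exact ⟨w, 1, one_mem _, by rw [mul_one], h.1, h.2⟩

theorem length_par_mul (hM : ∀ s t : B, s ≠ t → M s t ≠ 2) {s t : B} (hst : s ≠ t) {b : W}
    (hs : ¬ cs.IsLeftDescent b s) (ht : ¬ cs.IsLeftDescent b t) :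
    ∀ u ∈ par cs s t, cs.length (u * b) = cs.length u + cs.length b := by
  intro u hu
  rw [← cs.isRightDescent_inv_iff] at hs ht
  have := length_mul_par cs hM hst hs ht u⁻¹ (inv_mem hu)
  rw [← mul_inv_rev, cs.length_inv, cs.length_inv, cs.length_inv] at this
  omega

theorem exists_par_decomp_left (s t : B) (w : W) :
    ∃ b, ∃ u ∈ par cs s t, w = u * b ∧ ¬ cs.IsLeftDescent b s ∧ ¬ cs.IsLeftDescent b t := by
  obtain ⟨g, u, hu, e, h1, h2⟩ := exists_par_decomp cs s t w⁻¹
  refine ⟨g⁻¹, u⁻¹, inv_mem hu, ?_, ?_, ?_⟩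
  · rw [← mul_inv_rev, ← e, inv_inv]
  · rwa [cs.isLeftDescent_inv_iff]
  · rwa [cs.isLeftDescent_inv_iff]

theorem exists_rightDescent_of_mem_par {s t : B} {u : W} (hu : u ∈ par cs s t) (h1 : u ≠ 1)
    (hM : ∀ s t : B, s ≠ t → M s t ≠ 2) (hst : s ≠ t) :
    cs.IsRightDescent u s ∨ cs.IsRightDescent u t := by
  by_contra hc
  rw [not_or] at hc
  have := length_mul_par cs hM hst hc.1 hc.2 u⁻¹ (inv_mem hu)
  rw [mul_inv_cancel, cs.length_one, cs.length_inv] at this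
  exact h1 (cs.length_eq_zero_iff.1 (by omega))

theorem exists_leftDescent_of_mem_par {s t : B} {u : W} (hu : u ∈ par cs s t) (h1 : u ≠ 1)
    (hM : ∀ s t : B, s ≠ t → M s t ≠ 2) (hst : s ≠ t) :
    cs.IsLeftDescent u s ∨ cs.IsLeftDescent u t := by
  simp only [← cs.isRightDescent_inv_iff]
  exact exists_rightDescent_of_mem_par cs (inv_mem hu) (inv_ne_one.2 h1) hM hst

theorem rightDescent_of_mem_par {s t p p' : B} {u : W} (hu : u ∈ par cs s t) (h1 : u ≠ 1)
    (hM : ∀ s t : B, s ≠ t → M s t ≠ 2) (hst : s ≠ t) (hall : ∀ q, q = s ∨ q = t → q = p ∨ q = p')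
    (hp : ¬ cs.IsRightDescent u p) : cs.IsRightDescent u p' := by
  obtain ⟨q, hq, hd⟩ : ∃ q, (q = s ∨ q = t) ∧ cs.IsRightDescent u q := by
    rcases exists_rightDescent_of_mem_par cs hu h1 hM hst with h | h
    · exact ⟨s, Or.inl rfl, h⟩
    · exact ⟨t, Or.inr rfl, h⟩
  rcases hall q hq with rfl | rfl
  · exact absurd hd hp
  · exact hd

theorem leftDescent_of_mem_par {s t p p' : B} {u : W} (hu : u ∈ par cs s t) (h1 : u ≠ 1)
    (hM : ∀ s t : B, s ≠ t → M s t ≠ 2) (hst : s ≠ t) (hall : ∀ q, q = s ∨ q = t → q = p ∨ q = p')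
    (hp : ¬ cs.IsLeftDescent u p) : cs.IsLeftDescent u p' := by
  rw [← cs.isRightDescent_inv_iff] at hp ⊢
  exact rightDescent_of_mem_par cs (inv_mem hu) (inv_ne_one.2 h1) hM hst hall hp

theorem length_le_of_mem_par {s t : B} {u : W} (hu : u ∈ par cs s t)
    (hM : ∀ s t : B, s ≠ t → M s t ≠ 2) (hst : s ≠ t) (h0 : M s t ≠ 0) :
    cs.length u ≤ M s t ∧ (cs.length u = M s t → u = alt cs s t (M s t)) := by
  obtain ⟨n, hn, rfl | rfl⟩ := mem_par cs hu
  · rw [length_alt cs hM n hst hn]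
    exact ⟨by omega, fun h => by rw [h]⟩
  · rw [length_alt cs hM n hst.symm (by rwa [M.symmetric])]
    exact ⟨by omega, fun h => by rw [h, alt_comm]⟩

theorem eq_longest_of_descents {s t : B} {u : W} (hu : u ∈ par cs s t)
    (hM : ∀ s t : B, s ≠ t → M s t ≠ 2) (hst : s ≠ t)
    (h1 : cs.IsRightDescent u s) (h2 : cs.IsRightDescent u t) :
    M s t ≠ 0 ∧ u = alt cs s t (M s t) := by
  have key : ∀ p q, p ≠ q → ∀ n, (M p q = 0 ∨ n ≤ M p q) → cs.IsRightDescent (alt cs p q n) p →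
      n ≠ 0 → n = M p q := by
    intro p q hpq n hn hd h0
    by_contra hne
    have l1 := length_alt cs hM (n + 1) hpq.symm (by rw [M.symmetric]; omega)
    have l2 := length_alt cs hM n hpq hn
    rw [alt_succ] at l1
    rw [IsRightDescent] at hd
    omega
  obtain ⟨n, hn, rfl | rfl⟩ := mem_par cs hu
  · have h0 : n ≠ 0 := by rintro rfl; simp [IsRightDescent] at h1
    have := key s t hst n hn h1 h0
    exact ⟨by omega, by rw [this]⟩
  · have h0 : n ≠ 0 := by rintro rfl; simp [IsRightDescent] at h1
    have := key t s hst.symm n (by rwa [M.symmetric]) h2 h0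
    rw [M.symmetric] at this
    exact ⟨by omega, by rw [this, alt_comm]⟩

theorem rightDescent_mul_par (hM : ∀ s t : B, s ≠ t → M s t ≠ 2) {s t : B} (hst : s ≠ t) {g : W}
    (hs : ¬ cs.IsRightDescent g s) (ht : ¬ cs.IsRightDescent g t) {u : W} (hu : u ∈ par cs s t)
    {p : B} (hp : p = s ∨ p = t) : cs.IsRightDescent (g * u) p ↔ cs.IsRightDescent u p := by
  rw [IsRightDescent, IsRightDescent, mul_assoc, length_mul_par cs hM hst hs ht u hu,
    length_mul_par cs hM hst hs ht _ (mul_mem hu (simple_mem_par cs hp))]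
  omega

theorem leftDescent_par_mul (hM : ∀ s t : B, s ≠ t → M s t ≠ 2) {s t : B} (hst : s ≠ t) {b : W}
    (hs : ¬ cs.IsLeftDescent b s) (ht : ¬ cs.IsLeftDescent b t) {u : W} (hu : u ∈ par cs s t)
    {p : B} (hp : p = s ∨ p = t) : cs.IsLeftDescent (u * b) p ↔ cs.IsLeftDescent u p := by
  rw [IsLeftDescent, IsLeftDescent, ← mul_assoc, length_par_mul cs hM hst hs ht u hu,
    length_par_mul cs hM hst hs ht _ (mul_mem (simple_mem_par cs hp) hu)]
  omega

/-- An element with two right descents ends with the longest element of a finite dihedral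
parabolic subgroup. -/
theorem exists_longest_of_descents (hM : ∀ s t : B, s ≠ t → M s t ≠ 2) {s t : B} (hst : s ≠ t)
    {w : W} (h1 : cs.IsRightDescent w s) (h2 : cs.IsRightDescent w t) :
    M s t ≠ 0 ∧ ∃ g, w = g * alt cs s t (M s t) ∧
      ¬ cs.IsRightDescent g s ∧ ¬ cs.IsRightDescent g t := by
  obtain ⟨g, u, hu, rfl, hs, ht⟩ := exists_par_decomp cs s t w
  rw [rightDescent_mul_par cs hM hst hs ht hu (by simp)] at h1 h2
  obtain ⟨h0, rfl⟩ := eq_longest_of_descents cs hu hM hst h1 h2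
  exact ⟨h0, g, rfl, hs, ht⟩

theorem exists_longest_of_leftDescents (hM : ∀ s t : B, s ≠ t → M s t ≠ 2) {s t : B} (hst : s ≠ t)
    {w : W} (h1 : cs.IsLeftDescent w s) (h2 : cs.IsLeftDescent w t) :
    M s t ≠ 0 ∧ ∃ b, w = alt cs s t (M s t) * b ∧
      ¬ cs.IsLeftDescent b s ∧ ¬ cs.IsLeftDescent b t := by
  obtain ⟨b, u, hu, rfl, hs, ht⟩ := exists_par_decomp_left cs s t w
  rw [leftDescent_par_mul cs hM hst hs ht hu (by simp), ← cs.isRightDescent_inv_iff] at h1 h2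
  obtain ⟨h0, e⟩ := eq_longest_of_descents cs (inv_mem hu) hM hst h1 h2
  refine ⟨h0, b, ?_, hs, ht⟩
  have := (length_le_of_mem_par cs hu hM hst h0).2
    (by rw [← cs.length_inv, e, length_alt cs hM _ hst (Or.inr le_rfl)])
  rw [← this]

theorem three_le (hM : ∀ s t : B, s ≠ t → M s t ≠ 2) {s t : B} (hst : s ≠ t) (h0 : M s t ≠ 0) :
    3 ≤ M s t := by
  have := M.off_diagonal s t hst
  have := hM s t hst
  omega

/-- Here $w=g\,w_{rs}$, and the letters of $w_{rs}$ can be stripped alternately from the right: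
three of them because $m_{rs}\ge 3$, and a fourth unless $m_{rs}=3$. -/
theorem descents_of_descents (hM : ∀ s t : B, s ≠ t → M s t ≠ 2) {r s : B} (hrs : r ≠ s)
    {w : W} (h1 : cs.IsRightDescent w r) (h2 : cs.IsRightDescent w s) :
    cs.IsRightDescent (w * cs.simple r) s ∧
      cs.IsRightDescent (w * cs.simple r * cs.simple s) r ∧
      (M r s ≠ 3 → cs.IsRightDescent (w * cs.simple r * cs.simple s * cs.simple r) s) := by
  obtain ⟨h0, g, rfl, hr, hs⟩ := exists_longest_of_descents cs hM hrs h1 h2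
  have h3 := three_le hM hrs h0
  obtain ⟨m, hm⟩ : ∃ m, M r s = m + 3 := ⟨M r s - 3, by omega⟩
  have l1 : ∀ n, n ≤ m + 3 → cs.length (g * alt cs r s n) = cs.length g + n := fun n hn => by
    rw [length_mul_par cs hM hrs hr hs _ (alt_mem_par cs n r s), length_alt cs hM n hrs (by omega)]
  have l2 : ∀ n, n ≤ m + 3 → cs.length (g * alt cs s r n) = cs.length g + n := fun n hn => by
    rw [length_mul_par cs hM hrs hr hs _ (by rw [par_comm]; exact alt_mem_par cs n s r),
      length_alt cs hM n hrs.symm (by rw [M.symmetric]; omega)]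
  have e1 : g * alt cs r s (M r s) * cs.simple r = g * alt cs r s (m + 2) := by
    rw [alt_comm, hm, alt_succ, ← mul_assoc, cs.simple_mul_simple_cancel_right]
  have e2 : g * alt cs r s (m + 2) * cs.simple s = g * alt cs s r (m + 1) := by
    rw [alt_succ, ← mul_assoc, cs.simple_mul_simple_cancel_right]
  have e3 : g * alt cs s r (m + 1) * cs.simple r = g * alt cs r s m := by
    rw [alt_succ, ← mul_assoc, cs.simple_mul_simple_cancel_right]
  simp only [IsRightDescent, e1, e2, e3, l1 (m + 2) (by omega), l2 (m + 1) (by omega),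
    l1 m (by omega)]
  refine ⟨by omega, by omega, fun h => ?_⟩
  obtain ⟨k, hk⟩ : ∃ k, m = k + 1 := ⟨m - 1, by omega⟩
  rw [hk, alt_succ, ← mul_assoc, cs.simple_mul_simple_cancel_right, l2 k (by omega)]
  omega

/-- If `w` has two right descents `r`, `s`, then `s` is the only right descent of `wr`. -/
theorem eq_of_descents (hM : ∀ s t : B, s ≠ t → M s t ≠ 2) (w : W) :
    ∀ {r s p : B}, r ≠ s → cs.IsRightDescent w r → cs.IsRightDescent w s →
      cs.IsRightDescent (w * cs.simple r) p → p = s := by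
  induction hn : cs.length w using Nat.strong_induction_on generalizing w with
  | _ n ih =>
    subst hn
    intro r s p hrs h1 h2 h3
    by_contra hps
    obtain ⟨d1, d2, -⟩ := descents_of_descents cs hM hrs h1 h2
    -- The shorter element $wr$ has the descents $s$ and $p$, and $wrs$ still has the descent $r$
    -- because $m_{rs}\ge3$. Induction forces $p=r$, but $r$ is no descent of $wr$.
    have := ih _ h1 _ rfl (Ne.symm hps) d1 h3 d2
    subst this
    rw [IsRightDescent, cs.simple_mul_simple_cancel_right] at h3
    rw [IsRightDescent] at h1
    omega

theorem eq_of_leftDescents (hM : ∀ s t : B, s ≠ t → M s t ≠ 2) {w : W}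
    {r s p : B} (hrs : r ≠ s) (h1 : cs.IsLeftDescent w r) (h2 : cs.IsLeftDescent w s)
    (h3 : cs.IsLeftDescent (cs.simple r * w) p) : p = s := by
  rw [← cs.isRightDescent_inv_iff] at h1 h2 h3
  rw [mul_inv_rev, cs.inv_simple] at h3
  exact eq_of_descents cs hM _ hrs h1 h2 h3

end Dihedral

/-! ### Non-reduced products in the absence of commuting generators. -/

section Reduced

variable {B W : Type*} [Group W] {M : CoxeterMatrix B} (cs : CoxeterSystem M W)

theorem length_add_of_length_add_left {x y z : W}
    (h : cs.length (x * (y * z)) = cs.length x + cs.length y + cs.length z) :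
    cs.length (x * y) = cs.length x + cs.length y ∧
      cs.length (y * z) = cs.length y + cs.length z := by
  have h1 := cs.length_mul_le x y
  have h2 := cs.length_mul_le (x * y) z
  have h3 := cs.length_mul_le y z
  have h4 := cs.length_mul_le x (y * z)
  rw [mul_assoc] at h2
  omega

theorem IsLeftDescent.mul_right {x y : W} {i : B} (hd : cs.IsLeftDescent x i)
    (h : cs.length (x * y) = cs.length x + cs.length y) : cs.IsLeftDescent (x * y) i := by
  rw [IsLeftDescent] at *
  have := cs.length_mul_le (cs.simple i * x) y
  rw [mul_assoc] at this
  omega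

theorem IsRightDescent.mul_left {x y : W} {i : B} (hd : cs.IsRightDescent y i)
    (h : cs.length (x * y) = cs.length x + cs.length y) : cs.IsRightDescent (x * y) i := by
  rw [IsRightDescent] at *
  have := cs.length_mul_le x (y * cs.simple i)
  rw [← mul_assoc] at this
  omega

theorem IsLeftDescent.mul_right_of_descent {x y : W} {i j : B} (hd : cs.IsLeftDescent x j)
    (hd' : cs.IsLeftDescent (cs.simple j * x) i)
    (h : cs.length (x * y) = cs.length x + cs.length y) :
    cs.IsLeftDescent (cs.simple j * (x * y)) i := by
  rw [← mul_assoc]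
  refine IsLeftDescent.mul_right cs hd' ?_
  have h1 := cs.isLeftDescent_iff.1 hd
  have h2 := cs.isLeftDescent_iff.1 (IsLeftDescent.mul_right cs hd h)
  rw [mul_assoc]
  omega

/-- If `xy` is not reduced, then either `x` and `y` have a common descent, or `x` ends and `y`
starts with alternating products of the same two generators. -/
theorem descents_of_not_reduced (hM : ∀ s t : B, s ≠ t → M s t ≠ 2) {x : W} (y : W) :
    (∀ q, cs.IsRightDescent x q → ¬ cs.IsLeftDescent y q) →
    cs.length (x * y) ≠ cs.length x + cs.length y →
    ∃ i j, i ≠ j ∧ cs.IsRightDescent x i ∧ cs.IsRightDescent (x * cs.simple i) j ∧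
      cs.IsLeftDescent y j ∧ cs.IsLeftDescent (cs.simple j * y) i := by
  induction hn : cs.length y using Nat.strong_induction_on generalizing y with
  | _ n ih =>
    subst hn
    intro hd hxy
    -- Left descents of a reduced prefix persist, so the conclusion passes from a proper prefix
    -- $y_1$ with $xy_1$ not reduced to $y$.
    have prefix_case : ∀ y1 y2, y = y1 * y2 → cs.length y = cs.length y1 + cs.length y2 →
        cs.length y1 < cs.length y → cs.length (x * y1) ≠ cs.length x + cs.length y1 →
        ∃ i j, i ≠ j ∧ cs.IsRightDescent x i ∧ cs.IsRightDescent (x * cs.simple i) j ∧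
        cs.IsLeftDescent y j ∧ cs.IsLeftDescent (cs.simple j * y) i := by
      rintro y1 y2 rfl hl hlt hne
      obtain ⟨i, j, hij, h1, h2, h3, h4⟩ := ih _ hlt _ rfl
        (fun q hq hq' => hd q hq (IsLeftDescent.mul_right cs hq' hl)) hne
      exact ⟨i, j, hij, h1, h2, IsLeftDescent.mul_right cs h3 hl,
        IsLeftDescent.mul_right_of_descent cs h3 h4 hl⟩
    have hy1 : y ≠ 1 := by rintro rfl; simp at hxy
    obtain ⟨t, ht⟩ := cs.exists_rightDescent_of_ne_one hy1
    obtain ⟨y0, rfl⟩ : ∃ y0, y = y0 * cs.simple t :=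
      ⟨y * cs.simple t, (cs.simple_mul_simple_cancel_right t).symm⟩
    have hl := cs.isRightDescent_iff.1 ht
    rw [cs.simple_mul_simple_cancel_right] at hl
    by_cases hx0 : cs.length (x * y0) = cs.length x + cs.length y0
    swap
    · exact prefix_case y0 _ rfl (by rw [cs.length_simple, hl]) (by omega) hx0
    have hdt : cs.IsRightDescent (x * y0) t := by
      rw [IsRightDescent]
      have := cs.length_mul_simple (x * y0) t
      rw [mul_assoc] at this ⊢
      omega
    have hy0 : y0 ≠ 1 := by
      rintro rfl
      rw [mul_one] at hdt
      refine hd t hdt ?_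
      rw [one_mul, IsLeftDescent, cs.simple_mul_simple_self]
      simp
    obtain ⟨t', ht'⟩ := cs.exists_rightDescent_of_ne_one hy0
    have htt' : t ≠ t' := by
      rintro rfl
      rw [IsRightDescent] at ht'
      omega
    have hdt' := IsRightDescent.mul_left cs ht' hx0
    -- Two factorisations of $xy_0$ are compared: $y_0=cv$ with $c$ minimal in its coset, and
    -- $xy_0=g\,w_0$ because of the descents $t,t'$. Hence $xc=gu$ with $uv=w_0$ and
    -- $l(u)+l(v)=m_{tt'}$.
    obtain ⟨c, v, hv, rfl, hc, hc'⟩ := exists_par_decomp cs t t' y0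
    have lcv := length_mul_par cs hM htt' hc hc' v hv
    have hvt := mul_mem hv (left_mem_par cs t t')
    have lcvt := length_mul_par cs hM htt' hc hc' _ hvt
    have lx := length_add_of_length_add_left cs (x := x) (y := c) (z := v) (by omega)
    obtain ⟨h0, g, hg, hgt, hgt'⟩ := exists_longest_of_descents cs hM htt' hdt hdt'
    have hw0 := alt_mem_par cs (M t t') t t'
    set w0 := alt cs t t' (M t t') with hw0def
    have lw0 : cs.length w0 = M t t' := length_alt cs hM _ htt' (Or.inr le_rfl)
    have hu := mul_mem hw0 (inv_mem hv)
    set u := w0 * v⁻¹ with hudef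
    have exc : x * c = g * u := by
      rw [hudef, ← mul_assoc, ← hg]; group
    have lgu := length_mul_par cs hM htt' hgt hgt' u hu
    have lgw := length_mul_par cs hM htt' hgt hgt' w0 hw0
    have h3 := three_le hM htt' h0
    have hvtle := length_le_of_mem_par cs hvt hM htt' h0
    rw [← hw0def] at hvtle
    have lv1 : cs.length (v * cs.simple t) = cs.length v + 1 := by
      rw [mul_assoc] at hl; omega
    rw [← exc] at lgu
    rw [← hg] at lgw
    have luv : cs.length u + cs.length v = M t t' := by omega
    have hv1 : v ≠ 1 := by
      rintro rfl
      rw [mul_one] at ht'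
      exact hc' ht'
    have hu1 : u ≠ 1 := by
      intro h; rw [h, cs.length_one] at luv; omega
    obtain ⟨p, p', hp, hp', hpp', hup, hall⟩ : ∃ p p', (p = t ∨ p = t') ∧ (p' = t ∨ p' = t') ∧
        p ≠ p' ∧ cs.IsRightDescent u p ∧ ∀ q, q = t ∨ q = t' → q = p ∨ q = p' := by
      rcases exists_rightDescent_of_mem_par cs hu hu1 hM htt' with h | h
      · exact ⟨t, t', by simp, by simp, htt', h, fun q hq => hq⟩
      · exact ⟨t', t, by simp, by simp, htt'.symm, h, fun q hq => hq.symm⟩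
    have hup1 := cs.isRightDescent_iff.1 hup
    have hupm := mul_mem hu (simple_mem_par cs hp)
    have hupp : 2 ≤ cs.length u → cs.IsRightDescent (u * cs.simple p) p' := by
      intro h
      have : u * cs.simple p ≠ 1 := by
        intro h'; rw [h', cs.length_one] at hup1; omega
      have hnp : ¬ cs.IsRightDescent (u * cs.simple p) p :=
        cs.isRightDescent_iff_not_isRightDescent_mul.1 hup
      exact rightDescent_of_mem_par cs hupm this hM htt' hall hnp
    -- If $c=1$, then $x=gu$ and $y=vt$ meet inside one dihedral group. There $l(u)\ge2$, since
    -- $l(u)=1$ would make $vt=w_0$ and give $x$ and $y$ the common descent $p$.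
    by_cases hc1 : c = 1
    · subst hc1
      rw [mul_one] at exc
      rw [one_mul] at *
      have hxp : cs.IsRightDescent x p := by
        rw [exc, rightDescent_mul_par cs hM htt' hgt hgt' hu hp]; exact hup
      have hyp := hd p hxp
      have hu2 : 2 ≤ cs.length u := by
        by_contra hlt
        have hlu : cs.length u ≠ 0 := fun h => hu1 (cs.length_eq_zero_iff.1 h)
        have e := hvtle.2 (by omega)
        apply hyp
        rw [e]
        have hlt2 := length_le_of_mem_par cs (mul_mem (simple_mem_par cs hp) hw0) hM htt' h0
        have := cs.length_simple_mul w0 p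
        rw [IsLeftDescent]
        omega
      have hyp' : cs.IsLeftDescent (v * cs.simple t) p' := by
        exact leftDescent_of_mem_par cs hvt hy1 hM htt' hall hyp
      refine ⟨p, p', hpp', hxp, ?_, hyp', ?_⟩
      · rw [exc, mul_assoc, rightDescent_mul_par cs hM htt' hgt hgt' hupm hp']
        exact hupp hu2
      · have hl2 := cs.isLeftDescent_iff.1 hyp'
        have hlv : cs.length v ≠ 0 := fun h => hv1 (cs.length_eq_zero_iff.1 h)
        have hne : cs.simple p' * (v * cs.simple t) ≠ 1 := by
          intro h; rw [h, cs.length_one] at hl2; omega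
        have hnp := cs.isLeftDescent_iff_not_isLeftDescent_mul.1 hyp'
        exact leftDescent_of_mem_par cs (mul_mem (simple_mem_par cs hp') hvt) hne hM htt'
          (fun q hq => (hall q hq).symm) hnp
    · obtain ⟨r, hr⟩ := cs.exists_rightDescent_of_ne_one hc1
      have hrt : r ≠ t := by rintro rfl; exact hc hr
      have hrt' : r ≠ t' := by rintro rfl; exact hc' hr
      have hrp : r ≠ p := by rcases hp with rfl | rfl <;> assumption
      have hrp' : r ≠ p' := by rcases hp' with rfl | rfl <;> assumption
      have hzr := IsRightDescent.mul_left cs hr lx.1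
      have hzp : cs.IsRightDescent (x * c) p := by
        rw [exc, rightDescent_mul_par cs hM htt' hgt hgt' hu hp]; exact hup
      -- The element $xc$ has the descents $p$ and $r\notin\{t,t'\}$, so $r$ is the only descent of
      -- $xcp$; if $l(u)\ge2$, then $p'$ would be another one. So $l(u)=1$ and $vt=w_0$. Now $cp$ is
      -- a proper prefix of $y$, and $x\cdot cp$ is not reduced.
      have hu1' : cs.length u = 1 := by
        by_contra hne
        have hlu : cs.length u ≠ 0 := fun h => hu1 (cs.length_eq_zero_iff.1 h)
        have h5 : cs.IsRightDescent (x * c * cs.simple p) p' := by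
          rw [exc, mul_assoc, rightDescent_mul_par cs hM htt' hgt hgt' hupm hp']
          exact hupp (by omega)
        exact hrp' (eq_of_descents cs hM _ hrp.symm hzp hzr h5).symm
      have e := hvtle.2 (by omega)
      have hpw := mul_mem (simple_mem_par cs hp) hw0
      have hlt2 := length_le_of_mem_par cs hpw hM htt' h0
      have hpw2 := cs.length_simple_mul w0 p
      have lcp : cs.length (c * cs.simple p) = cs.length c + 1 := by
        rw [length_mul_par cs hM htt' hc hc' _ (simple_mem_par cs hp), cs.length_simple]
      refine prefix_case (c * cs.simple p) (cs.simple p * w0) ?_ ?_ ?_ ?_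
      · rw [mul_assoc, e, mul_assoc, cs.simple_mul_simple_cancel_left]
      · rw [mul_assoc, lcvt, lcp, e]
        omega
      · rw [mul_assoc, lcvt, lcp]; omega
      · rw [← mul_assoc]
        rw [IsRightDescent] at hzp
        omega

/-- The last three letters of $w$ shield $b$ from $a$: the elements $aw$, $awp$, $awpp'$ have the
descents $p$, $p'$, $p$. By `eq_of_descents`, neither $aw$ nor the result of removing its descent
$p$ or $p'$ has a descent outside $\{s,t\}$. A failure would produce such a descent, namely a left
descent of $b$. -/
theorem length_mul_mul_of_par (hM : ∀ s t : B, s ≠ t → M s t ≠ 2) {s t : B} (hst : s ≠ t)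
    {a b w : W} (has : ¬ cs.IsRightDescent a s) (hat : ¬ cs.IsRightDescent a t)
    (hbs : ¬ cs.IsLeftDescent b s) (hbt : ¬ cs.IsLeftDescent b t) (hw : w ∈ par cs s t)
    (h3 : 3 ≤ cs.length w) :
    cs.length (a * w * b) = cs.length a + cs.length w + cs.length b := by
  obtain ⟨p, p', hp, hp', hpp', hwp, hall⟩ : ∃ p p', (p = s ∨ p = t) ∧ (p' = s ∨ p' = t) ∧
      p ≠ p' ∧ cs.IsRightDescent w p ∧ ∀ q, q = s ∨ q = t → q = p ∨ q = p' := by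
    rcases exists_rightDescent_of_mem_par cs hw (by rintro rfl; simp at h3) hM hst with h | h
    · exact ⟨s, t, by simp, by simp, hst, h, fun q hq => hq⟩
    · exact ⟨t, s, by simp, by simp, hst.symm, h, fun q hq => hq.symm⟩
  have step : ∀ v ∈ par cs s t, ∀ q q', (q = s ∨ q = t) → (∀ r, r = s ∨ r = t → r = q ∨ r = q') →
      cs.IsRightDescent v q → 2 ≤ cs.length v → cs.IsRightDescent (v * cs.simple q) q' := by
    intro v hv q q' hq hqq hvq h2
    have h1 := cs.isRightDescent_iff.1 hvq
    have hne : v * cs.simple q ≠ 1 := by intro h; rw [h, cs.length_one] at h1; omega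
    have hnq := cs.isRightDescent_iff_not_isRightDescent_mul.1 hvq
    exact rightDescent_of_mem_par cs (mul_mem hv (simple_mem_par cs hq)) hne hM hst hqq hnq
  have lwp := cs.isRightDescent_iff.1 hwp
  have m1 := mul_mem hw (simple_mem_par cs hp)
  have d1 := step w hw p p' hp hall hwp (by omega)
  have lwp' := cs.isRightDescent_iff.1 d1
  have d2 := step _ m1 p' p hp' (fun r hr => (hall r hr).symm) d1 (by omega)
  have m2 := mul_mem m1 (simple_mem_par cs hp')
  have x0 : cs.IsRightDescent (a * w) p := by
    rwa [rightDescent_mul_par cs hM hst has hat hw hp]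
  have x1 : cs.IsRightDescent (a * w * cs.simple p) p' := by
    rwa [mul_assoc, rightDescent_mul_par cs hM hst has hat m1 hp']
  have x2 : cs.IsRightDescent (a * w * cs.simple p * cs.simple p') p := by
    rwa [mul_assoc a, mul_assoc a, rightDescent_mul_par cs hM hst has hat m2 hp]
  have hx : ∀ q, cs.IsRightDescent (a * w) q → q = p ∨ q = p' := by
    intro q hq
    by_contra hne
    rw [not_or] at hne
    exact hne.2 (eq_of_descents cs hM _ (Ne.symm hne.1) x0 hq x1).symm
  have hbp : ¬ cs.IsLeftDescent b p := by rcases hp with rfl | rfl <;> assumption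
  have hbp' : ¬ cs.IsLeftDescent b p' := by rcases hp' with rfl | rfl <;> assumption
  rw [← length_mul_par cs hM hst has hat w hw]
  by_contra hne
  obtain ⟨i, j, -, h1, h2, h3, -⟩ := descents_of_not_reduced cs hM b (fun q hq => by
    rcases hx q hq with rfl | rfl <;> assumption) hne
  have hjp : j ≠ p := by rintro rfl; exact hbp h3
  have hjp' : j ≠ p' := by rintro rfl; exact hbp' h3
  rcases hx i h1 with rfl | rfl
  · exact hjp (eq_of_descents cs hM _ hjp'.symm x1 h2 x2).symm
  · exact hjp (eq_of_descents cs hM _ hpp'.symm h1 x0 h2)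

/-- The dihedral alternative of `descents_of_not_reduced` is impossible: uniqueness of the descent
that remains after a removal would give $r=s$ or make $r$ a left descent of $sb$. So there is a
common descent. It is neither $r$ nor $s$, since $s$ is no right descent of $ar$ and $r$ no left
descent of $sb$. -/
theorem exists_descent_of_not_reduced (hM : ∀ s t : B, s ≠ t → M s t ≠ 2) {r s : B} (hrs : r ≠ s)
    {a b : W} (har : ¬ cs.IsRightDescent a r) (has : ¬ cs.IsRightDescent a s)
    (hbr : ¬ cs.IsLeftDescent b r) (hbs : ¬ cs.IsLeftDescent b s)
    (h : cs.length (a * cs.simple r * (cs.simple s * b)) ≠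
      cs.length (a * cs.simple r) + cs.length (cs.simple s * b)) :
    ∃ p, p ≠ r ∧ p ≠ s ∧ cs.IsRightDescent (a * cs.simple r) p ∧
      cs.IsLeftDescent (cs.simple s * b) p := by
  have mr := left_mem_par cs r s
  have ms := right_mem_par cs r s
  have lrs : cs.length (cs.simple r * cs.simple s) = 2 := by
    have := length_alt cs hM 2 hrs (by have := @three_le B M hM r s hrs; omega)
    rwa [alt_succ, alt_one] at this
  have hxr : cs.IsRightDescent (a * cs.simple r) r := by
    rw [cs.isRightDescent_iff_not_isRightDescent_mul, cs.simple_mul_simple_cancel_right]; exact har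
  have hys : cs.IsLeftDescent (cs.simple s * b) s := by
    rw [cs.isLeftDescent_iff_not_isLeftDescent_mul, cs.simple_mul_simple_cancel_left]; exact hbs
  have hxs : ¬ cs.IsRightDescent (a * cs.simple r) s := by
    rw [rightDescent_mul_par cs hM hrs har has mr (by simp), IsRightDescent, lrs, cs.length_simple]
    omega
  have hyr : ¬ cs.IsLeftDescent (cs.simple s * b) r := by
    rw [leftDescent_par_mul cs hM hrs hbr hbs ms (by simp), IsLeftDescent, lrs, cs.length_simple]
    omega
  by_cases hq : ∃ q, cs.IsRightDescent (a * cs.simple r) q ∧ cs.IsLeftDescent (cs.simple s * b) q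
  · obtain ⟨q, h1, h2⟩ := hq
    exact ⟨q, by rintro rfl; exact hyr h2, by rintro rfl; exact hxs h1, h1, h2⟩
  · exfalso
    push Not at hq
    obtain ⟨i, j, hij, h1, h2, h3, h4⟩ := descents_of_not_reduced cs hM _ hq h
    by_cases hi : i = r
    · subst hi
      rw [cs.simple_mul_simple_cancel_right] at h2
      have hjs : j ≠ s := by rintro rfl; exact has h2
      exact hrs (eq_of_leftDescents cs hM hjs h3 hys h4)
    · have := eq_of_descents cs hM _ hi h1 hxr h2
      subst this
      exact hyr h3

end Reduced

end CoxHecke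

namespace CoxHecke

open CoxeterSystem

/-! ### Weights on dihedral parabolic subgroups. -/

section Weight

variable {B W : Type*} [Group W] {M : CoxeterMatrix B} {cs : CoxeterSystem M W}

theorem weight_one (L : WeightFunction cs) : L 1 = 0 := by
  have := L.map_mul_of_length_add 1 1 (by simp)
  rw [mul_one] at this
  omega

theorem weight_alt (L : WeightFunction cs) (hM : ∀ s t : B, s ≠ t → M s t ≠ 2) (n : ℕ) :
    ∀ {s t : B}, s ≠ t → (M s t = 0 ∨ n ≤ M s t) →
      L (alt cs s t n) = ((n + 1) / 2 : ℕ) * L (cs.simple t) + (n / 2 : ℕ) * L (cs.simple s) := by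
  induction n with
  | zero => intro s t _ _; simp [weight_one]
  | succ n ih =>
    intro s t hst hn
    have l1 := length_alt cs hM (n + 1) hst hn
    have l2 := length_alt cs hM n hst.symm (by rw [M.symmetric]; omega)
    rw [alt_succ] at l1 ⊢
    rw [L.map_mul_of_length_add _ _ (by rw [l1, l2, cs.length_simple]),
      ih hst.symm (by rw [M.symmetric]; omega), show (n + 1 + 1) / 2 = n / 2 + 1 by omega]
    push_cast
    ring

theorem weight_eq_of_odd (L : WeightFunction cs) (hM : ∀ s t : B, s ≠ t → M s t ≠ 2) {s t : B}
    (hst : s ≠ t) (h : Odd (M s t)) : L (cs.simple s) = L (cs.simple t) := by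
  have h1 := weight_alt L hM (M s t) hst (Or.inr le_rfl)
  have h2 := weight_alt L hM (M s t) hst.symm (by rw [M.symmetric]; omega)
  obtain ⟨k, hk⟩ := h
  rw [← alt_comm, h1, hk, show (2 * k + 1 + 1) / 2 = k + 1 by omega,
    show (2 * k + 1) / 2 = k by omega] at h2
  push_cast at h2
  linarith

/-- Each generator occurs at least twice in the longest element if $m_{st}\ge4$, and for $m_{st}=3$
the two weights agree. These inequalities pay for the terms with dihedral factor of length two in
`mul_mem_of_rightDescents`. -/
theorem weight_longest (L : WeightFunction cs) (hM : ∀ s t : B, s ≠ t → M s t ≠ 2) {s t : B}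
    (hst : s ≠ t) (h0 : M s t ≠ 0) :
    2 * L (cs.simple s) + L (cs.simple t) ≤ L (alt cs s t (M s t)) ∧
      L (cs.simple s) + 2 * L (cs.simple t) ≤ L (alt cs s t (M s t)) := by
  have h3 := three_le hM hst h0
  have hs := L.pos s
  have ht := L.pos t
  rw [weight_alt L hM (M s t) hst (Or.inr le_rfl)]
  by_cases h : M s t = 3
  · have e := weight_eq_of_odd L hM hst (by rw [h]; decide)
    rw [h, e]
    constructor <;> push_cast <;> norm_num
    linarith
  · have a1 : (2 : ℤ) ≤ ((M s t + 1) / 2 : ℕ) := by norm_cast; omega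
    have a2 : (2 : ℤ) ≤ (M s t / 2 : ℕ) := by norm_cast; omega
    constructor <;> nlinarith

theorem weight_lt_longest (L : WeightFunction cs) (hM : ∀ s t : B, s ≠ t → M s t ≠ 2) {s t : B}
    (hst : s ≠ t) (h0 : M s t ≠ 0) {w : W} (hw : w ∈ par cs s t)
    (hne : w ≠ alt cs s t (M s t)) : L w < L (alt cs s t (M s t)) := by
  have key : ∀ k n, ∀ p q : B, (p = s ∧ q = t ∨ p = t ∧ q = s) → n + k + 1 = M s t →
      L (alt cs p q n) < L (alt cs s t (M s t)) := by
    intro k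
    induction k with
    | zero =>
      intro n p q hpq hn
      have e : alt cs s t (M s t) = alt cs p q n * cs.simple p := by
        rw [← alt_succ]
        rcases hpq with ⟨rfl, rfl⟩ | ⟨rfl, rfl⟩
        · rw [alt_comm, ← hn]
        · rw [← hn]
      have hne : p ≠ q := by rcases hpq with ⟨rfl, rfl⟩ | ⟨rfl, rfl⟩ <;> tauto
      have hMpq : M p q = M s t := by
        rcases hpq with ⟨rfl, rfl⟩ | ⟨rfl, rfl⟩
        · rfl
        · exact M.symmetric _ _
      rw [e, L.map_mul_of_length_add]
      · linarith [L.pos p]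
      · rw [← e, length_alt cs hM _ hst (Or.inr le_rfl), length_alt cs hM n hne (by omega),
          cs.length_simple]
        omega
    | succ k ih =>
      intro n p q hpq hn
      have hne : p ≠ q := by rcases hpq with ⟨rfl, rfl⟩ | ⟨rfl, rfl⟩ <;> tauto
      have hMpq : M p q = M s t := by
        rcases hpq with ⟨rfl, rfl⟩ | ⟨rfl, rfl⟩
        · rfl
        · exact M.symmetric _ _
      have := ih (n + 1) q p (by tauto) (by omega)
      rw [alt_succ, L.map_mul_of_length_add] at this
      · linarith [L.pos p]
      · rw [← alt_succ, length_alt cs hM _ hne.symm (by rw [M.symmetric]; omega),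
          length_alt cs hM n hne (by omega), cs.length_simple]
  obtain ⟨n, hn, rfl | rfl⟩ := mem_par cs hw
  · have : n ≠ M s t := by rintro rfl; exact hne rfl
    exact key (M s t - n - 1) n s t (by tauto) (by omega)
  · have : n ≠ M s t := by rintro rfl; exact hne (alt_comm cs s t).symm
    exact key (M s t - n - 1) n t s (by tauto) (by omega)

end Weight

/-! ### Filtered images of the Hecke algebra in which all products have bounded degree. -/

/-- A ring with a filtration and a family of elements `τ w` that satisfy the relations of the
Hecke algebra, and the products of which lie in the `N`-th step of the filtration. -/
structure BoundedHecke {B W : Type*} [Group W] {M : CoxeterMatrix B} {cs : CoxeterSystem M W}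
    (L : WeightFunction cs) (N : ℤ) (R : Type*) [Ring R] [Algebra LZ R] where
  /-- the image of the standard basis -/
  τ : W → R
  /-- the filtration -/
  F : ℤ → AddSubgroup R
  mono : ∀ {m n : ℤ}, m ≤ n → F m ≤ F n
  shift : ∀ (m : ℤ) {n : ℤ} {x : R}, x ∈ F n → (LaurentPolynomial.T m : LZ) • x ∈ F (m + n)
  exhaust : ∀ x : R, ∃ n, x ∈ F n
  τ_one : τ 1 = 1
  τ_mul : ∀ {w w' : W}, cs.length (w * w') = cs.length w + cs.length w' → τ w * τ w' = τ (w * w')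
  τ_sq : ∀ s : B, τ (cs.simple s) * τ (cs.simple s) = 1 + xi L s • τ (cs.simple s)
  τ_mem : ∀ w, τ w ∈ F 0
  bound : ∀ x y, τ x * τ y ∈ F N

namespace BoundedHecke

variable {B W : Type*} [Group W] {M : CoxeterMatrix B} {cs : CoxeterSystem M W}
  {L : WeightFunction cs} {N : ℤ} {R : Type*} [Ring R] [Algebra LZ R] (S : BoundedHecke L N R)

theorem mem_of_shift {m n : ℤ} {x : R} (h : (LaurentPolynomial.T m : LZ) • x ∈ S.F (m + n)) :
    x ∈ S.F n := by
  have := S.shift (-m) h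
  rwa [smul_smul, ← LaurentPolynomial.T_add, neg_add_cancel, LaurentPolynomial.T_zero, one_smul,
    neg_add_cancel_left] at this

theorem xi_smul_mem (s : B) {n : ℤ} {x : R} (h : x ∈ S.F n) :
    xi L s • x ∈ S.F (L (cs.simple s) + n) := by
  rw [xi, sub_smul]
  have := L.pos s
  exact AddSubgroup.sub_mem _ (S.shift _ h) (S.mono (by linarith) (S.shift _ h))

/-- The leading coefficient of $\xi_s$ is $1$, so $\xi_s$ can be cancelled with its full degree.
From $q^{L(s)}x=\xi_sx+q^{-L(s)}x$ any excess in the degree of $x$ can be lowered step by step,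
starting from a bound supplied by `exhaust`. -/
theorem mem_of_xi_smul_mem (s : B) {n : ℤ} {x : R} (h : xi L s • x ∈ S.F (L (cs.simple s) + n)) :
    x ∈ S.F n := by
  have key : ∀ k : ℕ, x ∈ S.F (n + k) → x ∈ S.F n := by
    intro k
    induction k with
    | zero => intro hk; simpa using hk
    | succ k ih =>
      intro hk
      refine ih (S.mem_of_shift (m := L (cs.simple s)) ?_)
      have hs := L.pos s
      have e : (LaurentPolynomial.T (L (cs.simple s)) : LZ) • x =
          xi L s • x + (LaurentPolynomial.T (-L (cs.simple s)) : LZ) • x := by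
        rw [← add_smul, xi, sub_add_cancel]
      rw [e]
      refine AddSubgroup.add_mem _ (S.mono (by omega) h) (S.mono ?_ (S.shift _ hk))
      push_cast
      omega
  obtain ⟨m, hm⟩ := S.exhaust x
  exact key (m - n).toNat (S.mono (by omega) hm)

theorem mem_of_reduced {x y : W} (h : cs.length (x * y) = cs.length x + cs.length y) :
    S.τ x * S.τ y ∈ S.F 0 := by
  rw [S.τ_mul h]; exact S.τ_mem _

theorem mul_shift {x y : W} {s : B} (hx : ¬ cs.IsRightDescent x s) (hy : ¬ cs.IsLeftDescent y s) :
    S.τ (x * cs.simple s) * S.τ y = S.τ x * S.τ (cs.simple s * y) := by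
  rw [cs.not_isRightDescent_iff] at hx
  rw [cs.not_isLeftDescent_iff] at hy
  rw [← S.τ_mul (by rw [hx, cs.length_simple]), ← S.τ_mul (by rw [hy, cs.length_simple, add_comm]),
    mul_assoc]

theorem mul_step {x y : W} {s : B} (hx : ¬ cs.IsRightDescent x s) (hy : ¬ cs.IsLeftDescent y s) :
    S.τ (x * cs.simple s) * S.τ (cs.simple s * y) =
      S.τ x * S.τ y + xi L s • (S.τ x * S.τ (cs.simple s * y)) := by
  rw [cs.not_isRightDescent_iff] at hx
  rw [cs.not_isLeftDescent_iff] at hy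
  rw [← S.τ_mul (by rw [hx, cs.length_simple]), ← S.τ_mul (by rw [hy, cs.length_simple, add_comm]),
    mul_assoc, ← mul_assoc (S.τ (cs.simple s)), S.τ_sq, add_mul, mul_add, one_mul, smul_mul_assoc,
    mul_smul_comm]

/-- The difference $T_{xs}T_{sy}-T_xT_y$ equals $\xi_sT_xT_{sy}$. This is the source of every gain
of $L(s)$ over the uniform bound. -/
theorem mul_mem_of_step {x y : W} {s : B} (hx : ¬ cs.IsRightDescent x s)
    (hy : ¬ cs.IsLeftDescent y s) {n : ℤ}
    (h1 : S.τ (x * cs.simple s) * S.τ (cs.simple s * y) ∈ S.F n) (h2 : S.τ x * S.τ y ∈ S.F n) :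
    S.τ x * S.τ (cs.simple s * y) ∈ S.F (n - L (cs.simple s)) := by
  refine S.mem_of_xi_smul_mem s ?_
  rw [S.mul_step hx hy] at h1
  have := AddSubgroup.sub_mem _ h1 h2
  rwa [add_sub_cancel_left, ← add_sub_cancel (L (cs.simple s)) n] at this

theorem bound_sub {x y : W} {s : B} (hx : ¬ cs.IsRightDescent x s)
    (hy : ¬ cs.IsLeftDescent y s) :
    S.τ x * S.τ (cs.simple s * y) ∈ S.F (N - L (cs.simple s)) :=
  S.mul_mem_of_step hx hy (S.bound _ _) (S.bound _ _)

theorem mem_of_reduced₃ {a w b : W} (haw : cs.length (a * w) = cs.length a + cs.length w)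
    (h : cs.length (a * w * b) = cs.length a + cs.length w + cs.length b) :
    S.τ (a * w) * S.τ b ∈ S.F 0 :=
  S.mem_of_reduced (by rw [h, haw])

/-- The degree of `T_{ar} T_{sb}`, where `a` and `b` are minimal with respect to `{r, s}`. -/
theorem mul_mem_of_minimal (hM : ∀ s t : B, s ≠ t → M s t ≠ 2) {r s : B} (hrs : r ≠ s) (a : W) :
    ∀ b : W, ¬ cs.IsRightDescent a r → ¬ cs.IsRightDescent a s → ¬ cs.IsLeftDescent b r →
      ¬ cs.IsLeftDescent b s →
      S.τ (a * cs.simple r) * S.τ (cs.simple s * b) ∈ S.F 0 ∨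
        ∃ p, p ≠ r ∧ p ≠ s ∧ cs.IsRightDescent (a * cs.simple r) p ∧
          cs.IsLeftDescent (cs.simple s * b) p ∧
          S.τ (a * cs.simple r) * S.τ (cs.simple s * b) ∈ S.F (L (cs.simple p)) := by
  induction hn : cs.length a using Nat.strong_induction_on generalizing a with
  | _ n ih =>
    subst hn
    intro b har has hbr hbs
    by_cases hred : cs.length (a * cs.simple r * (cs.simple s * b)) =
        cs.length (a * cs.simple r) + cs.length (cs.simple s * b)
    · exact Or.inl (S.mem_of_reduced hred)
    obtain ⟨p, hpr, hps, hxp, hyp⟩ := exists_descent_of_not_reduced cs hM hrs har has hbr hbs hred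
    refine Or.inr ⟨p, hpr, hps, hxp, hyp, ?_⟩
    have hLp := L.pos p
    have lar := cs.not_isRightDescent_iff.1 har
    have lbs := cs.not_isLeftDescent_iff.1 hbs
    have hxr : cs.IsRightDescent (a * cs.simple r) r := by
      rw [cs.isRightDescent_iff_not_isRightDescent_mul, cs.simple_mul_simple_cancel_right]
      exact har
    have hys : cs.IsLeftDescent (cs.simple s * b) s := by
      rw [cs.isLeftDescent_iff_not_isLeftDescent_mul, cs.simple_mul_simple_cancel_left]; exact hbs
    generalize a * cs.simple r = x at *
    generalize cs.simple s * b = y at *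
    obtain ⟨x, rfl⟩ : ∃ x1, x = x1 * cs.simple p :=
      ⟨x * cs.simple p, (cs.simple_mul_simple_cancel_right p).symm⟩
    obtain ⟨y, rfl⟩ : ∃ y1, y = cs.simple p * y1 :=
      ⟨cs.simple p * y, (cs.simple_mul_simple_cancel_left p).symm⟩
    have dx := descents_of_descents cs hM hpr hxp hxr
    have uy := fun q => @eq_of_leftDescents _ _ _ _ cs hM (cs.simple p * y) p s q hps hyp hys
    have lx := cs.isRightDescent_iff.1 hxp
    have ly := cs.isLeftDescent_iff.1 hyp
    have hx1 := cs.isRightDescent_iff_not_isRightDescent_mul.1 hxp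
    have hy1 := cs.isLeftDescent_iff_not_isLeftDescent_mul.1 hyp
    have ux := fun q => @eq_of_descents _ _ _ _ cs hM (x * cs.simple p) p r q hpr hxp hxr
    rw [cs.simple_mul_simple_cancel_right] at hx1 lx dx
    rw [cs.simple_mul_simple_cancel_left] at hy1 ly
    simp only [cs.simple_mul_simple_cancel_right] at ux
    simp only [cs.simple_mul_simple_cancel_left] at uy
    have hy1r : ¬ cs.IsLeftDescent y r := fun h => hrs (uy r h)
    -- The $\xi_p$-term is harmless: $xp$ ends with $w_{pr}$, of length at least $3$, and neither
    -- $p$ nor $r$ is a left descent of $y$, so $xp\cdot y$ is reduced. What remains is $T_xT_y$.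
    rw [S.mul_step hx1 hy1]
    refine AddSubgroup.add_mem _ ?_ ?_
    swap
    · rw [← S.mul_shift hx1 hy1]
      rw [← add_zero (L _)]
      refine S.xi_smul_mem p ?_
      obtain ⟨h0, g, hg, hgp, hgr⟩ := exists_longest_of_descents cs hM hpr hxp hxr
      rw [hg]
      have m := alt_mem_par cs (M p r) p r
      refine S.mem_of_reduced₃ (length_mul_par cs hM hpr hgp hgr _ m) ?_
      refine length_mul_mul_of_par cs hM hpr hgp hgr hy1 hy1r m ?_
      rw [length_alt cs hM _ hpr (Or.inr le_rfl)]
      exact three_le hM hpr h0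
    by_cases hred1 : cs.length (x * y) = cs.length x + cs.length y
    · exact S.mono hLp.le (S.mem_of_reduced hred1)
    obtain ⟨i, j, -, h1, h2, h3, h4⟩ := descents_of_not_reduced cs hM y
      (fun q hq hq' => hrs ((ux q hq).symm.trans (uy q hq'))) hred1
    obtain rfl := ux i h1
    obtain rfl := uy j h3
    rename' i => r, j => s
    -- The element $xr$ has the right descents $p$ and $s$. If $m_{pr}\ne3$, then $r$ is a descent
    -- of $xrp$, and uniqueness gives $r=s$.
    have hMpr : M p r = 3 := by
      by_contra hne
      exact hrs (eq_of_descents cs hM _ hps dx.2.1 h2 (dx.2.2 hne))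
    have d4 : cs.IsLeftDescent (cs.simple s * y) p := by
      have := descents_of_descents cs hM (w := (cs.simple p * y)⁻¹) hps
        (by rwa [cs.isRightDescent_inv_iff]) (by rwa [cs.isRightDescent_inv_iff])
      rw [← cs.isRightDescent_inv_iff]
      simpa [mul_assoc] using this.2.1
    have ua := fun q => @eq_of_descents _ _ _ _ cs hM (x * cs.simple r) s p q hps.symm h2 dx.2.1
    have ub := fun q => @eq_of_leftDescents _ _ _ _ cs hM (cs.simple s * y) r p q hpr.symm h4 d4
    have lx1 := cs.isRightDescent_iff.1 h1
    have lx2 := cs.isRightDescent_iff.1 h2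
    have ly1 := cs.isLeftDescent_iff.1 h3
    have ly2 := cs.isLeftDescent_iff.1 h4
    obtain ⟨a2, ha2⟩ : ∃ a2, a2 = x * cs.simple r * cs.simple s := ⟨_, rfl⟩
    obtain ⟨b2, hb2⟩ : ∃ b2, b2 = cs.simple r * (cs.simple s * y) := ⟨_, rfl⟩
    have ex : x = a2 * cs.simple s * cs.simple r := by
      rw [ha2, cs.simple_mul_simple_cancel_right, cs.simple_mul_simple_cancel_right]
    have ey : y = cs.simple s * (cs.simple r * b2) := by
      rw [hb2, cs.simple_mul_simple_cancel_left, cs.simple_mul_simple_cancel_left]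
    rw [← ha2] at ua lx2
    rw [← hb2] at ub ly2
    have a2r : ¬ cs.IsRightDescent a2 r := fun h => hpr (ua r h).symm
    have a2s : ¬ cs.IsRightDescent a2 s := fun h => hps (ua s h).symm
    have b2r : ¬ cs.IsLeftDescent b2 r := fun h => hpr (ub r h).symm
    have b2s : ¬ cs.IsLeftDescent b2 s := fun h => hps (ub s h).symm
    -- Now $xy=a_2\,(srsr)\,b_2$. If $m_{rs}\ne3$, the middle factor has length $4$ and the product
    -- would be reduced.
    by_cases hMrs : M r s = 3
    swap
    · exfalso
      have h3' := @three_le _ _ hM r s hrs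
      have e4 : alt cs s r 4 = cs.simple s * cs.simple r * cs.simple s * cs.simple r := by
        simp [alt_succ]
      have l4 := length_alt cs hM 4 hrs.symm (by rw [M.symmetric]; omega)
      have := length_mul_mul_of_par cs hM hrs a2r a2s b2r b2s
        (by rw [par_comm]; exact alt_mem_par cs 4 s r) (by omega)
      rw [l4, e4] at this
      apply hred1
      nth_rw 1 [ex, ey]
      simp only [mul_assoc] at this ⊢
      omega
    have eL1 := weight_eq_of_odd L hM hpr (by rw [hMpr]; decide)
    have eL2 := weight_eq_of_odd L hM hrs (by rw [hMrs]; decide)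
    have e3 : cs.simple r * cs.simple s * cs.simple r = cs.simple s * cs.simple r * cs.simple s := by
      have := alt_comm cs s r
      rw [M.symmetric, hMrs] at this
      simpa [alt_succ] using this
    have m3 : cs.simple s * cs.simple r * cs.simple s ∈ par cs r s :=
      mul_mem (mul_mem (right_mem_par cs r s) (left_mem_par cs r s)) (right_mem_par cs r s)
    have l3 : cs.length (cs.simple s * cs.simple r * cs.simple s) = 3 := by
      have := length_alt cs hM 3 hrs (by omega)
      simpa [alt_succ] using this
    have mrs := mul_mem (left_mem_par cs r s) (right_mem_par cs r s)
    have msr := mul_mem (right_mem_par cs r s) (left_mem_par cs r s)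
    have lrs : cs.length (cs.simple r * cs.simple s) = 2 := by
      have := length_alt cs hM 2 hrs (by omega)
      simpa [alt_succ] using this
    have lsr : cs.length (cs.simple s * cs.simple r) = 2 := by
      have := length_alt cs hM 2 hrs.symm (by rw [M.symmetric]; omega)
      simpa [alt_succ] using this
    have q1 : ¬ cs.IsRightDescent (a2 * cs.simple s) r := by
      rw [rightDescent_mul_par cs hM hrs a2r a2s (right_mem_par cs r s) (by simp), IsRightDescent,
        lsr, cs.length_simple]
      omega
    have q2 : ¬ cs.IsLeftDescent y r := hy1r
    have q3 : ¬ cs.IsLeftDescent (cs.simple r * cs.simple s * b2) s := by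
      rw [leftDescent_par_mul cs hM hrs b2r b2s mrs (by simp), IsLeftDescent, ← mul_assoc, l3, lrs]
      omega
    have q4 : ¬ cs.IsLeftDescent (cs.simple s * b2) r := by
      rw [leftDescent_par_mul cs hM hrs b2r b2s (right_mem_par cs r s) (by simp), IsLeftDescent,
        lrs, cs.length_simple]
      omega
    have e5 : cs.simple r * y = cs.simple s * (cs.simple r * cs.simple s * b2) := by
      rw [ey]
      simp only [← mul_assoc]
      rw [e3]
    -- The braid relation $rsr=srs$ makes a second split at $s$ possible. Its first term
    -- $T_{a_2}T_{rsb_2}=T_{a_2r}T_{sb_2}$ has the original shape with a shorter $a_2$, and a common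
    -- descent found there must be $p$, the only possible right descent of $a_2$. In the other term
    -- $a_2(srs)b_2$ is reduced. All orders being $3$, the weights of $p,r,s$ coincide.
    rw [ex, S.mul_shift q1 q2, e5, S.mul_step a2s q3, eL1, eL2]
    refine AddSubgroup.add_mem _ ?_ ?_
    · rw [mul_assoc, ← S.mul_shift a2r q4]
      rcases ih _ (by omega) a2 rfl b2 a2r a2s b2r b2s with h | ⟨p2, hp2r, hp2s, hd, -, h⟩
      · exact S.mono (L.pos s).le h
      · have hd2 : cs.IsRightDescent (a2 * cs.simple r) r := by
          rw [cs.isRightDescent_iff_not_isRightDescent_mul, cs.simple_mul_simple_cancel_right]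
          exact a2r
        have hd3 := (descents_of_descents cs hM hp2r.symm hd2 hd).1
        rw [cs.simple_mul_simple_cancel_right] at hd3
        rw [ua p2 hd3, eL1, eL2] at h
        exact h
    · rw [← add_zero (L _)]
      refine S.xi_smul_mem s ?_
      refine S.mem_of_reduced ?_
      have := length_mul_mul_of_par cs hM hrs a2r a2s b2r b2s m3 (by omega)
      have h6 := length_par_mul cs hM hrs b2r b2s _ m3
      simp only [mul_assoc] at this h6 ⊢
      omega

end BoundedHecke

end CoxHecke

namespace CoxHecke

open CoxeterSystem

/-! ### One-dimensional characters of dihedral Hecke algebras and their eigenvectors. -/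

theorem par_finite {B W : Type*} [Group W] {M : CoxeterMatrix B} (cs : CoxeterSystem M W) {s t : B}
    (h0 : M s t ≠ 0) : (par cs s t : Set W).Finite := by
  have : (par cs s t : Set W) ⊆ ⋃ n ∈ Finset.range (M s t + 1), {alt cs s t n, alt cs t s n} := by
    intro u hu
    obtain ⟨n, hn, h⟩ := mem_par cs hu
    simp only [Set.mem_iUnion, Finset.mem_range]
    exact ⟨n, by omega, h⟩
  exact (Set.Finite.biUnion (Finset.finite_toSet _) fun n _ => by simp).subset this

/-- A one-dimensional representation of the Hecke algebra of a dihedral parabolic subgroup, the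
values of which are powers of `q` up to sign. -/
structure DihedralChar {B W : Type*} [Group W] {M : CoxeterMatrix B} {cs : CoxeterSystem M W}
    (L : WeightFunction cs) (s t : B) where
  /-- the value at `T_w` -/
  c : W → LZ
  /-- the degree of the value at `T_w` -/
  wt : W → ℤ
  /-- the value at `T_s` and `T_t` -/
  lam : B → LZ
  c_one : c 1 = 1
  c_mul : ∀ {p : B}, (p = s ∨ p = t) → ∀ {w : W}, ¬ cs.IsLeftDescent w p →
    c (cs.simple p * w) = lam p * c w
  lam_sq : ∀ {p : B}, (p = s ∨ p = t) → lam p * lam p = 1 + xi L p * lam p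
  c_eq : ∀ w, c w = LaurentPolynomial.T (wt w) ∨ c w = -LaurentPolynomial.T (wt w)

section Characters

variable {B W : Type*} [Group W] {M : CoxeterMatrix B} {cs : CoxeterSystem M W}

theorem weight_simple_mul (L : WeightFunction cs) {p : B} {w : W} (h : ¬ cs.IsLeftDescent w p) :
    L (cs.simple p * w) = L (cs.simple p) + L w :=
  L.map_mul_of_length_add _ _ (by rw [cs.not_isLeftDescent_iff.1 h, cs.length_simple, add_comm])

/-- The character with `T_s ↦ q ^ L(s)` and `T_t ↦ q ^ L(t)`. -/
noncomputable def indexChar (L : WeightFunction cs) (s t : B) : DihedralChar L s t where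
  c w := LaurentPolynomial.T (L w)
  wt w := L w
  lam p := LaurentPolynomial.T (L (cs.simple p))
  c_one := by rw [weight_one, LaurentPolynomial.T_zero]
  c_mul _ _ h := by rw [weight_simple_mul L h, LaurentPolynomial.T_add]
  lam_sq _ := by
    rw [xi, sub_mul, ← LaurentPolynomial.T_add, ← LaurentPolynomial.T_add, neg_add_cancel,
      LaurentPolynomial.T_zero]
    ring
  c_eq _ := Or.inl rfl

/-- For `w` in the parabolic subgroup of `s` and `t`, this is the number of factors `s` in a reduced
expression of `w`. -/
noncomputable def countLow (L : WeightFunction cs) (s t : B) (w : W) : ℤ :=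
  (L (cs.simple t) * cs.length w - L w) / (L (cs.simple t) - L (cs.simple s))

/-- The degree of `mixedChar`. -/
noncomputable def mixedWeight (L : WeightFunction cs) (s t : B) (w : W) : ℤ :=
  L (cs.simple t) * (cs.length w - countLow L s t w) - L (cs.simple s) * countLow L s t w

/-- A new letter $s$ raises the numerator by exactly $L(t)-L(s)$, a new letter $t$ leaves it
unchanged. The rule therefore holds on all of $W$, whether or not the division is exact. -/
theorem countLow_left_mul (L : WeightFunction cs) {s t : B} (h : L (cs.simple s) < L (cs.simple t))
    {w : W} (hw : ¬ cs.IsLeftDescent w s) :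
    countLow L s t (cs.simple s * w) = countLow L s t w + 1 := by
  rw [countLow, countLow, weight_simple_mul L hw, cs.not_isLeftDescent_iff.1 hw,
    ← Int.add_mul_ediv_right _ 1 (by omega)]
  congr 1
  push_cast
  ring

theorem countLow_right_mul (L : WeightFunction cs) {s t : B} {w : W}
    (hw : ¬ cs.IsLeftDescent w t) :
    countLow L s t (cs.simple t * w) = countLow L s t w := by
  rw [countLow, countLow, weight_simple_mul L hw, cs.not_isLeftDescent_iff.1 hw]
  congr 1
  push_cast
  ring

open Classical in
/-- The character with `T_s ↦ -q ^ (-L(s))` and `T_t ↦ q ^ L(t)`. -/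
noncomputable def mixedChar (L : WeightFunction cs) {s t : B} (h : L (cs.simple s) < L (cs.simple t)) :
    DihedralChar L s t where
  c w := if Even (countLow L s t w) then LaurentPolynomial.T (mixedWeight L s t w) else
    -LaurentPolynomial.T (mixedWeight L s t w)
  wt w := mixedWeight L s t w
  lam p := if p = s then -LaurentPolynomial.T (-L (cs.simple s)) else
    LaurentPolynomial.T (L (cs.simple t))
  c_one := by simp [mixedWeight, countLow, weight_one]
  c_mul {p} hp {w} hw := by
    rcases hp with rfl | rfl
    · have e : mixedWeight L p t (cs.simple p * w) = -L (cs.simple p) + mixedWeight L p t w := by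
        rw [mixedWeight, mixedWeight, countLow_left_mul L h hw, cs.not_isLeftDescent_iff.1 hw]
        push_cast
        ring
      rw [countLow_left_mul L h hw, e, LaurentPolynomial.T_add, if_pos rfl]
      by_cases h2 : Even (countLow L p t w)
      · rw [if_neg (by rwa [Int.even_add_one, not_not]), if_pos h2, neg_mul]
      · rw [if_pos (by rwa [Int.even_add_one]), if_neg h2, neg_mul_neg]
    · have e : mixedWeight L s p (cs.simple p * w) = L (cs.simple p) + mixedWeight L s p w := by
        rw [mixedWeight, mixedWeight, countLow_right_mul L hw, cs.not_isLeftDescent_iff.1 hw]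
        push_cast
        ring
      have hne : p ≠ s := by rintro rfl; exact lt_irrefl _ h
      rw [countLow_right_mul L hw, e, LaurentPolynomial.T_add, if_neg hne]
      by_cases h2 : Even (countLow L s p w)
      · rw [if_pos h2, if_pos h2]
      · rw [if_neg h2, if_neg h2, mul_neg]
  lam_sq {p} hp := by
    by_cases hps : p = s
    · subst hps
      simp only [if_pos, xi, mul_neg, neg_mul, neg_neg, sub_mul, ← LaurentPolynomial.T_add,
        add_neg_cancel, LaurentPolynomial.T_zero]
      ring
    · obtain rfl : p = t := hp.resolve_left hps
      simp only [if_neg hps, xi, sub_mul, ← LaurentPolynomial.T_add, neg_add_cancel,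
        LaurentPolynomial.T_zero]
      ring
  c_eq w := by by_cases h2 : Even (countLow L s t w) <;> simp [h2]

theorem mixedWeight_alt (L : WeightFunction cs) (hM : ∀ s t : B, s ≠ t → M s t ≠ 2) {s t : B}
    (h : L (cs.simple s) < L (cs.simple t)) {n : ℕ} (hn : M s t = 0 ∨ n ≤ M s t) :
    mixedWeight L s t (alt cs s t n) =
        ((n + 1) / 2 : ℕ) * L (cs.simple t) - (n / 2 : ℕ) * L (cs.simple s) ∧
      mixedWeight L s t (alt cs t s n) =
        (n / 2 : ℕ) * L (cs.simple t) - ((n + 1) / 2 : ℕ) * L (cs.simple s) := by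
  have hst : s ≠ t := by rintro rfl; exact lt_irrefl _ h
  have hn' : M t s = 0 ∨ n ≤ M t s := by rwa [M.symmetric]
  obtain ⟨a, b, ha, hb, hab⟩ : ∃ a b : ℕ, (n + 1) / 2 = a ∧ n / 2 = b ∧ n = a + b :=
    ⟨_, _, rfl, rfl, by omega⟩
  have e : ∀ x : ℤ, x * (L (cs.simple t) - L (cs.simple s)) /
      (L (cs.simple t) - L (cs.simple s)) = x := fun x => Int.mul_ediv_cancel _ (by omega)
  constructor
  · have : countLow L s t (alt cs s t n) = b := by
      rw [countLow, weight_alt L hM n hst hn, length_alt cs hM n hst hn, ha, hb, hab]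
      refine Eq.trans ?_ (e b)
      refine congrArg (· / _) ?_; push_cast; ring
    rw [mixedWeight, this, length_alt cs hM n hst hn, ha, hb, hab]
    push_cast; ring
  · have : countLow L s t (alt cs t s n) = a := by
      rw [countLow, weight_alt L hM n hst.symm hn', length_alt cs hM n hst.symm hn', ha, hb, hab]
      refine Eq.trans ?_ (e a)
      refine congrArg (· / _) ?_; push_cast; ring
    rw [mixedWeight, this, length_alt cs hM n hst.symm hn', ha, hb, hab]
    push_cast; ring

theorem even_of_weight_lt (L : WeightFunction cs) (hM : ∀ s t : B, s ≠ t → M s t ≠ 2) {s t : B}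
    (h : L (cs.simple s) < L (cs.simple t)) : Even (M s t) := by
  have hst : s ≠ t := by rintro rfl; exact lt_irrefl _ h
  by_contra hc
  exact h.ne (weight_eq_of_odd L hM hst (Nat.not_even_iff_odd.1 hc))

/-- With $\delta=L(t)-L(s)$ and $m_{st}=2k$, the value at $d$ is $k\delta+L(s)$. Elements of length
$2j$ give $j\delta$, and those of length $2j+1$ give $(j+1)\delta+L(s)$ or $(j+1)\delta-L(t)$
according to their last letter. In particular the longest element falls short by $L(s)$. -/
theorem mixedWeight_lt (L : WeightFunction cs) (hM : ∀ s t : B, s ≠ t → M s t ≠ 2) {s t : B}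
    (h : L (cs.simple s) < L (cs.simple t)) (h0 : M s t ≠ 0) {w : W} (hw : w ∈ par cs s t)
    (hne : w ≠ alt cs s t (M s t - 1)) :
    mixedWeight L s t w < mixedWeight L s t (alt cs s t (M s t - 1)) := by
  have hs := L.pos s
  obtain ⟨k, hk⟩ := even_of_weight_lt L hM h
  obtain ⟨n, hn, hw'⟩ := mem_par cs hw
  have hn := hn.resolve_left h0
  rw [(mixedWeight_alt L hM h (Or.inr (by omega))).1, show (M s t - 1 + 1) / 2 = k by omega,
    show (M s t - 1) / 2 = k - 1 by omega, Nat.cast_sub (by omega)]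
  have hd : 0 < L (cs.simple t) - L (cs.simple s) := by omega
  obtain ⟨j, hj⟩ : ∃ j, n = 2 * j ∨ n = 2 * j + 1 := ⟨n / 2, by omega⟩
  have hjk : (j : ℤ) ≤ k := by norm_cast; omega
  rcases hj with hj | hj
  · have e : mixedWeight L s t w = j * (L (cs.simple t) - L (cs.simple s)) := by
      rcases hw' with rfl | rfl
      · rw [(mixedWeight_alt L hM h (Or.inr hn)).1, show (n + 1) / 2 = j by omega,
          show n / 2 = j by omega]
        ring
      · rw [(mixedWeight_alt L hM h (Or.inr hn)).2, show (n + 1) / 2 = j by omega,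
          show n / 2 = j by omega]
        ring
    rw [e]
    have := mul_le_mul_of_nonneg_right hjk hd.le
    push_cast
    nlinarith
  · have hjk' : (j : ℤ) + 1 ≤ k := by norm_cast; omega
    rcases hw' with rfl | rfl
    · have hjk'' : (j : ℤ) + 1 < k := by
        have : n ≠ M s t - 1 := fun h => hne (by rw [h])
        norm_cast; omega
      rw [(mixedWeight_alt L hM h (Or.inr hn)).1, show (n + 1) / 2 = j + 1 by omega,
        show n / 2 = j by omega]
      have := mul_lt_mul_of_pos_right hjk'' hd
      push_cast
      nlinarith
    · rw [(mixedWeight_alt L hM h (Or.inr hn)).2, show (n + 1) / 2 = j + 1 by omega,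
        show n / 2 = j by omega]
      have := mul_le_mul_of_nonneg_right hjk' hd.le
      push_cast
      nlinarith

end Characters

namespace BoundedHecke

variable {B W : Type*} [Group W] {M : CoxeterMatrix B} {cs : CoxeterSystem M W}
  {L : WeightFunction cs} {N : ℤ} {R : Type*} [Ring R] [Algebra LZ R] (S : BoundedHecke L N R)
  {s t : B} (X : DihedralChar L s t)

/-- The element `∑ c(w) T_w`, the sum being over the parabolic subgroup of `s` and `t`. -/
noncomputable def charSum : R := ∑ᶠ w ∈ (par cs s t : Set W), X.c w • S.τ w

/-- Pairing $w$ with $pw$ gives $X=(1+\lambda_pT_p)Y$, with $Y$ the part of the sum where $pw>w$.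
The quadratic relations for $T_p$ and $\lambda_p$ give
$T_p(1+\lambda_pT_p)=\lambda_p(1+\lambda_pT_p)$. -/
theorem simple_mul_charSum (h0 : M s t ≠ 0) {p : B} (hp : p = s ∨ p = t) :
    S.τ (cs.simple p) * S.charSum X = X.lam p • S.charSum X := by
  classical
  have hfin := par_finite cs h0
  set D := hfin.toFinset with hD
  set D' := D.filter fun w => ¬ cs.IsLeftDescent w p with hD'
  have hm : ∀ w, cs.simple p * w ∈ D ↔ w ∈ D := fun w => by
    rw [hD, Set.Finite.mem_toFinset, Set.Finite.mem_toFinset]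
    exact Subgroup.mul_mem_cancel_left _ (simple_mem_par cs hp)
  have e1 : S.charSum X = ∑ w ∈ D, X.c w • S.τ w := by
    rw [charSum, finsum_mem_eq_finite_toFinset_sum _ hfin]
  have e2 : ∑ w ∈ D.filter (fun w => ¬ ¬ cs.IsLeftDescent w p), X.c w • S.τ w =
      ∑ w ∈ D', X.c (cs.simple p * w) • S.τ (cs.simple p * w) := by
    refine Finset.sum_nbij' (fun w => cs.simple p * w) (fun w => cs.simple p * w) ?_ ?_ ?_ ?_ ?_
    · intro w hw
      rw [Finset.mem_filter, not_not] at hw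
      rw [hD', Finset.mem_filter, hm]
      exact ⟨hw.1, cs.isLeftDescent_iff_not_isLeftDescent_mul.1 hw.2⟩
    · intro w hw
      rw [hD', Finset.mem_filter] at hw
      rw [Finset.mem_filter, hm, not_not, cs.isLeftDescent_iff_not_isLeftDescent_mul,
        cs.simple_mul_simple_cancel_left]
      exact hw
    · intro w _; exact cs.simple_mul_simple_cancel_left p
    · intro w _; exact cs.simple_mul_simple_cancel_left p
    · intro w _; simp only [cs.simple_mul_simple_cancel_left]
  set Y := ∑ w ∈ D', X.c w • S.τ w with hY
  have e3 : ∑ w ∈ D', X.c (cs.simple p * w) • S.τ (cs.simple p * w) =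
      X.lam p • (S.τ (cs.simple p) * Y) := by
    rw [hY, Finset.mul_sum, Finset.smul_sum]
    refine Finset.sum_congr rfl fun w hw => ?_
    have hd := (Finset.mem_filter.1 hw).2
    rw [X.c_mul hp hd, mul_smul_comm, smul_smul, ← S.τ_mul
      (by rw [cs.not_isLeftDescent_iff.1 hd, cs.length_simple, add_comm])]
  have e4 : S.charSum X = Y + X.lam p • (S.τ (cs.simple p) * Y) := by
    rw [e1, ← Finset.sum_filter_add_sum_filter_not D (fun w => ¬ cs.IsLeftDescent w p), e2, e3]
  rw [e4, mul_add, mul_smul_comm, ← mul_assoc, S.τ_sq, add_mul, one_mul, smul_mul_assoc, smul_add,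
    smul_add, smul_smul, smul_smul, X.lam_sq hp, mul_comm (X.lam p) (xi L p), add_smul, one_smul]
  abel

theorem mul_charSum (hM : ∀ s t : B, s ≠ t → M s t ≠ 2) (hst : s ≠ t) (h0 : M s t ≠ 0) {u : W}
    (hu : u ∈ par cs s t) : S.τ u * S.charSum X = X.c u • S.charSum X := by
  induction hn : cs.length u using Nat.strong_induction_on generalizing u with
  | _ n ih =>
    subst hn
    by_cases h1 : u = 1
    · rw [h1, S.τ_one, X.c_one, one_mul, one_smul]
    obtain ⟨p, hp, hd⟩ : ∃ p, (p = s ∨ p = t) ∧ cs.IsLeftDescent u p := by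
      rcases exists_leftDescent_of_mem_par cs hu h1 hM hst with h | h
      · exact ⟨s, Or.inl rfl, h⟩
      · exact ⟨t, Or.inr rfl, h⟩
    obtain ⟨v, rfl⟩ : ∃ v, u = cs.simple p * v :=
      ⟨cs.simple p * u, (cs.simple_mul_simple_cancel_left p).symm⟩
    rw [cs.isLeftDescent_iff_not_isLeftDescent_mul, cs.simple_mul_simple_cancel_left] at hd
    have hl := cs.not_isLeftDescent_iff.1 hd
    rw [← S.τ_mul (by rw [hl, cs.length_simple, add_comm]), mul_assoc,
      ih _ (by omega) ((Subgroup.mul_mem_cancel_left _ (simple_mem_par cs hp)).1 hu) rfl,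
      mul_smul_comm, simple_mul_charSum S X h0 hp, smul_smul, X.c_mul hp hd, mul_comm]

theorem char_smul_mem (w : W) {n : ℤ} {x : R} (h : x ∈ S.F n) : X.c w • x ∈ S.F (X.wt w + n) := by
  rcases X.c_eq w with e | e <;> rw [e]
  · exact S.shift _ h
  · rw [neg_smul]
    exact neg_mem (S.shift _ h)

theorem mem_of_char_smul_mem (w : W) {n : ℤ} {x : R} (h : X.c w • x ∈ S.F (X.wt w + n)) :
    x ∈ S.F n := by
  rcases X.c_eq w with e | e <;> rw [e] at h
  · exact S.mem_of_shift h
  · rw [neg_smul] at h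
    exact S.mem_of_shift (neg_mem_iff.1 h)

variable {a b : W}

theorem mul_charSum_mul (has : ¬ cs.IsRightDescent a s) (hat : ¬ cs.IsRightDescent a t) {u : W}
    (hu : u ∈ par cs s t) (hM : ∀ s t : B, s ≠ t → M s t ≠ 2) (hst : s ≠ t) (h0 : M s t ≠ 0) :
    S.τ (a * u) * S.charSum X * S.τ b = X.c u • (S.τ a * S.charSum X * S.τ b) := by
  rw [← S.τ_mul (length_mul_par cs hM hst has hat u hu), mul_assoc (S.τ a),
    S.mul_charSum X hM hst h0 hu, mul_smul_comm, smul_mul_assoc]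

theorem charSum_expand (h0 : M s t ≠ 0) (hM : ∀ s t : B, s ≠ t → M s t ≠ 2) (hst : s ≠ t)
    (hbs : ¬ cs.IsLeftDescent b s) (hbt : ¬ cs.IsLeftDescent b t) (x : R) :
    x * S.charSum X * S.τ b =
      ∑ w ∈ (par_finite cs h0).toFinset, X.c w • (x * S.τ (w * b)) := by
  rw [charSum, finsum_mem_eq_finite_toFinset_sum _ (par_finite cs h0), Finset.mul_sum,
    Finset.sum_mul]
  refine Finset.sum_congr rfl fun w hw => ?_
  rw [Set.Finite.mem_toFinset] at hw
  rw [mul_smul_comm, smul_mul_assoc, mul_assoc,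
    S.τ_mul (length_par_mul cs hM hst hbs hbt w hw)]

theorem charSum_expand' (h0 : M s t ≠ 0) (hM : ∀ s t : B, s ≠ t → M s t ≠ 2) (hst : s ≠ t)
    (has : ¬ cs.IsRightDescent a s) (hat : ¬ cs.IsRightDescent a t) (x : R) :
    S.τ a * S.charSum X * x =
      ∑ w ∈ (par_finite cs h0).toFinset, X.c w • (S.τ (a * w) * x) := by
  rw [charSum, finsum_mem_eq_finite_toFinset_sum _ (par_finite cs h0), Finset.mul_sum,
    Finset.sum_mul]
  refine Finset.sum_congr rfl fun w hw => ?_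
  rw [Set.Finite.mem_toFinset] at hw
  rw [mul_smul_comm, smul_mul_assoc, S.τ_mul (length_mul_par cs hM hst has hat w hw)]

/-- One has $c(z)\,T_aXT_b=T_{az}XT_b=\sum_w c(w)T_{az}T_{wb}$, and no $c(w)$ has larger degree than
$c(z)$. Dividing by $c(z)$, a power of $q$ up to sign, leaves the uniform bound. -/
theorem charSum_mem (hM : ∀ s t : B, s ≠ t → M s t ≠ 2) (hst : s ≠ t) (h0 : M s t ≠ 0)
    (has : ¬ cs.IsRightDescent a s) (hat : ¬ cs.IsRightDescent a t)
    (hbs : ¬ cs.IsLeftDescent b s) (hbt : ¬ cs.IsLeftDescent b t) {z : W} (hz : z ∈ par cs s t)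
    (hlt : ∀ w ∈ par cs s t, w ≠ z → X.wt w < X.wt z) :
    S.τ a * S.charSum X * S.τ b ∈ S.F N := by
  refine S.mem_of_char_smul_mem X z ?_
  rw [← S.mul_charSum_mul X has hat hz hM hst h0, S.charSum_expand X h0 hM hst hbs hbt]
  refine sum_mem fun w hw => ?_
  rw [Set.Finite.mem_toFinset] at hw
  refine S.mono ?_ (S.char_smul_mem X w (S.bound _ _))
  by_cases h : w = z
  · rw [h]
  · linarith [hlt w hw h]

/-- Solve $c(u)T_aXT_b=\sum_wc(w)T_{au}T_{wb}$ for the term $w=z$. The other terms lose at least one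
degree by strict maximality, and so does the left side if $u\ne z$. Only $u=z$ needs extra
information about $T_aXT_b$. -/
theorem mul_mem_of_charSum (hM : ∀ s t : B, s ≠ t → M s t ≠ 2) (hst : s ≠ t) (h0 : M s t ≠ 0)
    (has : ¬ cs.IsRightDescent a s) (hat : ¬ cs.IsRightDescent a t)
    (hbs : ¬ cs.IsLeftDescent b s) (hbt : ¬ cs.IsLeftDescent b t) {z : W} (hz : z ∈ par cs s t)
    (hlt : ∀ w ∈ par cs s t, w ≠ z → X.wt w < X.wt z) {u : W} (hu : u ∈ par cs s t)
    (h : u ≠ z ∨ S.τ a * S.charSum X * S.τ b ∈ S.F (N - 1)) :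
    S.τ (a * u) * S.τ (z * b) ∈ S.F (N - 1) := by
  classical
  refine S.mem_of_char_smul_mem X z ?_
  have e := S.charSum_expand X h0 hM hst hbs hbt (S.τ (a * u))
  rw [S.mul_charSum_mul X has hat hu hM hst h0,
    ← Finset.add_sum_erase _ _ ((Set.Finite.mem_toFinset _).2 hz)] at e
  rw [eq_sub_of_add_eq e.symm]
  refine sub_mem ?_ (sum_mem fun w hw => ?_)
  · by_cases huz : u = z
    · rw [huz]
      exact S.char_smul_mem X z (h.resolve_left fun h => h huz)
    · refine S.mono ?_ (S.char_smul_mem X u (S.charSum_mem X hM hst h0 has hat hbs hbt hz hlt))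
      linarith [hlt u hu huz]
  · rw [Finset.mem_erase, Set.Finite.mem_toFinset] at hw
    refine S.mono ?_ (S.char_smul_mem X w (S.bound _ _))
    linarith [hlt w hw.2 hw.1]

end BoundedHecke

end CoxHecke

namespace CoxHecke

open CoxeterSystem

/-! ### Elements of $D$ and stability properties of $\Omega_{\ge N}$. -/

section Omega

variable {B W : Type*} [Group W] {M : CoxeterMatrix B} {cs : CoxeterSystem M W}

theorem isLongest_empty : Hecke.IsLongest cs ∅ 1 := by
  simp [Hecke.IsLongest]

theorem isLongest_singleton (s : B) : Hecke.IsLongest cs {s} (cs.simple s) := by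
  have key : ∀ w ∈ Subgroup.closure (cs.simple '' {s}), w = 1 ∨ w = cs.simple s := by
    intro w hw
    induction hw using Subgroup.closure_induction with
    | mem w hw => simpa using Or.inr hw
    | one => exact Or.inl rfl
    | mul v w _ _ hv hw => rcases hv with rfl | rfl <;> rcases hw with rfl | rfl <;> simp
    | inv w _ hw => rcases hw with rfl | rfl <;> simp
  refine ⟨(Set.toFinite {1, cs.simple s}).subset key, Subgroup.subset_closure ⟨s, rfl, rfl⟩, ?_⟩
  intro w hw
  rcases key w hw with rfl | rfl <;> simp

theorem isLongest_alt (hM : ∀ s t : B, s ≠ t → M s t ≠ 2) {s t : B} (hst : s ≠ t)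
    (h0 : M s t ≠ 0) : Hecke.IsLongest cs {s, t} (alt cs s t (M s t)) := by
  refine ⟨par_finite cs h0, alt_mem_par cs _ s t, fun w hw => ?_⟩
  rw [length_alt cs hM _ hst (Or.inr le_rfl)]
  exact (length_le_of_mem_par cs hw hM hst h0).1

variable {L : WeightFunction cs} {N : ℕ}

theorem mem_omegaGe_of_mem_dge {d x y : W} (hd : d ∈ Hecke.Dge L N)
    (h : cs.length (x * d * y) = cs.length x + cs.length d + cs.length y) :
    x * d * y ∈ Hecke.OmegaGe L N := ⟨d, hd, x, y, rfl, h⟩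

theorem mul_mem_omegaGe_right {x z : W} (hz : z ∈ Hecke.OmegaGe L N)
    (h : cs.length (z * x) = cs.length z + cs.length x) : z * x ∈ Hecke.OmegaGe L N := by
  obtain ⟨d, hd, a, b, rfl, h1⟩ := hz
  have := cs.length_mul_le b x
  have := cs.length_mul_le (a * d) (b * x)
  have := cs.length_mul_le a d
  have e : a * d * b * x = a * d * (b * x) := by simp only [mul_assoc]
  rw [e] at h ⊢
  exact mem_omegaGe_of_mem_dge hd (by omega)

theorem pos_of_notMem_omegaGe {x : W} (hx : x ∉ Hecke.OmegaGe L N) : 0 < N := by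
  by_contra hN
  refine hx ?_
  have h1 : (1 : W) ∈ Hecke.Dge L N := Or.inl ⟨∅, isLongest_empty, by rw [weight_one]; omega⟩
  have := mem_omegaGe_of_mem_dge (x := x) (y := 1) h1 (by simp)
  rwa [mul_one, mul_one] at this

theorem weight_lt_of_rightDescent {x : W} (hx : x ∉ Hecke.OmegaGe L N) {t : B}
    (ht : cs.IsRightDescent x t) : L (cs.simple t) < N := by
  by_contra hN
  refine hx ?_
  have h1 : cs.simple t ∈ Hecke.Dge L N := Or.inl ⟨{t}, isLongest_singleton t, by omega⟩
  have hl := cs.isRightDescent_iff.1 ht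
  have := mem_omegaGe_of_mem_dge (x := x * cs.simple t) (y := 1) h1
    (by simpa using hl.symm)
  simpa using this

theorem weight_longest_lt (hM : ∀ s t : B, s ≠ t → M s t ≠ 2) {s t : B} (hst : s ≠ t) {x : W}
    (hx : x ∉ Hecke.OmegaGe L N) (hs : cs.IsRightDescent x s) (ht : cs.IsRightDescent x t) :
    L (alt cs s t (M s t)) < N := by
  obtain ⟨h0, g, rfl, hgs, hgt⟩ := exists_longest_of_descents cs hM hst hs ht
  by_contra hN
  refine hx ?_
  have h1 : alt cs s t (M s t) ∈ Hecke.Dge L N :=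
    Or.inl ⟨{s, t}, isLongest_alt hM hst h0, by omega⟩
  have := mem_omegaGe_of_mem_dge (x := g) (y := 1) h1
    (by simpa using length_mul_par cs hM hst hgs hgt _ (alt_mem_par cs _ s t))
  simpa using this

theorem alt_mem_dge (hM : ∀ s t : B, s ≠ t → M s t ≠ 2) {s t : B}
    (h : L (cs.simple s) < L (cs.simple t)) (h0 : M s t ≠ 0)
    (hN : N ≤ mixedWeight L s t (alt cs s t (M s t - 1))) :
    alt cs s t (M s t - 1) ∈ Hecke.Dge L N := by
  refine Or.inr ⟨s, t, h0, h, rfl, ?_⟩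
  obtain ⟨k, hk⟩ := even_of_weight_lt L hM h
  rw [(mixedWeight_alt L hM h (Or.inr (by omega))).1, show (M s t - 1 + 1) / 2 = k by omega,
    show (M s t - 1) / 2 = k - 1 by omega, Nat.cast_sub (by omega)] at hN
  rw [show M s t / 2 = k by omega]
  exact_mod_cast hN

end Omega

section Dihedral

variable {B W : Type*} [Group W] {M : CoxeterMatrix B} (cs : CoxeterSystem M W)

theorem length_simple_mul_simple (hM : ∀ s t : B, s ≠ t → M s t ≠ 2) {p q : B} (hpq : p ≠ q) :
    cs.length (cs.simple p * cs.simple q) = 2 := by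
  have := length_alt cs hM 2 hpq (by have := M.off_diagonal p q hpq; omega)
  simpa [alt_succ] using this

theorem not_rightDescent_mul_simple (hM : ∀ s t : B, s ≠ t → M s t ≠ 2) {p q : B} (hpq : p ≠ q)
    {a : W} (hp : ¬ cs.IsRightDescent a p) (hq : ¬ cs.IsRightDescent a q) :
    ¬ cs.IsRightDescent (a * cs.simple p) q := by
  rw [rightDescent_mul_par cs hM hpq hp hq (left_mem_par cs p q) (by simp), IsRightDescent,
    length_simple_mul_simple cs hM hpq, cs.length_simple]
  omega

theorem not_leftDescent_simple_mul (hM : ∀ s t : B, s ≠ t → M s t ≠ 2) {p q : B} (hpq : p ≠ q)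
    {b : W} (hp : ¬ cs.IsLeftDescent b p) (hq : ¬ cs.IsLeftDescent b q) :
    ¬ cs.IsLeftDescent (cs.simple p * b) q := by
  rw [leftDescent_par_mul cs hM hpq hp hq (left_mem_par cs p q) (by simp), IsLeftDescent,
    length_simple_mul_simple cs hM hpq.symm, cs.length_simple]
  omega

theorem cases_of_mem_par (hM : ∀ s t : B, s ≠ t → M s t ≠ 2) {s t : B} (hst : s ≠ t) {w : W}
    (hw : w ∈ par cs s t) : 3 ≤ cs.length w ∨ w = 1 ∨ w = cs.simple s ∨ w = cs.simple t ∨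
      w = cs.simple s * cs.simple t ∨ w = cs.simple t * cs.simple s := by
  obtain ⟨n, hn, h⟩ := mem_par cs hw
  have h1 := length_alt cs hM n hst hn
  have h2 := length_alt cs hM n hst.symm (by rwa [M.symmetric])
  by_cases h3 : 3 ≤ n
  · left
    rcases h with rfl | rfl <;> omega
  · right
    have : n = 0 ∨ n = 1 ∨ n = 2 := by omega
    rcases this with rfl | rfl | rfl
    · left; simpa using h
    · rcases h with rfl | rfl <;> simp
    · rcases h with rfl | rfl <;> simp [alt_succ]

end Dihedral

/-! ### Products whose right factor has two left descents. -/

namespace BoundedHecke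

variable {B W : Type*} [Group W] {M : CoxeterMatrix B} {cs : CoxeterSystem M W}
  {L : WeightFunction cs} {N : ℕ} {R : Type*} [Ring R] [Algebra LZ R] (S : BoundedHecke L N R)

/-- This is the index character with $y=w_Jb$. Since $s$ is no right descent of $x=au$, the dihedral
part $u$ is not $w_J$. -/
theorem mul_mem_of_leftDescents (hM : ∀ s t : B, s ≠ t → M s t ≠ 2) {s t : B} (hst : s ≠ t)
    {x y : W} (hxs : ¬ cs.IsRightDescent x s) (hys : cs.IsLeftDescent y s)
    (hyt : cs.IsLeftDescent y t) : S.τ x * S.τ y ∈ S.F (N - 1) := by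
  obtain ⟨h0, b, rfl, hbs, hbt⟩ := exists_longest_of_leftDescents cs hM hst hys hyt
  obtain ⟨a, u, hu, rfl, has, hat⟩ := exists_par_decomp cs s t x
  refine S.mul_mem_of_charSum (indexChar L s t) hM hst h0 has hat hbs hbt (alt_mem_par cs _ s t)
    (fun w hw hne => weight_lt_longest L hM hst h0 hw hne) hu (Or.inl ?_)
  rintro rfl
  refine hxs ?_
  rw [rightDescent_mul_par cs hM hst has hat hu (by simp), IsRightDescent,
    length_alt cs hM _ hst (Or.inr le_rfl)]
  have h3 := three_le hM hst h0
  obtain ⟨m, hm⟩ : ∃ m, M s t = m + 1 := ⟨M s t - 1, by omega⟩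
  rw [alt_comm, hm, alt_succ, cs.simple_mul_simple_cancel_right, length_alt cs hM _ hst (by omega)]
  omega

theorem mul_mem_of_simple {a b : W} {p : B} (hap : ¬ cs.IsRightDescent a p)
    (hbp : ¬ cs.IsLeftDescent b p) {n : ℤ} (h1 : ∀ y, S.τ (a * cs.simple p) * S.τ y ∈ S.F n)
    (h2 : ∀ y, S.τ a * S.τ y ∈ S.F n) :
    S.τ (a * cs.simple p) * S.τ b ∈ S.F (n - L (cs.simple p)) := by
  rw [S.mul_shift hap hbp]
  exact S.mul_mem_of_step hap hbp (h1 _) (h2 _)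

/-- This is the exceptional case $u=z=w_J$ of the index character. As $L(w_J)<N$, it suffices to
bound $T_{aw}T_b$ by $N-1-L(w)$ for each $w\in W_J$. For $l(w)\ge3$ the product is reduced; for
$l(w)\le1$ the induction hypothesis applies to the prefixes $a$ and $ap$ of $x$; for $l(w)=2$
`mul_mem_of_minimal` is used. -/
theorem mul_mem_of_rightDescents (hM : ∀ s t : B, s ≠ t → M s t ≠ 2) {s t : B} (hst : s ≠ t)
    {x y : W} (hx : x ∉ Hecke.OmegaGe L N)
    (ih : ∀ x', x' ∉ Hecke.OmegaGe L N → cs.length x' < cs.length x →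
      ∀ y, S.τ x' * S.τ y ∈ S.F (N - 1))
    (hxs : cs.IsRightDescent x s) (hxt : cs.IsRightDescent x t)
    (hys : cs.IsLeftDescent y s) (hyt : cs.IsLeftDescent y t) :
    S.τ x * S.τ y ∈ S.F (N - 1) := by
  have hw0 := weight_longest_lt hM hst hx hxs hxt
  obtain ⟨h0, b, rfl, hbs, hbt⟩ := exists_longest_of_leftDescents cs hM hst hys hyt
  obtain ⟨-, a, rfl, has, hat⟩ := exists_longest_of_descents cs hM hst hxs hxt
  have h3 := three_le hM hst h0
  have hwm := alt_mem_par cs (M s t) s t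
  have hwl := length_alt cs hM _ hst (Or.inr le_rfl)
  have hal := length_mul_par cs hM hst has hat
  have hxl := hal _ hwm
  have hW := weight_longest L hM hst h0
  refine S.mul_mem_of_charSum (indexChar L s t) hM hst h0 has hat hbs hbt hwm
    (fun w hw hne => weight_lt_longest L hM hst h0 hw hne) hwm (Or.inr ?_)
  have hpre : ∀ u v, u ∈ par cs s t → u * v = alt cs s t (M s t) →
      cs.length u + cs.length v = M s t → v ≠ 1 → a * u ∉ Hecke.OmegaGe L N ∧
        ∀ y, S.τ (a * u) * S.τ y ∈ S.F (N - 1) := by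
    intro u v hu huv hl hv
    have hv' : 0 < cs.length v := Nat.pos_of_ne_zero fun h => hv (cs.length_eq_zero_iff.1 h)
    have hau := hal u hu
    have h1 : a * u ∉ Hecke.OmegaGe L N := fun h => hx <| by
      rw [← huv, ← mul_assoc]
      refine mul_mem_omegaGe_right h ?_
      rw [mul_assoc, huv]
      omega
    exact ⟨h1, ih _ h1 (by omega)⟩
  have hpre1 : ∀ p, p = s ∨ p = t → a * cs.simple p ∉ Hecke.OmegaGe L N ∧
      ∀ y, S.τ (a * cs.simple p) * S.τ y ∈ S.F (N - 1) := by
    intro p hp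
    have hd : cs.IsLeftDescent (alt cs s t (M s t)) p := by
      rw [← leftDescent_par_mul cs hM hst hbs hbt hwm hp]
      rcases hp with rfl | rfl <;> assumption
    have hl := cs.isLeftDescent_iff.1 hd
    refine hpre _ _ (simple_mem_par cs hp) (cs.simple_mul_simple_cancel_left p)
      (by rw [cs.length_simple]; omega) ?_
    intro h
    rw [h, cs.length_one] at hl
    omega
  have hpre0 : ∀ y, S.τ a * S.τ y ∈ S.F (N - 1) := by
    have := hpre 1 _ (one_mem _) (one_mul _) (by rw [cs.length_one, hwl, zero_add])
      (by rintro h; rw [h, cs.length_one] at hwl; omega)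
    rw [mul_one] at this
    exact this.2
  have hp1 : ∀ p, (p = s ∨ p = t) → ¬ cs.IsRightDescent a p → ¬ cs.IsLeftDescent b p →
      S.τ (a * cs.simple p) * S.τ b ∈ S.F (N - 1 - L (cs.simple p)) := fun p hp hap hbp =>
    S.mul_mem_of_simple hap hbp (hpre1 p hp).2 hpre0
  have hp2 : ∀ p q, (p = s ∧ q = t ∨ p = t ∧ q = s) →
      2 * L (cs.simple q) + L (cs.simple p) < N →
      S.τ (a * (cs.simple p * cs.simple q)) * S.τ b ∈
        S.F (N - 1 - (L (cs.simple p) + L (cs.simple q))) := by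
    intro p q hpq hlt
    have hne : p ≠ q := by rcases hpq with ⟨rfl, rfl⟩ | ⟨rfl, rfl⟩ <;> tauto
    have hap : ¬ cs.IsRightDescent a p := by rcases hpq with ⟨rfl, rfl⟩ | ⟨rfl, rfl⟩ <;> assumption
    have haq : ¬ cs.IsRightDescent a q := by rcases hpq with ⟨rfl, rfl⟩ | ⟨rfl, rfl⟩ <;> assumption
    have hbp : ¬ cs.IsLeftDescent b p := by rcases hpq with ⟨rfl, rfl⟩ | ⟨rfl, rfl⟩ <;> assumption
    have hbq : ¬ cs.IsLeftDescent b q := by rcases hpq with ⟨rfl, rfl⟩ | ⟨rfl, rfl⟩ <;> assumption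
    have hq := L.pos q
    rw [← mul_assoc, S.mul_shift (not_rightDescent_mul_simple cs hM hne hap haq) hbq]
    rcases S.mul_mem_of_minimal hM hne a b hap haq hbp hbq with h | ⟨r, hrp, -, hr, -, h⟩
    · exact S.mono (by omega) h
    · refine S.mono ?_ h
      have hdp : cs.IsRightDescent (a * cs.simple p) p := by
        rw [cs.isRightDescent_iff_not_isRightDescent_mul, cs.simple_mul_simple_cancel_right]
        exact hap
      -- The prefix $ap\notin\Omega_{\ge N}$ has the descents $r$ and $p$, so $2L(r)+L(p)<N$.
      -- Together with $2L(q)+L(p)<N$ this gives $L(p)+L(q)+L(r)<N$.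
      have h1 := weight_longest_lt hM hrp (hpre1 p (by tauto)).1 hr hdp
      have h2 := (weight_longest L hM hrp
        (exists_longest_of_descents cs hM hrp hr hdp).1).1
      omega
  rw [S.charSum_expand' _ h0 hM hst has hat]
  refine sum_mem fun w hw => ?_
  rw [Set.Finite.mem_toFinset] at hw
  suffices h : S.τ (a * w) * S.τ b ∈ S.F (N - 1 - L w) by
    have := S.char_smul_mem (indexChar L s t) w h
    exact S.mono (by change L w + _ ≤ _; omega) this
  rcases cases_of_mem_par cs hM hst hw with h | rfl | rfl | rfl | rfl | rfl
  · refine S.mono ?_ (S.mem_of_reduced₃ (hal _ hw)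
      (length_mul_mul_of_par cs hM hst has hat hbs hbt hw h))
    have : L w ≤ L (alt cs s t (M s t)) := by
      by_cases h : w = alt cs s t (M s t)
      · rw [h]
      · exact (weight_lt_longest L hM hst h0 hw h).le
    omega
  · rw [weight_one, mul_one, sub_zero]
    exact hpre0 b
  · exact hp1 s (by simp) has hbs
  · exact hp1 t (by simp) hat hbt
  · rw [L.map_mul_of_length_add _ _ (by simp [length_simple_mul_simple cs hM hst])]
    exact hp2 s t (by simp) (by omega)
  · rw [L.map_mul_of_length_add _ _ (by simp [length_simple_mul_simple cs hM hst.symm])]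
    exact hp2 t s (by simp) (by omega)

end BoundedHecke

end CoxHecke

namespace CoxHecke

open CoxeterSystem

/-! ### Unequal weights and the induction on the length of the left factor. -/

namespace BoundedHecke

variable {B W : Type*} [Group W] {M : CoxeterMatrix B} {cs : CoxeterSystem M W}
  {L : WeightFunction cs} {N : ℕ} {R : Type*} [Ring R] [Algebra LZ R] (S : BoundedHecke L N R)

/-- As for the index character, $T_{aw}T_b$ is bounded by $N-1$ minus the degree of $c(w)$. The
negative contribution of $s$ makes this easier: for $w=s$ the uniform bound suffices, and for
$w=st,ts$ the gain $L(t)$ over it does, because $L(s)\ge1$. Only $a$ and $at$ need the stronger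
hypotheses. -/
theorem mixedCharSum_mem (hM : ∀ s t : B, s ≠ t → M s t ≠ 2) {s t : B}
    (hlt : L (cs.simple s) < L (cs.simple t)) (h0 : M s t ≠ 0) {a b : W}
    (has : ¬ cs.IsRightDescent a s) (hat : ¬ cs.IsRightDescent a t)
    (hbs : ¬ cs.IsLeftDescent b s) (hbt : ¬ cs.IsLeftDescent b t)
    (hw0 : mixedWeight L s t (alt cs s t (M s t - 1)) < N)
    (h1 : ∀ y, S.τ a * S.τ y ∈ S.F (N - 1))
    (h2 : ∀ y, S.τ (a * cs.simple t) * S.τ y ∈ S.F (N - 1)) :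
    S.τ a * S.charSum (mixedChar L hlt) * S.τ b ∈ S.F (N - 1) := by
  have hst : s ≠ t := by rintro rfl; exact lt_irrefl _ hlt
  have h3 := three_le hM hst h0
  have hs := L.pos s
  have w2 := mixedWeight_alt L hM hlt (n := 2) (by omega)
  have w1 := mixedWeight_alt L hM hlt (n := 1) (by omega)
  have w0 := mixedWeight_alt L hM hlt (n := 0) (by omega)
  simp [alt_succ] at w2 w1 w0
  have hbt' := not_leftDescent_simple_mul cs hM hst hbs hbt
  have hat' := not_rightDescent_mul_simple cs hM hst has hat
  have has' := not_rightDescent_mul_simple cs hM hst.symm hat has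
  rw [S.charSum_expand' _ h0 hM hst has hat]
  refine sum_mem fun w hw => ?_
  rw [Set.Finite.mem_toFinset] at hw
  suffices h : S.τ (a * w) * S.τ b ∈ S.F (N - 1 - mixedWeight L s t w) by
    have := S.char_smul_mem (mixedChar L hlt) w h
    exact S.mono (by change mixedWeight L s t w + _ ≤ _; omega) this
  rcases cases_of_mem_par cs hM hst hw with h | rfl | rfl | rfl | rfl | rfl
  · refine S.mono ?_ (S.mem_of_reduced₃ (length_mul_par cs hM hst has hat _ hw)
      (length_mul_mul_of_par cs hM hst has hat hbs hbt hw h))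
    have : mixedWeight L s t w ≤ mixedWeight L s t (alt cs s t (M s t - 1)) := by
      by_cases h : w = alt cs s t (M s t - 1)
      · rw [h]
      · exact (mixedWeight_lt L hM hlt h0 hw h).le
    omega
  · rw [mul_one, w0, sub_zero]
    exact h1 b
  · rw [w1.2]
    exact S.mono (by omega) (S.bound _ _)
  · rw [w1.1]
    exact S.mul_mem_of_simple hat hbt h2 h1
  · rw [w2.1, ← mul_assoc, S.mul_shift hat' hbt]
    exact S.mono (by omega) (S.bound_sub hat' hbt)
  · rw [w2.2, ← mul_assoc, S.mul_shift has' hbs, S.mul_shift hat hbt']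
    exact S.mono (by omega) (S.bound_sub hat hbt')

/-- As $m_{st}$ is even, $w_J=sd$, so $sy=db$ and the mixed character isolates the product. In the
case $x=ad$, the condition $x\notin\Omega_{\ge N}$ gives $\mathbf a'(d)<N$, and $a$ and $at$ are
shorter prefixes of $x$. -/
theorem mul_mem_of_mixed (hM : ∀ s t : B, s ≠ t → M s t ≠ 2) {s t : B}
    (hlt : L (cs.simple s) < L (cs.simple t)) {x y : W} (hx : x ∉ Hecke.OmegaGe L N)
    (hy : cs.simple s * y ∉ Hecke.OmegaGt L N)
    (ih : ∀ x', x' ∉ Hecke.OmegaGe L N → cs.length x' < cs.length x →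
      ∀ y, S.τ x' * S.τ y ∈ S.F (N - 1))
    (hys : cs.IsLeftDescent y s) (hyt : cs.IsLeftDescent y t) :
    S.τ x * S.τ (cs.simple s * y) ∈ S.F (N - 1) := by
  have hst : s ≠ t := by rintro rfl; exact lt_irrefl _ hlt
  obtain ⟨h0, b, rfl, hbs, hbt⟩ := exists_longest_of_leftDescents cs hM hst hys hyt
  have h3 := three_le hM hst h0
  obtain ⟨k, hk⟩ := even_of_weight_lt L hM hlt
  obtain ⟨m, hm⟩ : ∃ m, M s t = m + 1 := ⟨M s t - 1, by omega⟩
  have hd : cs.simple s * (alt cs s t (M s t) * b) = alt cs s t (M s t - 1) * b := by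
    rw [hm, alt_succ_left, if_neg (by rw [Nat.not_even_iff_odd]; exact ⟨k - 1, by omega⟩),
      ← mul_assoc, cs.simple_mul_simple_cancel_left, Nat.add_sub_cancel]
  rw [hd] at hy ⊢
  have hdm := alt_mem_par cs (M s t - 1) s t
  have hdl := length_alt cs hM (M s t - 1) hst (by omega)
  obtain ⟨a, u, hu, rfl, has, hat⟩ := exists_par_decomp cs s t x
  refine S.mul_mem_of_charSum (mixedChar L hlt) hM hst h0 has hat hbs hbt hdm
    (fun w hw hne => mixedWeight_lt L hM hlt h0 hw hne) hu ?_
  by_cases hud : u = alt cs s t (M s t - 1)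
  swap
  · exact Or.inl hud
  subst hud
  right
  have hal := length_mul_par cs hM hst has hat
  have hxl := hal _ hdm
  refine S.mixedCharSum_mem hM hlt h0 has hat hbs hbt ?_ ?_ ?_
  · by_contra hN
    refine hx ?_
    have := mem_omegaGe_of_mem_dge (x := a) (y := 1) (alt_mem_dge hM hlt h0 (not_lt.1 hN))
      (by simpa using hxl)
    rwa [mul_one] at this
  · exact ih a (fun h => hx (mul_mem_omegaGe_right h hxl)) (by omega)
  · have hat1 := cs.not_isRightDescent_iff.1 hat
    refine ih _ (fun h => hx ?_) (by omega)
    have e : alt cs s t (M s t - 1) = cs.simple t * alt cs s t (M s t - 2) := by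
      obtain ⟨j, hj⟩ : ∃ j, M s t = j + 2 := ⟨M s t - 2, by omega⟩
      rw [hj, show j + 2 - 1 = j + 1 by omega, alt_succ_left, if_pos ⟨k - 1, by omega⟩,
        Nat.add_sub_cancel]
    rw [e, ← mul_assoc] at hxl ⊢
    refine mul_mem_omegaGe_right h ?_
    rw [hxl, hat1, ← e, hdl, length_alt cs hM _ hst (by omega)]
    omega

/-- If `x` does not belong to `Ω_{≥N}`, then `T_x T_y` has degree less than `N` for all `y`. -/
theorem mul_mem_of_notMem_omegaGe (hM : ∀ s t : B, s ≠ t → M s t ≠ 2)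
    (hΩ : ∀ y ∈ Hecke.OmegaGt L N, ∀ x, S.τ x * S.τ y ∈ S.F (N - 1)) (x : W)
    (hx : x ∉ Hecke.OmegaGe L N) (y : W) : S.τ x * S.τ y ∈ S.F (N - 1) := by
  induction hn : cs.length x using Nat.strong_induction_on generalizing x y with
  | _ n ih' =>
    subst hn
    have ih : ∀ x', x' ∉ Hecke.OmegaGe L N → cs.length x' < cs.length x →
        ∀ y, S.τ x' * S.τ y ∈ S.F (N - 1) := fun x' h1 h2 y => ih' _ h2 x' h1 y rfl
    clear ih'
    by_cases hy : y ∈ Hecke.OmegaGt L N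
    · exact hΩ y hy x
    have hN : (0 : ℤ) < N := by exact_mod_cast pos_of_notMem_omegaGe hx
    by_cases hx1 : x = 1
    · rw [hx1, S.τ_one, one_mul]
      exact S.mono (by omega) (S.τ_mem y)
    have pre : ∀ {z : W} {p : B}, ¬ cs.IsRightDescent z p → z * cs.simple p ∉ Hecke.OmegaGe L N →
        z ∉ Hecke.OmegaGe L N := fun {z p} hd h h' => h <| mul_mem_omegaGe_right h'
      (by rw [cs.not_isRightDescent_iff.1 hd, cs.length_simple])
    -- A right descent of $x$ that is no left descent of $y$ can be moved across, which shortens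
    -- $x$.
    by_cases hsub : ∀ q, cs.IsRightDescent x q → cs.IsLeftDescent y q
    swap
    · push Not at hsub
      obtain ⟨q, hxq, hyq⟩ := hsub
      have hl := cs.isRightDescent_iff.1 hxq
      obtain ⟨z, rfl⟩ : ∃ z, x = z * cs.simple q :=
        ⟨x * cs.simple q, (cs.simple_mul_simple_cancel_right q).symm⟩
      rw [cs.isRightDescent_iff_not_isRightDescent_mul, cs.simple_mul_simple_cancel_right] at hxq
      rw [cs.simple_mul_simple_cancel_right] at hl
      rw [S.mul_shift hxq hyq]
      exact ih z (pre hxq hx) (by omega) _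
    obtain ⟨t, hxt⟩ := cs.exists_rightDescent_of_ne_one hx1
    have hyt := hsub t hxt
    have hLt := weight_lt_of_rightDescent hx hxt
    have hl := cs.isRightDescent_iff.1 hxt
    by_cases hcase : ∃ s, s ≠ t ∧ cs.IsRightDescent (x * cs.simple t) s ∧ cs.IsLeftDescent y s
    · obtain ⟨s, hst, hxs', hys⟩ := hcase
      by_cases hxs : cs.IsRightDescent x s
      · exact S.mul_mem_of_rightDescents hM hst hx ih hxs hxt hys hyt
      · exact S.mul_mem_of_leftDescents hM hst hxs hys hyt
    push Not at hcase
    obtain ⟨x, rfl⟩ : ∃ z, x = z * cs.simple t :=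
      ⟨x * cs.simple t, (cs.simple_mul_simple_cancel_right t).symm⟩
    obtain ⟨y1, rfl⟩ : ∃ z, y = cs.simple t * z :=
      ⟨cs.simple t * y, (cs.simple_mul_simple_cancel_left t).symm⟩
    rw [cs.isRightDescent_iff_not_isRightDescent_mul, cs.simple_mul_simple_cancel_right] at hxt
    have hy1 := hyt
    rw [cs.isLeftDescent_iff_not_isLeftDescent_mul, cs.simple_mul_simple_cancel_left] at hy1
    simp only [cs.simple_mul_simple_cancel_right] at hl hcase
    have hx' := pre hxt hx
    have ihx := ih x hx' (by omega)
    -- Splitting at $t$ leaves the term $\xi_tT_xT_y$ for the trimmed $x$, so a gain of $L(t)$ over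
    -- the induction hypothesis is required.
    suffices hG : S.τ x * S.τ (cs.simple t * y1) ∈ S.F (N - 1 - L (cs.simple t)) by
      rw [S.mul_step hxt hy1]
      refine add_mem (ihx _) ?_
      exact S.mono (by omega) (S.xi_smul_mem t hG)
    by_cases hx1' : x = 1
    · rw [hx1', S.τ_one, one_mul]
      exact S.mono (by omega) (S.τ_mem _)
    generalize hyy : cs.simple t * y1 = y at *
    obtain ⟨s, hxs⟩ := cs.exists_rightDescent_of_ne_one hx1'
    have hst : s ≠ t := by rintro rfl; exact hxt hxs
    have hys := hcase s hst hxs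
    have hl' := cs.isRightDescent_iff.1 hxs
    obtain ⟨a, rfl⟩ : ∃ z, x = z * cs.simple s :=
      ⟨x * cs.simple s, (cs.simple_mul_simple_cancel_right s).symm⟩
    rw [cs.isRightDescent_iff_not_isRightDescent_mul, cs.simple_mul_simple_cancel_right] at hxs
    rw [cs.simple_mul_simple_cancel_right] at hl'
    have ha := pre hxs hx'
    have iha := ih a ha (by omega)
    have hs := S.mul_mem_of_step hxs hys (ihx _) (iha _)
    rw [S.mul_shift hxs hys]
    -- Applied at $s$, the step identity gains $L(s)$. This is enough unless $L(s)<L(t)$, the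
    -- situation responsible for the second kind of elements of $D$.
    by_cases hlt : L (cs.simple s) < L (cs.simple t)
    swap
    · exact S.mono (by omega) hs
    by_cases hat : cs.IsRightDescent a t
    · have hyst : cs.IsLeftDescent (cs.simple s * y) s := by
        rw [cs.isLeftDescent_iff_not_isLeftDescent_mul, cs.simple_mul_simple_cancel_left]
        exact hys
      by_cases hyt' : cs.IsLeftDescent (cs.simple s * y) t
      -- Here $sy$ has both left descents, so $y$ begins with $d$. The mixed character bounds the
      -- untrimmed product $T_{ast}T_y$, and the step identity at $t$ converts this into the gain
      -- $L(t)$.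
      · have hm := S.mul_mem_of_mixed (y := cs.simple s * y) hM hlt hx
          (by rwa [cs.simple_mul_simple_cancel_left]) ih hyst hyt'
        rw [cs.simple_mul_simple_cancel_left, ← hyy] at hm
        have := S.mul_mem_of_step hxt hy1 hm (ihx _)
        rwa [hyy, S.mul_shift hxs hys] at this
      · have hl2 := cs.isRightDescent_iff.1 hat
        obtain ⟨c, rfl⟩ : ∃ z, a = z * cs.simple t :=
          ⟨a * cs.simple t, (cs.simple_mul_simple_cancel_right t).symm⟩
        rw [cs.isRightDescent_iff_not_isRightDescent_mul, cs.simple_mul_simple_cancel_right] at hat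
        rw [cs.simple_mul_simple_cancel_right] at hl2
        exact S.mul_mem_of_simple hat hyt' iha (ih c (pre hat ha) (by omega))
    -- If $t$ is no right descent of $a$, the product $as\cdot y$ is reduced: write $y=ub$. Either
    -- $l(su)\ge3$ separates $a$ from $b$, or $u=t$, and then a failure would give a common descent
    -- excluded by `hcase`.
    · rw [← S.mul_shift hxs hys]
      refine S.mono (m := 0) (by omega) (S.mem_of_reduced ?_)
      obtain ⟨b, u, hu, rfl, hbs, hbt⟩ := exists_par_decomp_left cs s t y
      rw [leftDescent_par_mul cs hM hst hbs hbt hu (by simp)] at hyt hys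
      have hus := cs.not_isLeftDescent_iff.1 hys
      have hub := length_par_mul cs hM hst hbs hbt u hu
      by_cases h3 : 3 ≤ cs.length (cs.simple s * u)
      · have := length_mul_mul_of_par cs hM hst hxs hat hbs hbt
          (mul_mem (left_mem_par cs s t) hu) h3
        simp only [mul_assoc] at this ⊢
        omega
      · have hut : u = cs.simple t := by
          have h2 := length_simple_mul_simple cs hM hst
          have h2' := length_simple_mul_simple cs hM hst.symm
          rcases cases_of_mem_par cs hM hst hu with h | rfl | rfl | rfl | rfl | rfl
          · omega
          · exact absurd hyt (cs.not_isLeftDescent_one t)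
          · exact absurd (by simp [IsLeftDescent]) hys
          · rfl
          · omega
          · omega
        by_contra hred
        rw [hut] at hred
        obtain ⟨p, -, hpt, h1, h2⟩ := exists_descent_of_not_reduced cs hM hst hxs hat hbs hbt hred
        rw [← hut] at h2
        exact hcase p hpt h1 h2

end BoundedHecke

end CoxHecke

namespace CoxHecke

open CoxeterSystem

/-! ### The degree filtration attached to a basis. -/

section Degree

/-- The Laurent polynomials of degree at most `n`. -/
def degreeLE (n : ℤ) : AddSubgroup LZ where
  carrier := {a | ∀ k, n < k → a.coeff k = 0}
  add_mem' := fun {a b} ha hb k hk => by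
    rw [AddMonoidAlgebra.coeff_add, Finsupp.add_apply, ha k hk, hb k hk, add_zero]
  zero_mem' := fun k _ => by simp
  neg_mem' := fun {a} ha k hk => by
    rw [AddMonoidAlgebra.coeff_neg, Finsupp.neg_apply, ha k hk, neg_zero]

theorem mem_degreeLE {n : ℤ} {a : LZ} : a ∈ degreeLE n ↔ a.degree ≤ n := by
  rw [LaurentPolynomial.degree, Finset.max_eq_sup_withBot, Finset.sup_le_iff]
  constructor
  · intro h k hk
    by_contra hc
    exact Finsupp.mem_support_iff.1 hk (h k (WithBot.coe_lt_coe.1 (not_le.1 hc)))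
  · intro h k hk
    by_contra hc
    exact not_lt.2 (WithBot.coe_le_coe.1 (h k (Finsupp.mem_support_iff.2 hc))) hk

theorem degreeLE_mono {m n : ℤ} (h : m ≤ n) : degreeLE m ≤ degreeLE n :=
  fun _ ha k hk => ha k (h.trans_lt hk)

theorem mul_mem_degreeLE {m n : ℤ} {a b : LZ} (ha : a ∈ degreeLE m) (hb : b ∈ degreeLE n) :
    a * b ∈ degreeLE (m + n) := by
  classical
  intro k hk
  rw [AddMonoidAlgebra.coeff_mul]
  refine Finset.sum_eq_zero fun i _ => Finset.sum_eq_zero fun j _ => ?_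
  dsimp only
  split_ifs with h
  · rcases lt_or_ge m i with hi | hi
    · rw [ha i hi, zero_mul]
    · rw [hb j (by omega), mul_zero]
  · rfl

theorem T_mem_degreeLE (n : ℤ) : (LaurentPolynomial.T n : LZ) ∈ degreeLE n :=
  mem_degreeLE.2 (LaurentPolynomial.degree_T_le n)

theorem one_mem_degreeLE : (1 : LZ) ∈ degreeLE 0 := by
  rw [← LaurentPolynomial.T_zero]; exact T_mem_degreeLE 0

theorem mem_degreeLE_of_degree_neg {a : LZ} (h : a.degree < 0) : a ∈ degreeLE (-1) :=
  fun k hk => (degree_neg_iff a).1 h k (by omega)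

variable {ι V : Type*} [AddCommGroup V] [Module LZ V] (b : Module.Basis ι LZ V)

/-- The elements with coefficients of degree at most `n` in the given basis. -/
def basisLE (n : ℤ) : AddSubgroup V where
  carrier := {x | ∀ i, b.repr x i ∈ degreeLE n}
  add_mem' := fun {x y} hx hy i => by
    rw [map_add, Finsupp.add_apply]; exact add_mem (hx i) (hy i)
  zero_mem' := fun i => by rw [map_zero]; exact zero_mem _
  neg_mem' := fun {x} hx i => by rw [map_neg, Finsupp.neg_apply]; exact neg_mem (hx i)

theorem basisLE_mono {m n : ℤ} (h : m ≤ n) : basisLE b m ≤ basisLE b n :=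
  fun _ hx i => degreeLE_mono h (hx i)

theorem smul_mem_basisLE {m n : ℤ} {a : LZ} {x : V} (ha : a ∈ degreeLE m) (hx : x ∈ basisLE b n) :
    a • x ∈ basisLE b (m + n) := fun i => by
  rw [map_smul, Finsupp.smul_apply, smul_eq_mul]
  exact mul_mem_degreeLE ha (hx i)

theorem basis_mem_basisLE (i : ι) : b i ∈ basisLE b 0 := fun j => by
  classical
  rw [b.repr_self, Finsupp.single_apply]
  split_ifs
  · exact one_mem_degreeLE
  · exact zero_mem _

theorem exists_mem_basisLE (x : V) : ∃ n, x ∈ basisLE b n := by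
  induction b.mem_span x using Submodule.span_induction with
  | mem x hx =>
    obtain ⟨i, rfl⟩ := hx
    exact ⟨0, basis_mem_basisLE b i⟩
  | zero => exact ⟨0, zero_mem _⟩
  | add x y _ _ hx hy =>
    obtain ⟨m, hm⟩ := hx
    obtain ⟨n, hn⟩ := hy
    exact ⟨max m n, add_mem (basisLE_mono b (le_max_left m n) hm)
      (basisLE_mono b (le_max_right m n) hn)⟩
  | smul a x _ hx =>
    obtain ⟨n, hn⟩ := hx
    obtain ⟨m, hm⟩ : ∃ m, a ∈ degreeLE m := by
      induction a using LaurentPolynomial.induction_on' with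
      | add p q hp hq =>
        obtain ⟨m, hm⟩ := hp
        obtain ⟨n, hn⟩ := hq
        exact ⟨max m n, add_mem (degreeLE_mono (le_max_left m n) hm)
          (degreeLE_mono (le_max_right m n) hn)⟩
      | C_mul_T n c => exact ⟨n, mem_degreeLE.2 (LaurentPolynomial.degree_C_mul_T_le n c)⟩
    exact ⟨m + n, smul_mem_basisLE b hm hn⟩

/-- The bound is required only for basis elements that occur in $x$, which is what inductions on the
length can supply. -/
theorem map_mem_basisLE {κ V' : Type*} [AddCommGroup V'] [Module LZ V'] (b' : Module.Basis κ LZ V')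
    (φ : V →ₗ[LZ] V') {m n : ℤ} {x : V} (hx : x ∈ basisLE b n)
    (h : ∀ i, b.repr x i ≠ 0 → φ (b i) ∈ basisLE b' m) : φ x ∈ basisLE b' (n + m) := by
  rw [← b.linearCombination_repr x, Finsupp.linearCombination_apply, Finsupp.sum, map_sum]
  refine sum_mem fun i hi => ?_
  rw [map_smul]
  exact smul_mem_basisLE b' (hx i) (h i (Finsupp.mem_support_iff.1 hi))

end Degree

/-! ### Degrees of products in the quotient $\mathcal H_{\le N}$. -/

namespace Hecke

variable {B W : Type*} [Group W] {M : CoxeterMatrix B} {cs : CoxeterSystem M W}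
  (L : WeightFunction cs)

theorem C_sub_T_mem_basisLE (w : W) : C L w - T L w ∈ basisLE (stdBasis L) (-1) :=
  fun y => mem_degreeLE_of_degree_neg ((C_isKL L w).2 y)

theorem length_lt_of_repr_ne_zero {w y : W} (h : (stdBasis L).repr (C L w - T L w) y ≠ 0) :
    cs.length y < cs.length w :=
  not_le.1 fun hc => h (C_sub_T_mem L w y hc)

/-- Inversion of a unitriangular matrix: $T_w=C_w-(C_w-T_w)$, where the bracket involves only
shorter elements, with coefficients of negative degree. -/
theorem T_mem_klBasisLE (w : W) : T L w ∈ basisLE (klBasis L) 0 := by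
  induction hn : cs.length w using Nat.strong_induction_on generalizing w with
  | _ n ih =>
    subst hn
    have h1 : C L w - T L w ∈ basisLE (klBasis L) (-1 + 0) :=
      map_mem_basisLE (stdBasis L) (klBasis L) LinearMap.id (C_sub_T_mem_basisLE L w)
        fun y hy => ih _ (length_lt_of_repr_ne_zero L hy) y rfl
    have h2 := basis_mem_basisLE (klBasis L) w
    rw [klBasis_apply] at h2
    have := sub_mem h2 (basisLE_mono _ (by omega) h1)
    rwa [sub_sub_cancel] at this

theorem C_sub_T_mem_klBasisLE (w : W) : C L w - T L w ∈ basisLE (klBasis L) (-1) := by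
  have := map_mem_basisLE (stdBasis L) (klBasis L) LinearMap.id (C_sub_T_mem_basisLE L w)
    (m := 0) fun y _ => T_mem_klBasisLE L y
  exact this

variable (N : ℕ) (hN : LRClosed L (Wgt L N))

theorem toHle_C {w : W} (hw : w ∈ Wgt L N) : toHle L N hN (C L w) = 0 :=
  (toHle_eq_zero L N hN _).2 (Submodule.subset_span ⟨w, hw, rfl⟩)

/-- Only $w\in W_{>N}$ is in question. There $C_w$ vanishes, so ${}^NT_w$ is minus the image of
$C_w-T_w$, which involves shorter elements. -/
theorem TN_mem (w : W) : TN L N hN w ∈ basisLE (leBasis L N hN) 0 := by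
  induction hn : cs.length w using Nat.strong_induction_on generalizing w with
  | _ n ih =>
    subst hn
    by_cases hw : w ∈ Wgt L N
    · have h1 := map_mem_basisLE (stdBasis L) (leBasis L N hN) (toHle L N hN).toLinearMap
        (C_sub_T_mem_basisLE L w) (m := 0)
        fun y hy => ih _ (length_lt_of_repr_ne_zero L hy) y rfl
      have e : (toHle L N hN).toLinearMap (C L w - T L w) = -TN L N hN w := by
        rw [map_sub]
        change toHle L N hN (C L w) - _ = _
        rw [toHle_C L N hN hw, zero_sub]
        rfl
      rw [e, neg_mem_iff] at h1
      exact basisLE_mono _ (by omega) h1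
    · have := basis_mem_basisLE (leBasis L N hN) ⟨w, (notMem_Wgt L).1 hw⟩
      rwa [leBasis, Module.Basis.mk_apply] at this

theorem toHle_C_mem (w : W) : toHle L N hN (C L w) ∈ basisLE (leBasis L N hN) 0 := by
  have h1 : toHle L N hN (C L w - T L w) ∈ basisLE (leBasis L N hN) (-1 + 0) :=
    map_mem_basisLE (stdBasis L) (leBasis L N hN) (toHle L N hN).toLinearMap
      (C_sub_T_mem_basisLE L w) fun y _ => TN_mem L N hN y
  have := add_mem (basisLE_mono _ (by omega) h1) (TN_mem L N hN w)
  rwa [TN, ← map_add, sub_add_cancel] at this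

theorem h_mem_degreeLE {z : W} (hz : z ∉ Wgt L N) (x y : W) : h L x y z ∈ degreeLE N := by
  rw [notMem_Wgt] at hz
  have h1 : (((h L x y z).degree.unbotD 0).toNat : ℕ∞) ≤ N :=
    (le_iSup₂ (f := fun x y => (((h L x y z).degree.unbotD 0).toNat : ℕ∞)) x y).trans hz
  have h2 : ((h L x y z).degree.unbotD 0).toNat ≤ N := by exact_mod_cast h1
  rw [mem_degreeLE]
  -- The truncation of $-\infty$ and of negative degrees to $0$ in `aFun` loses nothing, since
  -- $N\ge0$.
  cases hd : (h L x y z).degree with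
  | bot => exact bot_le
  | coe n =>
    rw [hd, WithBot.unbotD_coe] at h2
    exact WithBot.coe_le_coe.2 (by omega)

/-- Among the terms $h_{u,v,z}C_z$ of $C_uC_v$, those with $z\in W_{>N}$ die in the quotient and the
others have coefficients of degree at most $N$. -/
theorem toHle_mul_mem {m n : ℤ} {x y : Hecke L} (hx : x ∈ basisLE (klBasis L) m)
    (hy : y ∈ basisLE (klBasis L) n) :
    toHle L N hN (x * y) ∈ basisLE (leBasis L N hN) (m + n + N) := by
  have key : ∀ u v, toHle L N hN (C L u * C L v) ∈ basisLE (leBasis L N hN) N := by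
    intro u v
    rw [← (klBasis L).linearCombination_repr (C L u * C L v), Finsupp.linearCombination_apply,
      Finsupp.sum, map_sum]
    refine sum_mem fun z _ => ?_
    rw [map_smul, klBasis_apply]
    by_cases hz : z ∈ Wgt L N
    · rw [toHle_C L N hN hz, smul_zero]
      exact zero_mem _
    · rw [← add_zero (N : ℤ)]
      exact smul_mem_basisLE _ (h_mem_degreeLE L N hz u v) (toHle_C_mem L N hN z)
  have h1 := map_mem_basisLE (klBasis L) (leBasis L N hN)
    ((toHle L N hN).toLinearMap ∘ₗ LinearMap.mulRight LZ y) hx (m := n + N) fun u _ =>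
      map_mem_basisLE (klBasis L) (leBasis L N hN)
        ((toHle L N hN).toLinearMap ∘ₗ LinearMap.mulLeft LZ (klBasis L u)) hy (m := N) fun v _ => by
          rw [klBasis_apply, klBasis_apply]
          exact key u v
  rw [add_assoc]
  exact h1

/-- In the quotient $T_xT_y=-T_x(C_y-T_y)$, and the second factor has degree at most $-1$ in the
basis $C$. -/
theorem TN_mul_TN_mem_of_right {x y : W} (hy : y ∈ Wgt L N) :
    TN L N hN x * TN L N hN y ∈ basisLE (leBasis L N hN) (N - 1) := by
  have h1 := toHle_mul_mem L N hN (T_mem_klBasisLE L x) (C_sub_T_mem_klBasisLE L y)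
  rw [mul_sub, map_sub, map_mul, toHle_C L N hN hy, mul_zero, zero_sub, neg_mem_iff, map_mul] at h1
  exact basisLE_mono _ (by omega) h1

theorem TN_mul_TN_mem_of_left {x y : W} (hy : y ∈ Wgt L N) :
    TN L N hN y * TN L N hN x ∈ basisLE (leBasis L N hN) (N - 1) := by
  have h1 := toHle_mul_mem L N hN (C_sub_T_mem_klBasisLE L y) (T_mem_klBasisLE L x)
  rw [sub_mul, map_sub, map_mul, toHle_C L N hN hy, zero_mul, zero_sub, neg_mem_iff, map_mul] at h1
  exact basisLE_mono _ (by omega) h1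

/-- The algebra `H_{≤N}` with the images of the standard basis. -/
noncomputable def boundedHecke : BoundedHecke L N (Hle L N hN) where
  τ := TN L N hN
  F := basisLE (leBasis L N hN)
  mono := basisLE_mono _
  shift m _ _ hx := smul_mem_basisLE _ (T_mem_degreeLE m) hx
  exhaust := exists_mem_basisLE _
  τ_one := by rw [TN, T_one, map_one]
  τ_mul h := by rw [TN, TN, ← map_mul, T_mul_of_length_add L _ _ h, TN]
  τ_sq s := by rw [TN, ← map_mul, T_simple_mul_self, map_add, map_one, map_smul]
  τ_mem := TN_mem L N hN
  bound x y := by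
    have := toHle_mul_mem L N hN (T_mem_klBasisLE L x) (T_mem_klBasisLE L y)
    rwa [map_mul, zero_add, zero_add] at this

end Hecke

/-! ### Passage to inverses and the opposite algebra. -/

/-- The opposite ring, with `T_w` replaced by `T_{w⁻¹}`. -/
noncomputable def BoundedHecke.op {B W : Type*} [Group W] {M : CoxeterMatrix B}
    {cs : CoxeterSystem M W} {L : WeightFunction cs} {N : ℤ} {R : Type*} [Ring R] [Algebra LZ R] (S : BoundedHecke L N R) :
    BoundedHecke L N Rᵐᵒᵖ where
  τ w := MulOpposite.op (S.τ w⁻¹)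
  F n := (S.F n).comap (MulOpposite.opAddEquiv.symm : Rᵐᵒᵖ ≃+ R).toAddMonoidHom
  mono h _ hx := S.mono h hx
  shift m _ _ hx := S.shift m hx
  exhaust x := S.exhaust x.unop
  τ_one := by rw [inv_one, S.τ_one, MulOpposite.op_one]
  τ_mul {w w'} h := by
    rw [← MulOpposite.op_mul, S.τ_mul, mul_inv_rev]
    rw [← mul_inv_rev, cs.length_inv, cs.length_inv, cs.length_inv, h, add_comm]
  τ_sq s := by
    rw [← MulOpposite.op_mul, cs.inv_simple, S.τ_sq]
    rfl
  τ_mem w := S.τ_mem w⁻¹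
  bound x y := S.bound y⁻¹ x⁻¹

section Inverse

variable {B W : Type*} [Group W] {M : CoxeterMatrix B} {cs : CoxeterSystem M W}

theorem weight_inv (L : WeightFunction cs) (w : W) : L w⁻¹ = L w := by
  induction w using Hecke.left_induction (cs := cs) with
  | one => rw [inv_one]
  | step s w hs ih =>
    rw [weight_simple_mul L hs, mul_inv_rev, cs.inv_simple, L.map_mul_of_length_add, ih, add_comm]
    have := cs.not_isLeftDescent_iff.1 hs
    rw [← cs.length_inv, mul_inv_rev, inv_inv, cs.inv_simple, this, cs.length_inv, cs.length_simple]

theorem alt_inv (cs : CoxeterSystem M W) (n : ℕ) :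
    ∀ s t : B, (alt cs s t (2 * n + 1))⁻¹ = alt cs s t (2 * n + 1) := by
  induction n with
  | zero => intro s t; simp
  | succ n ih =>
    intro s t
    have e : alt cs s t (2 * (n + 1) + 1) =
        cs.simple t * alt cs t s (2 * n + 1) * cs.simple t := by
      rw [alt_succ_left, if_pos (by simp), show 2 * (n + 1) = 2 * n + 1 + 1 by ring, alt_succ,
        mul_assoc]
    rw [e, mul_inv_rev, mul_inv_rev, ih, cs.inv_simple, mul_assoc]

variable {L : WeightFunction cs} {N : ℕ}

/-- The inverse of a longest element is longest of the same weight. The other elements of $D$ are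
palindromes, because $m_{st}-1$ is odd. -/
theorem inv_mem_dge (hM : ∀ s t : B, s ≠ t → M s t ≠ 2) {d : W} (hd : d ∈ Hecke.Dge L N) :
    d⁻¹ ∈ Hecke.Dge L N := by
  rcases hd with ⟨J, ⟨h1, h2, h3⟩, h4⟩ | ⟨s, t, h0, hlt, h, h4⟩
  · refine Or.inl ⟨J, ⟨h1, inv_mem h2, ?_⟩, by rwa [weight_inv]⟩
    rwa [cs.length_inv]
  · refine Or.inr ⟨s, t, h0, hlt, ?_, h4⟩
    obtain ⟨k, hk⟩ := even_of_weight_lt L hM hlt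
    rw [h, show M s t - 1 = 2 * (k - 1) + 1 by omega]
    exact alt_inv cs _ s t

theorem inv_mem_omegaGe (hM : ∀ s t : B, s ≠ t → M s t ≠ 2) {w : W}
    (hw : w ∈ Hecke.OmegaGe L N) : w⁻¹ ∈ Hecke.OmegaGe L N := by
  obtain ⟨d, hd, x, y, rfl, h⟩ := hw
  have e : (x * d * y)⁻¹ = y⁻¹ * d⁻¹ * x⁻¹ := by simp only [mul_inv_rev, mul_assoc]
  refine ⟨d⁻¹, inv_mem_dge hM hd, y⁻¹, x⁻¹, e, ?_⟩
  rw [← e, cs.length_inv, cs.length_inv, cs.length_inv, cs.length_inv, h]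
  ring

end Inverse

/-! ### The strict bound outside $\Omega_{\ge N}$ and the conclusion. -/

namespace Hecke

variable {B W : Type*} [Group W] {M : CoxeterMatrix B} {cs : CoxeterSystem M W}
  (L : WeightFunction cs) (N : ℕ) (hN : LRClosed L (Wgt L N))

theorem degLe_le_of_mem {n : ℤ} {x : Hle L N hN} (hx : x ∈ basisLE (leBasis L N hN) n) :
    degLe L N hN x ≤ n :=
  Finset.sup_le fun w _ => mem_degreeLE.1 (hx w)

/-- The statement for $y$ is the one for $y^{-1}$ as left factor in the opposite algebra, as
$\Omega_{\ge N}$ and $\Omega_{>N}$ are stable under inversion. -/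
theorem TN_mul_TN_mem (hM : ∀ s t : B, s ≠ t → M s t ≠ 2) (hΩ : Wgt L N = OmegaGt L N) {x y : W}
    (h : x ∉ OmegaGe L N ∨ y ∉ OmegaGe L N) :
    TN L N hN x * TN L N hN y ∈ basisLE (leBasis L N hN) (N - 1) := by
  rcases h with h | h
  · refine (boundedHecke L N hN).mul_mem_of_notMem_omegaGe hM ?_ x h y
    intro y hy x
    rw [← hΩ] at hy
    exact TN_mul_TN_mem_of_right L N hN hy
  · have key := (boundedHecke L N hN).op.mul_mem_of_notMem_omegaGe hM ?_ y⁻¹ ?_ x⁻¹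
    · change TN L N hN x⁻¹⁻¹ * TN L N hN y⁻¹⁻¹ ∈ basisLE (leBasis L N hN) (N - 1) at key
      rwa [inv_inv, inv_inv] at key
    · intro y hy x
      have hy' := inv_mem_omegaGe hM hy
      change y⁻¹ ∈ OmegaGt L N at hy'
      rw [← hΩ] at hy'
      exact TN_mul_TN_mem_of_left L N hN (x := x⁻¹) hy'
    · intro hc
      have := inv_mem_omegaGe hM hc
      rw [inv_inv] at this
      exact h this

end Hecke

end CoxHecke

theorem mainTheorem6 {B W : Type*} [Finite B] [Group W] {M : CoxeterMatrix B}
    (cs : CoxeterSystem M W) (hM : ∀ s t : B, s ≠ t → M s t ≠ 2)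
    (L : CoxHecke.WeightFunction cs) (N : ℕ)
    (hOmega : CoxHecke.Hecke.Wgt L N = CoxHecke.Hecke.OmegaGt L N)
    (hP1 : CoxHecke.Hecke.P1gt L N) (hP4 : CoxHecke.Hecke.P4gt L N)
    (hP8 : CoxHecke.Hecke.P8gt L N) :
    ∀ x ∈ CoxHecke.Hecke.Wle L N, ∀ y ∈ CoxHecke.Hecke.Wle L N,
      CoxHecke.Hecke.degLe L N hP4.lrClosed
          (CoxHecke.Hecke.TN L N hP4.lrClosed x * CoxHecke.Hecke.TN L N hP4.lrClosed y) ≤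
        ((N : ℤ) : WithBot ℤ) ∧
      (CoxHecke.Hecke.degLe L N hP4.lrClosed
          (CoxHecke.Hecke.TN L N hP4.lrClosed x * CoxHecke.Hecke.TN L N hP4.lrClosed y) =
        ((N : ℤ) : WithBot ℤ) →
        x ∈ CoxHecke.Hecke.Omega L N ∧ y ∈ CoxHecke.Hecke.Omega L N) := by
  intro x hx y hy
  have hle : CoxHecke.Hecke.degLe L N hP4.lrClosed (CoxHecke.Hecke.TN L N hP4.lrClosed x *
      CoxHecke.Hecke.TN L N hP4.lrClosed y) ≤ ((N : ℤ) : WithBot ℤ) :=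
    CoxHecke.Hecke.degLe_le_of_mem L N hP4.lrClosed
      ((CoxHecke.Hecke.boundedHecke L N hP4.lrClosed).bound x y)
  refine ⟨hle, fun heq => ?_⟩
  -- Elements of $W_{\le N}$ lie outside $\Omega_{>N}$, so for them $\Omega_N$ and $\Omega_{\ge N}$
  -- impose the same condition.
  rw [← CoxHecke.Hecke.notMem_Wgt, hOmega] at hx hy
  by_contra hc
  have h : x ∉ CoxHecke.Hecke.OmegaGe L N ∨ y ∉ CoxHecke.Hecke.OmegaGe L N := by
    by_contra h
    rw [not_or, not_not, not_not] at h
    exact hc ⟨⟨h.1, hx⟩, ⟨h.2, hy⟩⟩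
  have hlt := CoxHecke.Hecke.degLe_le_of_mem L N hP4.lrClosed
    (CoxHecke.Hecke.TN_mul_TN_mem L N hP4.lrClosed hM hOmega h)
  rw [heq] at hlt
  have := WithBot.coe_le_coe.1 hlt
  omega
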